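/- Proposition 2.5 (Convergence). Let $d\ge 1$ and let $\Omega\subset\mathbb{R}^d$ be a nonempty bounded open set with $C^1$ boundary (near each of its boundary points, $\Omega$ is the sublevel set $\{\varphi<0\}$ of a $C^1$ function $\varphi$ whose differential at that point is nonzero; connectedness is not required). For $h>0$ let $$P_h=-\Delta+h^{-2}\mathbf{1}_{\mathbb{R}^d\setminus\Omega}$$ be the unbounded operator on $L^2(\mathbb{R}^d)$ with domain $H^2(\mathbb{R}^d)$. Let $-\Delta_\Omega$ be the Dirichlet Laplacian, i.e. the unbounded operator $u\mapsto-\Delta u$ (weakly) on $L^2(\Omega)$ with domain $\{u\in H^1_0(\Omega):\Delta u\in L^2(\Omega)\}$. List the eigenvalues of each operator in nondecreasing order, repeated according to multiplicity. Then for every integer $n\ge 1$, the $n$-th eigenvalue $\lambda_n^{\mathrm D}$ of $-\Delta_\Omega$ exists; there is $h_0>0$ such that for all $0<h\le h_0$ the operator $P_h$ has an $n$-th eigenvalue $\lambda_n^h$, and $\lambda_n^h\le\frac12h^{-2}$; and $$\lim_{h\to 0^+}\lambda_n^h=\lambda_n^{\mathrm D}.$$ -/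

import Mathlib

open MeasureTheory Filter Topology
open scoped ContDiff

noncomputable section

namespace ParticleInWell

/-- The Euclidean space `ℝ^d`. -/
abbrev Euc (d : ℕ) : Type := EuclideanSpace ℝ (Fin d)

/-- The complex Hilbert space `L²(ℝ^d)`. -/
abbrev L2 (d : ℕ) : Type := Lp ℂ 2 (volume : Measure (Euc d))

/-- The complex Hilbert space `L²(Ω)`. -/
abbrev L2On {d : ℕ} (Ω : Set (Euc d)) : Type := Lp ℂ 2 (volume.restrict Ω : Measure (Euc d))

/-! ### Domains of class `C¹` -/

/-- The boundary of `Ω` is of class `C¹`: near each of its boundary points, `Ω` is the sublevel set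
`{φ < 0}` of a `C¹` function `φ` with nonvanishing differential at that point. (By the implicit
function theorem this says that `Ω` is locally the region on one side of a `C¹` graph.) -/
def HasC1Boundary {d : ℕ} (Ω : Set (Euc d)) : Prop :=
  ∀ x ∈ frontier Ω, ∃ (U : Set (Euc d)) (φ : Euc d → ℝ), IsOpen U ∧ x ∈ U ∧
    ContDiffOn ℝ 1 φ U ∧ fderiv ℝ φ x ≠ 0 ∧ ∀ y ∈ U, (y ∈ Ω ↔ φ y < 0)

/-! ### Eigenvalues of unbounded operators, counted with multiplicity -/

section Eigenvalues

variable {H : Type*} [AddCommGroup H] [Module ℂ H]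

/-- The eigenspace `ker (T - μ)` of a (partially defined) linear operator `T`. -/
def eigenspace (T : H →ₗ.[ℂ] H) (μ : ℂ) : Submodule ℂ H where
  carrier := {u | (u, μ • u) ∈ T.graph}
  zero_mem' := by
    change ((0 : H), μ • (0 : H)) ∈ T.graph
    rw [smul_zero]
    exact T.graph.zero_mem
  add_mem' := by
    intro u v hu hv
    have h := T.graph.add_mem hu hv
    simpa [smul_add] using h
  smul_mem' := by
    intro c u hu
    have h := T.graph.smul_mem c hu
    simpa [smul_comm μ c u] using h

/-- `lam` is the `n`-th eigenvalue (`n = 1, 2, …`) in the nondecreasing list of the real eigenvalues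
of `T`, each repeated according to its multiplicity: the eigenspaces of the eigenvalues `< lam`
have total dimension less than `n`, those of the eigenvalues `≤ lam` have total dimension
at least `n`. (Eigenspaces for distinct eigenvalues are linearly independent, so the dimension of
their span is the sum of the multiplicities.) -/
def IsNthEigenvalue (T : H →ₗ.[ℂ] H) (n : ℕ) (lam : ℝ) : Prop :=
  Module.rank ℂ ↥(⨆ (μ : ℝ) (_ : μ < lam), eigenspace T (μ : ℂ)) < (n : Cardinal) ∧
  (n : Cardinal) ≤ Module.rank ℂ ↥(⨆ (μ : ℝ) (_ : μ ≤ lam), eigenspace T (μ : ℂ))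

/-- There is at most one `n`-th eigenvalue. -/
theorem IsNthEigenvalue.unique {T : H →ₗ.[ℂ] H} {n : ℕ} {a b : ℝ}
    (ha : IsNthEigenvalue T n a) (hb : IsNthEigenvalue T n b) : a = b := by
  have key : ∀ {a b : ℝ}, IsNthEigenvalue T n a → IsNthEigenvalue T n b → ¬ a < b := by
    intro a b ha hb hab
    have hle : (⨆ (μ : ℝ) (_ : μ ≤ a), eigenspace T (μ : ℂ)) ≤
        ⨆ (μ : ℝ) (_ : μ < b), eigenspace T (μ : ℂ) :=
      iSup_mono fun μ => iSup_le fun hμ => le_iSup_of_le (hμ.trans_lt hab) le_rfl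
    exact absurd (ha.2.trans (Submodule.rank_mono hle)) (not_le.mpr hb.1)
  exact le_antisymm (not_lt.mp (key hb ha)) (not_lt.mp (key ha hb))

end Eigenvalues

/-! ### The particle-in-well operator -/

section Well

open TemperedDistribution
open scoped SchwartzMap Laplacian

theorem toTD_zero (d : ℕ) : ((0 : L2 d) : 𝓢'(Euc d, ℂ)) = 0 :=
  map_zero (Lp.toTemperedDistributionCLM ℂ (volume : Measure (Euc d)) 2)

theorem toTD_add {d : ℕ} (u v : L2 d) :
    ((u + v : L2 d) : 𝓢'(Euc d, ℂ)) = (u : 𝓢'(Euc d, ℂ)) + (v : 𝓢'(Euc d, ℂ)) :=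
  map_add (Lp.toTemperedDistributionCLM ℂ (volume : Measure (Euc d)) 2) u v

theorem toTD_smul {d : ℕ} (c : ℂ) (u : L2 d) :
    ((c • u : L2 d) : 𝓢'(Euc d, ℂ)) = c • (u : 𝓢'(Euc d, ℂ)) :=
  map_smul (Lp.toTemperedDistributionCLM ℂ (volume : Measure (Euc d)) 2) c u

theorem laplacianTD_zero (d : ℕ) : Δ (0 : 𝓢'(Euc d, ℂ)) = 0 := by
  rw [← laplacianCLM_apply, map_zero]

theorem laplacianTD_add {d : ℕ} (u v : 𝓢'(Euc d, ℂ)) : Δ (u + v) = Δ u + Δ v := by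
  rw [← laplacianCLM_apply, map_add, laplacianCLM_apply, laplacianCLM_apply]

theorem laplacianTD_smul {d : ℕ} (c : ℂ) (u : 𝓢'(Euc d, ℂ)) : Δ (c • u) = c • Δ u := by
  rw [← laplacianCLM_apply, map_smul, laplacianCLM_apply]

/-- The graph of `P_h = -Δ + h⁻² 1_{Ωᶜ}` on `L²(ℝ^d)` with domain `H²(ℝ^d)`: the pairs `(u, f)`
with `u ∈ H²(ℝ^d)` and `f = -Δ u + h⁻² 1_{Ωᶜ} u`, where `w = Δ u ∈ L²(ℝ^d)` is the distributional
Laplacian of `u`. -/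
def wellGraph {d : ℕ} (Ω : Set (Euc d)) (h : ℝ) : Submodule ℂ (L2 d × L2 d) where
  carrier := {p | MemSobolev 2 2 (p.1 : 𝓢'(Euc d, ℂ)) ∧
    ∃ w : L2 d, (w : 𝓢'(Euc d, ℂ)) = Δ (p.1 : 𝓢'(Euc d, ℂ)) ∧
      ∀ᵐ x, p.2 x = -w x + ((h ^ 2)⁻¹ : ℝ) * Ωᶜ.indicator (fun y => p.1 y) x}
  zero_mem' := by
    refine ⟨?_, 0, ?_, ?_⟩
    · exact toTD_zero d ▸ memSobolev_fun_zero _ _ _ _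
    · change ((0 : L2 d) : 𝓢'(Euc d, ℂ)) = Δ ((0 : L2 d) : 𝓢'(Euc d, ℂ))
      rw [toTD_zero, laplacianTD_zero]
    · filter_upwards [Lp.coeFn_zero ℂ 2 (volume : Measure (Euc d))] with x hx
      change (0 : L2 d) x = -(0 : L2 d) x + _ * Ωᶜ.indicator (fun y => (0 : L2 d) y) x
      by_cases hxΩ : x ∈ Ωᶜ
      · rw [Set.indicator_of_mem hxΩ, hx]; simp
      · rw [Set.indicator_of_notMem hxΩ, hx]; simp
  add_mem' := by
    rintro ⟨u, f⟩ ⟨v, g⟩ ⟨hu, w, hw, hf⟩ ⟨hv, z, hz, hg⟩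
    simp only at hu hw hf hv hz hg
    refine ⟨?_, w + z, ?_, ?_⟩
    · change MemSobolev 2 2 ((u + v : L2 d) : 𝓢'(Euc d, ℂ))
      rw [toTD_add]
      exact hu.add hv
    · change ((w + z : L2 d) : 𝓢'(Euc d, ℂ)) = Δ ((u + v : L2 d) : 𝓢'(Euc d, ℂ))
      rw [toTD_add, toTD_add, laplacianTD_add, hw, hz]
    · filter_upwards [hf, hg, Lp.coeFn_add f g, Lp.coeFn_add u v, Lp.coeFn_add w z]
        with x h1 h2 h3 h4 h5
      change (f + g) x = -(w + z) x + _ * Ωᶜ.indicator (fun y => (u + v) y) x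
      by_cases hxΩ : x ∈ Ωᶜ
      · rw [Set.indicator_of_mem hxΩ] at h1 h2 ⊢
        rw [h3, h4, h5, Pi.add_apply, Pi.add_apply, Pi.add_apply, h1, h2]; ring
      · rw [Set.indicator_of_notMem hxΩ] at h1 h2 ⊢
        rw [h3, h5, Pi.add_apply, Pi.add_apply, h1, h2]; ring
  smul_mem' := by
    rintro c ⟨u, f⟩ ⟨hu, w, hw, hf⟩
    simp only at hu hw hf
    refine ⟨?_, c • w, ?_, ?_⟩
    · change MemSobolev 2 2 ((c • u : L2 d) : 𝓢'(Euc d, ℂ))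
      rw [toTD_smul]
      exact hu.smul c
    · change ((c • w : L2 d) : 𝓢'(Euc d, ℂ)) = Δ ((c • u : L2 d) : 𝓢'(Euc d, ℂ))
      rw [toTD_smul, toTD_smul, laplacianTD_smul, hw]
    · filter_upwards [hf, Lp.coeFn_smul c f, Lp.coeFn_smul c u, Lp.coeFn_smul c w]
        with x h1 h2 h3 h4
      change (c • f) x = -(c • w) x + _ * Ωᶜ.indicator (fun y => (c • u) y) x
      by_cases hxΩ : x ∈ Ωᶜ
      · rw [Set.indicator_of_mem hxΩ] at h1 ⊢
        rw [h2, h3, h4, Pi.smul_apply, Pi.smul_apply, Pi.smul_apply, h1]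
        simp only [smul_eq_mul]; ring
      · rw [Set.indicator_of_notMem hxΩ] at h1 ⊢
        rw [h2, h4, Pi.smul_apply, Pi.smul_apply, h1]
        simp only [smul_eq_mul]; ring

/-- The particle-in-well operator `P_h = -Δ + h⁻² 1_{Ωᶜ}`, as an unbounded operator on `L²(ℝ^d)`
with domain `H²(ℝ^d)`. -/
def wellOperator {d : ℕ} (Ω : Set (Euc d)) (h : ℝ) : L2 d →ₗ.[ℂ] L2 d :=
  (wellGraph Ω h).toLinearPMap

theorem wellOperator_graph {d : ℕ} (Ω : Set (Euc d)) (h : ℝ) :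
    (wellOperator Ω h).graph = wellGraph Ω h := by
  refine Submodule.toLinearPMap_graph_eq _ ?_
  rintro ⟨u, f⟩ ⟨-, w, hw, hf⟩ hu
  simp only at hu hw hf
  subst hu
  have hw0 : w = 0 := by
    have hker : w ∈ (Lp.toTemperedDistributionCLM ℂ (volume : Measure (Euc d)) 2).ker := by
      rw [LinearMap.mem_ker]
      change (w : 𝓢'(Euc d, ℂ)) = 0
      rw [hw, toTD_zero, laplacianTD_zero]
    rw [Lp.ker_toTemperedDistributionCLM_eq_bot] at hker
    simpa using hker
  subst hw0
  refine (Lp.eq_zero_iff_ae_eq_zero).mpr ?_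
  filter_upwards [hf, Lp.coeFn_zero ℂ 2 (volume : Measure (Euc d))] with x h1 h2
  rw [h1]
  by_cases hxΩ : x ∈ Ωᶜ
  · rw [Set.indicator_of_mem hxΩ, h2]; simp
  · rw [Set.indicator_of_notMem hxΩ, h2]; simp

theorem mem_wellOperator_domain {d : ℕ} {Ω : Set (Euc d)} (hΩ : IsOpen Ω) (h : ℝ) (u : L2 d) :
    u ∈ (wellOperator Ω h).domain ↔ MemSobolev 2 2 (u : 𝓢'(Euc d, ℂ)) := by
  rw [LinearPMap.mem_domain_iff, wellOperator_graph]
  refine ⟨fun ⟨_, hf⟩ => hf.1, fun hu => ?_⟩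
  have h0 := hu.laplacian
  rw [sub_self, memSobolev_zero_iff] at h0
  obtain ⟨w, hw⟩ := h0
  refine ⟨-w + (((h ^ 2)⁻¹ : ℝ) : ℂ) • ((Lp.memLp u).indicator hΩ.measurableSet.compl).toLp _,
    hu, w, hw.symm, ?_⟩
  filter_upwards [Lp.coeFn_add (-w)
      ((((h ^ 2)⁻¹ : ℝ) : ℂ) • ((Lp.memLp u).indicator hΩ.measurableSet.compl).toLp _),
    Lp.coeFn_neg w, Lp.coeFn_smul (((h ^ 2)⁻¹ : ℝ) : ℂ)
      (((Lp.memLp u).indicator hΩ.measurableSet.compl).toLp _),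
    ((Lp.memLp u).indicator hΩ.measurableSet.compl).coeFn_toLp] with x h1 h2 h3 h4
  rw [h1, Pi.add_apply, h2, h3, Pi.neg_apply, Pi.smul_apply, h4, smul_eq_mul]

end Well

/-! ### The Dirichlet Laplacian -/

section Dirichlet

/-- Test functions: `φ ∈ C_c^∞(Ω)`. -/
structure IsTestFunction {d : ℕ} (Ω : Set (Euc d)) (φ : Euc d → ℂ) : Prop where
  contDiff : ContDiff ℝ ∞ φ
  hasCompactSupport : HasCompactSupport φ
  tsupport_subset : tsupport φ ⊆ Ω

/-- The partial derivative `∂φ/∂x_i`. -/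
def partialDeriv {d : ℕ} (i : Fin d) (φ : Euc d → ℂ) (x : Euc d) : ℂ :=
  fderiv ℝ φ x (EuclideanSpace.single i 1)

theorem IsTestFunction.memLp {d : ℕ} {Ω : Set (Euc d)} {φ : Euc d → ℂ} (hφ : IsTestFunction Ω φ) :
    MemLp φ 2 (volume.restrict Ω) :=
  (hφ.contDiff.continuous.memLp_of_hasCompactSupport hφ.hasCompactSupport).restrict Ω

theorem IsTestFunction.memLp_partialDeriv {d : ℕ} {Ω : Set (Euc d)} {φ : Euc d → ℂ}
    (hφ : IsTestFunction Ω φ) (i : Fin d) :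
    MemLp (partialDeriv i φ) 2 (volume.restrict Ω) := by
  have h1 : Continuous (partialDeriv i φ) :=
    (hφ.contDiff.continuous_fderiv (by simp)).clm_apply continuous_const
  have h2 : HasCompactSupport (partialDeriv i φ) :=
    hφ.hasCompactSupport.fderiv_apply (𝕜 := ℝ) (EuclideanSpace.single i 1)
  exact (h1.memLp_of_hasCompactSupport h2).restrict Ω

/-- The pairs `(φ, ∇φ)` in `L²(Ω) × L²(Ω)^d` with `φ ∈ C_c^∞(Ω)`. -/
def testGradientGraph {d : ℕ} (Ω : Set (Euc d)) : Submodule ℂ (L2On Ω × (Fin d → L2On Ω)) where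
  carrier := {p | ∃ φ : Euc d → ℂ, IsTestFunction Ω φ ∧ (p.1 =ᵐ[volume.restrict Ω] φ) ∧
    ∀ i, p.2 i =ᵐ[volume.restrict Ω] partialDeriv i φ}
  zero_mem' := by
    refine ⟨0, ⟨contDiff_const, HasCompactSupport.zero, by simp [tsupport]⟩, ?_, fun i => ?_⟩
    · exact Lp.coeFn_zero ℂ 2 (volume.restrict Ω)
    · filter_upwards [Lp.coeFn_zero ℂ 2 (volume.restrict Ω)] with x hx
      change (0 : L2On Ω) x = _
      rw [hx]
      simp [partialDeriv]
  add_mem' := by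
    rintro p q ⟨φ, hφ, h1, h2⟩ ⟨ψ, hψ, h3, h4⟩
    refine ⟨φ + ψ, ⟨hφ.1.add hψ.1, hφ.2.add hψ.2,
      (tsupport_add φ ψ).trans (Set.union_subset hφ.3 hψ.3)⟩, ?_, fun i => ?_⟩
    · filter_upwards [h1, h3, Lp.coeFn_add p.1 q.1] with x a b c
      change (p.1 + q.1) x = φ x + ψ x
      rw [c, Pi.add_apply, a, b]
    · filter_upwards [h2 i, h4 i, Lp.coeFn_add (p.2 i) (q.2 i)] with x a b c
      have hd1 := (hφ.1.differentiable (by simp)) x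
      have hd2 := (hψ.1.differentiable (by simp)) x
      change (p.2 i + q.2 i) x = _
      rw [c, Pi.add_apply, a, b]
      simp [partialDeriv, fderiv_add hd1 hd2]
  smul_mem' := by
    rintro c p ⟨φ, hφ, h1, h2⟩
    refine ⟨c • φ, ⟨contDiff_const.smul hφ.1, hφ.2.smul_left (f := fun _ => c),
      (tsupport_smul_subset_right (fun _ => c) φ).trans hφ.3⟩, ?_, fun i => ?_⟩
    · filter_upwards [h1, Lp.coeFn_smul c p.1] with x a b
      change (c • p.1) x = c • φ x
      rw [b, Pi.smul_apply, a]
    · filter_upwards [h2 i, Lp.coeFn_smul c (p.2 i)] with x a b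
      have hd1 := (hφ.1.differentiable (by simp)) x
      change (c • p.2 i) x = _
      rw [b, Pi.smul_apply, a]
      simp [partialDeriv, fderiv_const_smul hd1]

/-- The pairs `(u, ∇u)` with `u ∈ H¹₀(Ω)`; here `H¹₀(Ω)` is the closure of `C_c^∞(Ω)` with respect
to the `H¹` norm, i.e. `u` and its (weak) gradient are simultaneous `L²` limits of test functions
and of their gradients. -/
def H10Gradient {d : ℕ} (Ω : Set (Euc d)) : Submodule ℂ (L2On Ω × (Fin d → L2On Ω)) :=
  (testGradientGraph Ω).topologicalClosure

/-- The graph of the Dirichlet Laplacian: the pairs `(u, f)` of elements of `L²(Ω)` such that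
`u ∈ H¹₀(Ω)` and `-Δ u = f` weakly, that is, `∫_Ω ∇u · ∇φ = ∫_Ω f φ` for all `φ ∈ C_c^∞(Ω)`. -/
def dirichletGraph {d : ℕ} (Ω : Set (Euc d)) : Submodule ℂ (L2On Ω × L2On Ω) where
  carrier := {p | ∃ g : Fin d → L2On Ω, (p.1, g) ∈ H10Gradient Ω ∧
    ∀ φ : Euc d → ℂ, IsTestFunction Ω φ →
      ∑ i, ∫ x in Ω, g i x * partialDeriv i φ x = ∫ x in Ω, p.2 x * φ x}
  zero_mem' := by
    refine ⟨0, (H10Gradient Ω).zero_mem, fun φ _ => ?_⟩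
    have h0 : ∀ ψ : Euc d → ℂ, ∫ x in Ω, (0 : L2On Ω) x * ψ x = 0 := by
      intro ψ
      refine integral_eq_zero_of_ae ?_
      filter_upwards [Lp.coeFn_zero ℂ 2 (volume.restrict Ω)] with x hx
      rw [hx]; simp
    change ∑ i : Fin d, ∫ x in Ω, (0 : L2On Ω) x * _ = ∫ x in Ω, (0 : L2On Ω) x * _
    simp only [h0, Finset.sum_const_zero]
  add_mem' := by
    rintro ⟨u, f⟩ ⟨v, f'⟩ ⟨g, hg, h⟩ ⟨g', hg', h'⟩
    simp only at h h'
    refine ⟨g + g', (H10Gradient Ω).add_mem hg hg', fun φ hφ => ?_⟩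
    have hadd : ∀ (a b : L2On Ω) (ψ : Euc d → ℂ), MemLp ψ 2 (volume.restrict Ω) →
        ∫ x in Ω, (a + b) x * ψ x = (∫ x in Ω, a x * ψ x) + ∫ x in Ω, b x * ψ x := by
      intro a b ψ hψ
      have ha : Integrable (fun x => a x * ψ x) (volume.restrict Ω) :=
        (Lp.memLp a).integrable_mul hψ
      have hb : Integrable (fun x => b x * ψ x) (volume.restrict Ω) :=
        (Lp.memLp b).integrable_mul hψ
      rw [← integral_add ha hb]
      refine integral_congr_ae ?_
      filter_upwards [Lp.coeFn_add a b] with x hx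
      rw [hx, Pi.add_apply, add_mul]
    change ∑ i, ∫ x in Ω, (g i + g' i) x * _ = ∫ x in Ω, (f + f') x * _
    refine Eq.trans ?_ (hadd f f' φ hφ.memLp).symm
    refine Eq.trans ?_ (congrArg₂ (· + ·) (h φ hφ) (h' φ hφ))
    rw [← Finset.sum_add_distrib]
    exact Finset.sum_congr rfl fun i _ => hadd _ _ _ (hφ.memLp_partialDeriv i)
  smul_mem' := by
    rintro c ⟨u, f⟩ ⟨g, hg, h⟩
    simp only at h
    refine ⟨c • g, (H10Gradient Ω).smul_mem c hg, fun φ hφ => ?_⟩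
    have hsmul : ∀ (a : L2On Ω) (ψ : Euc d → ℂ),
        ∫ x in Ω, (c • a) x * ψ x = c * ∫ x in Ω, a x * ψ x := by
      intro a ψ
      rw [← integral_const_mul]
      refine integral_congr_ae ?_
      filter_upwards [Lp.coeFn_smul c a] with x hx
      rw [hx, Pi.smul_apply, smul_eq_mul, mul_assoc]
    change ∑ i, ∫ x in Ω, (c • g i) x * _ = ∫ x in Ω, (c • f) x * _
    rw [hsmul, ← h φ hφ, Finset.mul_sum]
    exact Finset.sum_congr rfl fun i _ => hsmul _ _

/-- The Dirichlet Laplacian `-Δ` on `Ω` (`Ω` open): the unbounded operator `u ↦ -Δ u` on `L²(Ω)`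
with domain `{u ∈ H¹₀(Ω) : Δ u ∈ L²(Ω)}`. -/
def dirichletLaplacian {d : ℕ} (Ω : Set (Euc d)) : L2On Ω →ₗ.[ℂ] L2On Ω :=
  (dirichletGraph Ω).toLinearPMap

theorem continuous_integral_mul {d : ℕ} (Ω : Set (Euc d)) {ψ : Euc d → ℂ}
    (hψ : MemLp ψ 2 (volume.restrict Ω)) :
    Continuous fun u : L2On Ω => ∫ x in Ω, u x * ψ x := by
  have h : (fun u : L2On Ω => ∫ x in Ω, u x * ψ x) =
      fun u : L2On Ω => inner ℂ (hψ.star.toLp (star ψ)) u := by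
    funext u
    rw [L2.inner_def]
    refine integral_congr_ae ?_
    filter_upwards [hψ.star.coeFn_toLp] with x hx
    rw [hx]
    simp
  rw [h]
  exact continuous_const.inner continuous_id

/-- The second component of an element of `H10Gradient Ω` is the weak gradient of the first. -/
theorem H10Gradient.weak {d : ℕ} {Ω : Set (Euc d)} {p : L2On Ω × (Fin d → L2On Ω)}
    (hp : p ∈ H10Gradient Ω) {ψ : Euc d → ℂ} (hψ : IsTestFunction Ω ψ) (i : Fin d) :
    ∫ x in Ω, p.2 i x * ψ x = - ∫ x in Ω, p.1 x * partialDeriv i ψ x := by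
  have hcl : IsClosed {p : L2On Ω × (Fin d → L2On Ω) |
      ∫ x in Ω, p.2 i x * ψ x = - ∫ x in Ω, p.1 x * partialDeriv i ψ x} := by
    refine isClosed_eq ?_ ?_
    · exact (continuous_integral_mul Ω hψ.memLp).comp
        ((continuous_apply i).comp continuous_snd)
    · exact ((continuous_integral_mul Ω (hψ.memLp_partialDeriv i)).comp continuous_fst).neg
  refine closure_minimal ?_ hcl hp
  rintro q ⟨φ, hφ, h1, h2⟩
  have e1 : ∫ x in Ω, q.2 i x * ψ x = ∫ x, partialDeriv i φ x * ψ x := by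
    refine Eq.trans ?_ (setIntegral_eq_integral_of_forall_compl_eq_zero (s := Ω) ?_)
    · refine integral_congr_ae ?_
      filter_upwards [h2 i] with x hx
      rw [hx]
    · intro x hx
      rw [image_eq_zero_of_notMem_tsupport fun hx' => hx (hψ.tsupport_subset hx'), mul_zero]
  have e2 : ∫ x in Ω, q.1 x * partialDeriv i ψ x = ∫ x, φ x * partialDeriv i ψ x := by
    refine Eq.trans ?_ (setIntegral_eq_integral_of_forall_compl_eq_zero (s := Ω) ?_)
    · refine integral_congr_ae ?_
      filter_upwards [h1] with x hx
      rw [hx]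
    · intro x hx
      rw [image_eq_zero_of_notMem_tsupport fun hx' => hx (hφ.tsupport_subset hx'), zero_mul]
  change ∫ x in Ω, q.2 i x * ψ x = - ∫ x in Ω, q.1 x * partialDeriv i ψ x
  rw [e1, e2, eq_neg_iff_add_eq_zero, add_comm, ← eq_neg_iff_add_eq_zero]
  have hc : ∀ {χ : Euc d → ℂ}, IsTestFunction Ω χ → Continuous (partialDeriv i χ) :=
    fun hχ => (hχ.contDiff.continuous_fderiv (by simp)).clm_apply continuous_const
  exact integral_mul_fderiv_eq_neg_fderiv_mul_of_integrable
    (((hc hφ).mul hψ.contDiff.continuous).integrable_of_hasCompactSupport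
      hψ.hasCompactSupport.mul_left)
    ((hφ.contDiff.continuous.mul (hc hψ)).integrable_of_hasCompactSupport
      hφ.hasCompactSupport.mul_right)
    ((hφ.contDiff.continuous.mul hψ.contDiff.continuous).integrable_of_hasCompactSupport
      hψ.hasCompactSupport.mul_left)
    (fun x _ => hφ.contDiff.differentiable (by simp) x)
    (fun x _ => hψ.contDiff.differentiable (by simp) x)

theorem eq_zero_of_test {d : ℕ} {Ω : Set (Euc d)} (hΩ : IsOpen Ω) (f : L2On Ω)
    (hf : ∀ φ : Euc d → ℂ, IsTestFunction Ω φ → ∫ x in Ω, f x * φ x = 0) : f = 0 := by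
  refine (Lp.eq_zero_iff_ae_eq_zero).mpr ?_
  have hloc : LocallyIntegrableOn f Ω (volume.restrict Ω) :=
    ((Lp.memLp f).locallyIntegrable (by norm_num)).locallyIntegrableOn Ω
  have h := hΩ.ae_eq_zero_of_integral_contDiff_smul_eq_zero hloc (fun g hg hgc hgΩ => by
    have hsub : tsupport (fun x => (g x : ℂ)) ⊆ tsupport g :=
      closure_mono fun x hx => by
        simpa using hx
    have := hf (fun x => (g x : ℂ)) ⟨Complex.ofRealCLM.contDiff.comp hg,
      hgc.comp_left (g := fun t : ℝ => (t : ℂ)) (by simp), hsub.trans hgΩ⟩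
    rw [← this]
    refine integral_congr_ae (Eventually.of_forall fun x => ?_)
    simp [mul_comm])
  filter_upwards [h, ae_restrict_mem hΩ.measurableSet] with x hx hxΩ
  exact hx hxΩ

theorem dirichletLaplacian_graph {d : ℕ} {Ω : Set (Euc d)} (hΩ : IsOpen Ω) :
    (dirichletLaplacian Ω).graph = dirichletGraph Ω := by
  refine Submodule.toLinearPMap_graph_eq _ ?_
  rintro ⟨u, f⟩ ⟨g, hg, hgf⟩ hu
  simp only at hu hg hgf
  subst hu
  have h0 : ∀ ψ : Euc d → ℂ, ∫ x in Ω, (0 : L2On Ω) x * ψ x = 0 := by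
    intro ψ
    refine integral_eq_zero_of_ae ?_
    filter_upwards [Lp.coeFn_zero ℂ 2 (volume.restrict Ω)] with x hx
    rw [hx]; simp
  have hg0 : ∀ i, g i = 0 := fun i => eq_zero_of_test hΩ (g i) fun ψ hψ => by
    have h := H10Gradient.weak hg hψ i
    simp only at h
    rw [h, h0, neg_zero]
  refine eq_zero_of_test hΩ f fun φ hφ => ?_
  rw [← hgf φ hφ]
  simp only [hg0, h0, Finset.sum_const_zero]

end Dirichlet

end ParticleInWell

end

/-! Let κ = (2π)², a factor due to the Fourier normalization, let J be the multiplier (1 +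
|ξ|²)^(-1/2), whose range is H¹(ℝ^d), and let χ be multiplication by the indicator of Ωᶜ. Pulled
back to L² by J, the form of (P_h + κ)/κ becomes ‖v‖² + t‖χJv‖² with t = 1/(κh²). Hence κ(P_h + κ)⁻¹
is R_h = J(1 + tJχJ)⁻¹J.

As h → 0 the penalty t tends to infinity, and (1 + tJχJ)⁻¹ converges strongly to the orthogonal
projection P onto ker χJ, which represents the H¹ functions vanishing outside Ω. The limit is R₀ =
JPJ. The C¹ boundary enters only through `HasC1Boundary.mem_closure_testPotentials`: such functions
are H¹ limits of test functions, so ker χJ represents H¹₀(Ω) and R₀ has the eigenvectors of the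
Dirichlet Laplacian, extended by zero.

The convergence R_h → R₀ holds in operator norm (`tendsto_norm_penalizedResolvent_sub`). Split J =
(1 - χ)J + χJ. The first term is compact by Rellich's theorem, as Ω is bounded, and a compact
operator turns strong convergence of bounded self-adjoint operators into norm convergence. The
second contributes O(t^(-1/2)) by the energy estimate.

Max-min values of quadratic forms move by at most the norm of the perturbation
(`abs_maxMin_sub_le`). Above the distance to a compact operator they are eigenvalues counted with
multiplicity (`isNthEigenvalue_of_maxMin`). R_h is not compact, but its distance to the compact R₀
tends to 0 while the n-th max-min value tends to a positive limit. An eigenvalue s of the resolvent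
corresponds to κ/s - κ, which gives convergence; the bound by h⁻²/2 follows because the limit is
finite. -/

noncomputable section

namespace ParticleInWell

/-! ### Max-min values of self-adjoint operators -/

section MaxMin

open Module

variable {H : Type*} [NormedAddCommGroup H] [InnerProductSpace ℂ H]

/-- The span of the eigenspaces of `A` for the real eigenvalues in `I`. -/
def spectralSpan (A : H →L[ℂ] H) (I : Set ℝ) : Submodule ℂ H :=
  ⨆ (s : ℝ) (_ : s ∈ I), Module.End.eigenspace (A : H →ₗ[ℂ] H) (s : ℂ)

theorem eigenspace_le_spectralSpan (A : H →L[ℂ] H) {I : Set ℝ} {s : ℝ} (hs : s ∈ I) :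
    Module.End.eigenspace (A : H →ₗ[ℂ] H) (s : ℂ) ≤ spectralSpan A I :=
  le_iSup₂_of_le s hs le_rfl

theorem spectralSpan_mono (A : H →L[ℂ] H) {I J : Set ℝ} (h : I ⊆ J) :
    spectralSpan A I ≤ spectralSpan A J :=
  iSup₂_le fun _ hs => eigenspace_le_spectralSpan A (h hs)

theorem reApplyInnerSelf_of_mem_eigenspace (A : H →L[ℂ] H) {s : ℝ} {x : H}
    (hx : x ∈ Module.End.eigenspace (A : H →ₗ[ℂ] H) (s : ℂ)) :
    A.reApplyInnerSelf x = s * ‖x‖ ^ 2 := by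
  rw [Module.End.mem_eigenspace_iff] at hx
  change A x = _ at hx
  rw [ContinuousLinearMap.reApplyInnerSelf_apply, hx, inner_smul_left, inner_self_eq_norm_sq_to_K,
    Complex.conj_ofReal]
  change ((s : ℂ) * ((‖x‖ : ℝ) : ℂ) ^ 2).re = _
  norm_cast

theorem map_mem_spectralSpan (A : H →L[ℂ] H) {I : Set ℝ} {u : H} (hu : u ∈ spectralSpan A I) :
    A u ∈ spectralSpan A I := by
  have : spectralSpan A I ≤ (spectralSpan A I).comap (A : H →ₗ[ℂ] H) := by
    refine iSup₂_le fun s hs x hx => ?_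
    have hx' := hx
    rw [Module.End.mem_eigenspace_iff] at hx
    rw [Submodule.mem_comap, hx]
    exact Submodule.smul_mem _ _ (eigenspace_le_spectralSpan A hs hx')
  exact this hu

/-- Eigenspaces for distinct eigenvalues are mutually orthogonal, so the form and the squared norm
both split over a finite sum of eigenvectors, and the inequality holds termwise. -/
theorem le_reApplyInnerSelf_of_mem_spectralSpan {A : H →L[ℂ] H}
    (hA : (A : H →ₗ[ℂ] H).IsSymmetric) {t : ℝ} {u : H} (hu : u ∈ spectralSpan A (Set.Ici t)) :
    t * ‖u‖ ^ 2 ≤ A.reApplyInnerSelf u := by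
  have hOF : OrthogonalFamily ℂ
      (fun s : Set.Ici t => Module.End.eigenspace (A : H →ₗ[ℂ] H) ((s : ℝ) : ℂ))
      fun s => (Module.End.eigenspace (A : H →ₗ[ℂ] H) ((s : ℝ) : ℂ)).subtypeₗᵢ :=
    hA.orthogonalFamily_eigenspaces.comp (γ := Set.Ici t) (f := fun s => ((s : ℝ) : ℂ))
      (fun a b h => Subtype.ext (Complex.ofReal_injective h))
  rw [spectralSpan, iSup_subtype', Submodule.mem_iSup_iff_exists_finsupp] at hu
  obtain ⟨f, hf, rfl⟩ := hu
  let g : (i : Set.Ici t) → Module.End.eigenspace (A : H →ₗ[ℂ] H) ((i : ℝ) : ℂ) :=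
    fun i => ⟨f i, hf i⟩
  have hsum : f.sum (fun _ x => x) = ∑ i ∈ f.support,
      (Module.End.eigenspace (A : H →ₗ[ℂ] H) ((i : ℝ) : ℂ)).subtypeₗᵢ (g i) := rfl
  have hAsum : A (f.sum fun _ x => x) = ∑ i ∈ f.support,
      (Module.End.eigenspace (A : H →ₗ[ℂ] H) ((i : ℝ) : ℂ)).subtypeₗᵢ (((i : ℝ) : ℂ) • g i) := by
    rw [hsum, map_sum]
    refine Finset.sum_congr rfl fun i _ => ?_
    have := hf i
    rw [Module.End.mem_eigenspace_iff] at this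
    exact this
  rw [ContinuousLinearMap.reApplyInnerSelf_apply, hAsum, hsum, hOF.inner_sum, hOF.norm_sum,
    Finset.mul_sum, map_sum]
  refine Finset.sum_le_sum fun i _ => ?_
  rw [inner_smul_left, inner_self_eq_norm_sq_to_K, Complex.conj_ofReal]
  have h2 : (((i : ℝ) : ℂ) * ((‖g i‖ : ℝ) : ℂ) ^ 2).re = (i : ℝ) * ‖g i‖ ^ 2 := by
    norm_cast
  refine le_of_le_of_eq ?_ h2.symm
  exact mul_le_mul_of_nonneg_right i.2 (by positivity)

/-- The form equals s‖x‖² on the eigenspace and is at least t‖x‖² on the span. -/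
theorem isSymmetric_eq_zero_of_spectralSpan {A : H →L[ℂ] H} {s t : ℝ} (hst : s < t)
    (hA : (A : H →ₗ[ℂ] H).IsSymmetric) {x : H}
    (hx : x ∈ Module.End.eigenspace (A : H →ₗ[ℂ] H) (s : ℂ))
    (hx' : x ∈ spectralSpan A (Set.Ici t)) : x = 0 := by
  have h1 := le_reApplyInnerSelf_of_mem_spectralSpan hA hx'
  rw [reApplyInnerSelf_of_mem_eigenspace A hx] at h1
  by_contra hne
  have : 0 < ‖x‖ ^ 2 := by positivity
  nlinarith

/-- A subspace on which a compact operator is bounded below is finite-dimensional. -/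
theorem finiteDimensional_of_isCompactOperator {F G : Type*} [NormedAddCommGroup F]
    [NormedSpace ℂ F] [NormedAddCommGroup G] [NormedSpace ℂ G] (K : F →L[ℂ] G)
    (hK : IsCompactOperator K) {c : ℝ} (hc : 0 < c) (h : ∀ u, c * ‖u‖ ≤ ‖K u‖) :
    FiniteDimensional ℂ F := by
  by_contra hF
  -- Riesz's lemma gives a bounded sequence with mutual distances at least 1. The images under K
  -- stay at distance c from each other, so no subsequence of them converges.
  obtain ⟨R, f, -, hfR, hf⟩ := exists_seq_norm_le_one_le_norm_sub (𝕜 := ℂ) hF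
  obtain ⟨C, hC, hKC⟩ := hK.image_closedBall_subset_compact (f := (K : F →ₗ[ℂ] G)) R
  obtain ⟨a, -, φ, hφ, ha⟩ := hC.tendsto_subseq (x := fun n => K (f n)) fun n =>
    hKC ⟨f n, by simpa using hfR n, rfl⟩
  have hcau := ha.cauchySeq
  rw [Metric.cauchySeq_iff'] at hcau
  obtain ⟨N, hN⟩ := hcau c hc
  have h1 := hN (N + 1) (by lia)
  have h2 := hf (hφ.injective.ne (show N + 1 ≠ N by lia))
  have h3 := h (f (φ (N + 1)) - f (φ N))
  rw [map_sub] at h3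
  rw [dist_eq_norm] at h1
  simp only [Function.comp] at h1
  nlinarith

variable [CompleteSpace H]

/-- Expand the nonnegative form at x - rBx with r = 1/(‖B‖ + 1); the added 1 keeps r meaningful for
B = 0. It follows that Bx is small whenever the form is small at x. -/
theorem norm_apply_sq_le_of_reApplyInnerSelf_nonneg {B : H →L[ℂ] H} (hB : IsSelfAdjoint B)
    (h : ∀ x, 0 ≤ B.reApplyInnerSelf x) (x : H) :
    ‖B x‖ ^ 2 ≤ (‖B‖ + 1) * B.reApplyInnerSelf x := by
  set r : ℝ := (‖B‖ + 1)⁻¹ with hr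
  have hb : 0 < ‖B‖ + 1 := by positivity
  have hr0 : 0 < r := by positivity
  have hrb : r * (‖B‖ + 1) = 1 := inv_mul_cancel₀ hb.ne'
  have h1 := h (x - (r : ℂ) • B x)
  have hsym : inner ℂ (B (B x)) x = inner ℂ (B x) (B x) := hB.isSymmetric (B x) x
  have h2 : B.reApplyInnerSelf (x - (r : ℂ) • B x) =
      B.reApplyInnerSelf x - 2 * r * ‖B x‖ ^ 2 + r ^ 2 * B.reApplyInnerSelf (B x) := by
    simp only [ContinuousLinearMap.reApplyInnerSelf_apply, map_sub, map_smul, inner_sub_left,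
      inner_sub_right, inner_smul_left, inner_smul_right, Complex.conj_ofReal, hsym]
    have h3 : ∀ (a : ℝ) (z : ℂ), RCLike.re ((a : ℂ) * z) = a * RCLike.re z := by
      intro a z; simp
    simp only [map_sub, h3, inner_self_eq_norm_sq]
    ring
  have h4 : B.reApplyInnerSelf (B x) ≤ ‖B‖ * ‖B x‖ ^ 2 := by
    rw [ContinuousLinearMap.reApplyInnerSelf_apply]
    refine (RCLike.re_le_norm _).trans ((norm_inner_le_norm _ _).trans ?_)
    have := B.le_opNorm (B x)
    nlinarith [norm_nonneg (B x)]
  have h5 : r ^ 2 * B.reApplyInnerSelf (B x) ≤ r * ‖B x‖ ^ 2 := by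
    have : r ^ 2 * ‖B‖ ≤ r := by nlinarith [norm_nonneg B]
    calc r ^ 2 * B.reApplyInnerSelf (B x) ≤ r ^ 2 * (‖B‖ * ‖B x‖ ^ 2) := by gcongr
      _ = (r ^ 2 * ‖B‖) * ‖B x‖ ^ 2 := by ring
      _ ≤ _ := by gcongr
  have h6 : r * ‖B x‖ ^ 2 ≤ B.reApplyInnerSelf x := by linarith
  calc ‖B x‖ ^ 2 = (‖B‖ + 1) * (r * ‖B x‖ ^ 2) := by rw [← mul_assoc, mul_comm _ r, hrb, one_mul]
    _ ≤ _ := by gcongr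

/-- If the supremum of the quadratic form of a self-adjoint operator on the unit sphere exceeds
the part that is not controlled by a compact operator, then it is an eigenvalue. -/
theorem exists_eigenvector_of_lt {A : H →L[ℂ] H} (hA : IsSelfAdjoint A) {G : Type*}
    [NormedAddCommGroup G] [NormedSpace ℂ G] {K : H →L[ℂ] G} (hK : IsCompactOperator K) {δ : ℝ}
    (hAK : ∀ u, A.reApplyInnerSelf u ≤ ‖K u‖ * ‖u‖ + δ * ‖u‖ ^ 2) {t : ℝ} {u : H}
    (hu : u ≠ 0) (htu : t * ‖u‖ ^ 2 ≤ A.reApplyInnerSelf u)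
    (hδ : δ * ‖u‖ ^ 2 < A.reApplyInnerSelf u) :
    ∃ (s : ℝ) (x : H), t ≤ s ∧ A.reApplyInnerSelf u ≤ s * ‖u‖ ^ 2 ∧ x ≠ 0 ∧
      x ∈ Module.End.eigenspace (A : H →ₗ[ℂ] H) (s : ℂ) := by
  set Q : Set ℝ := (fun x => A.reApplyInnerSelf x) '' Metric.sphere 0 1 with hQ
  have hsm : ∀ (r : ℝ) (x : H), A.reApplyInnerSelf ((r : ℂ) • x) =
      r ^ 2 * A.reApplyInnerSelf x := by
    intro r x
    have := ContinuousLinearMap.reApplyInnerSelf_smul A x (c := (r : ℂ))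
    simpa using this
  have hnormal : ∀ x : H, x ≠ 0 → A.reApplyInnerSelf x / ‖x‖ ^ 2 ∈ Q := by
    intro x hx
    refine ⟨((‖x‖⁻¹ : ℝ) : ℂ) • x, ?_, ?_⟩
    · simp [norm_smul, hx]
    · simp only
      rw [hsm]
      field_simp
  have hbdd : BddAbove Q := by
    refine ⟨‖A‖, ?_⟩
    rintro _ ⟨x, hx, rfl⟩
    have hx1 : ‖x‖ = 1 := by simpa using hx
    calc A.reApplyInnerSelf x ≤ ‖inner ℂ (A x) x‖ := by
          rw [ContinuousLinearMap.reApplyInnerSelf_apply]; exact RCLike.re_le_norm _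
      _ ≤ ‖A x‖ * ‖x‖ := norm_inner_le_norm _ _
      _ ≤ ‖A‖ := by rw [hx1, mul_one]; simpa [hx1] using A.le_opNorm x
  set m := sSup Q with hm
  have hum : A.reApplyInnerSelf u / ‖u‖ ^ 2 ≤ m := le_csSup hbdd (hnormal u hu)
  have hu2 : 0 < ‖u‖ ^ 2 := by positivity
  have hum' : A.reApplyInnerSelf u ≤ m * ‖u‖ ^ 2 := (div_le_iff₀ hu2).mp hum
  have hδm : δ < m := by
    by_contra hcon
    nlinarith
  have htm : t ≤ m := by
    by_contra hcon
    nlinarith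
  -- The operator m - A has a nonnegative form with infimum 0 on the unit sphere, so B x → 0 along a
  -- maximizing sequence for A.
  set B : H →L[ℂ] H := (m : ℂ) • ContinuousLinearMap.id ℂ H - A with hB
  have hBre : ∀ x, B.reApplyInnerSelf x = m * ‖x‖ ^ 2 - A.reApplyInnerSelf x := by
    intro x
    have h1 : B x = (m : ℂ) • x - A x := rfl
    rw [ContinuousLinearMap.reApplyInnerSelf_apply, ContinuousLinearMap.reApplyInnerSelf_apply, h1,
      inner_sub_left, map_sub, inner_smul_left, Complex.conj_ofReal, inner_self_eq_norm_sq_to_K]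
    congr 1
    change ((m : ℂ) * ((‖x‖ : ℝ) : ℂ) ^ 2).re = _
    norm_cast
  have hBnonneg : ∀ x, 0 ≤ B.reApplyInnerSelf x := by
    intro x
    rw [hBre]
    by_cases hx : x = 0
    · simp [hx, ContinuousLinearMap.reApplyInnerSelf_apply]
    · have := le_csSup hbdd (hnormal x hx)
      rw [div_le_iff₀ (by positivity)] at this
      linarith
  have hBsa : IsSelfAdjoint B := by
    refine IsSelfAdjoint.sub ?_ hA
    exact IsSelfAdjoint.smul (Complex.conj_ofReal m) (IsSelfAdjoint.one (H →L[ℂ] H))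
  have hBcs := norm_apply_sq_le_of_reApplyInnerSelf_nonneg hBsa hBnonneg
  -- Coercivity modulo a compact operator, useful since δ < m: once K x and B x converge along a
  -- subsequence, so does x.
  have hcoer : ∀ x, (m - δ) * ‖x‖ ≤ ‖K x‖ + ‖B x‖ := by
    intro x
    by_cases hx : x = 0
    · simp [hx]
    have h1 := hAK x
    have h2 := hBre x
    have h3 : B.reApplyInnerSelf x ≤ ‖B x‖ * ‖x‖ := by
      rw [ContinuousLinearMap.reApplyInnerSelf_apply]
      exact (RCLike.re_le_norm _).trans (norm_inner_le_norm _ _)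
    have hx0 : 0 < ‖x‖ := norm_pos_iff.mpr hx
    have : (m - δ) * ‖x‖ * ‖x‖ ≤ (‖K x‖ + ‖B x‖) * ‖x‖ := by nlinarith
    exact le_of_mul_le_mul_right this hx0
  have hseq : ∀ n : ℕ, ∃ x : H, ‖x‖ = 1 ∧ B.reApplyInnerSelf x < 1 / ((n : ℝ) + 1) := by
    intro n
    have hpos : (0 : ℝ) < 1 / ((n : ℝ) + 1) := by positivity
    obtain ⟨_, ⟨x, hx, rfl⟩, hlt⟩ := exists_lt_of_lt_csSup ⟨_, hnormal u hu⟩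
      (show m - 1 / ((n : ℝ) + 1) < sSup Q by linarith)
    have hx1 : ‖x‖ = 1 := by simpa using hx
    refine ⟨x, hx1, ?_⟩
    rw [hBre, hx1]
    simp only at hlt
    linarith
  choose x hx1 hxB using hseq
  have hBx : Tendsto (fun n => B (x n)) atTop (𝓝 0) := by
    rw [tendsto_zero_iff_norm_tendsto_zero]
    have hsq : Tendsto (fun n => ‖B (x n)‖ ^ 2) atTop (𝓝 0) := by
      refine squeeze_zero (fun n => by positivity)
        (fun n => (hBcs (x n)).trans (mul_le_mul_of_nonneg_left (hxB n).le (by positivity))) ?_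
      simpa using (tendsto_one_div_add_atTop_nhds_zero_nat (𝕜 := ℝ)).const_mul (‖B‖ + 1)
    have := hsq.sqrt
    simpa using this
  obtain ⟨C, hC, hKC⟩ := hK.image_closedBall_subset_compact (f := (K : H →ₗ[ℂ] G)) 1
  obtain ⟨a, -, φ, hφ, ha⟩ := hC.tendsto_subseq (x := fun n => K (x n)) fun n =>
    hKC ⟨x n, by simp [hx1 n], rfl⟩
  have hBφ := hBx.comp hφ.tendsto_atTop
  have hxcau : CauchySeq (x ∘ φ) := by
    rw [Metric.cauchySeq_iff']
    intro ε hε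
    have hc : 0 < (m - δ) * ε / 2 := by nlinarith
    obtain ⟨N1, hN1⟩ := Metric.cauchySeq_iff.mp ha.cauchySeq _ hc
    obtain ⟨N2, hN2⟩ := Metric.cauchySeq_iff.mp hBφ.cauchySeq _ hc
    refine ⟨max N1 N2, fun n hn => ?_⟩
    have h1 := hN1 n (le_of_max_le_left hn) (max N1 N2) (le_max_left _ _)
    have h2 := hN2 n (le_of_max_le_right hn) (max N1 N2) (le_max_right _ _)
    have h3 := hcoer (x (φ n) - x (φ (max N1 N2)))
    rw [dist_eq_norm] at h1 h2 ⊢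
    simp only [Function.comp, ← map_sub] at h1 h2 ⊢
    have h4 : (m - δ) * ‖x (φ n) - x (φ (max N1 N2))‖ < (m - δ) * ε := by linarith
    exact lt_of_mul_lt_mul_left h4 (by linarith)
  obtain ⟨y, hy⟩ := cauchySeq_tendsto_of_complete hxcau
  have hyB : B y = 0 := tendsto_nhds_unique ((B.continuous.tendsto y).comp hy) hBφ
  have hy1 : ‖y‖ = 1 := by
    refine tendsto_nhds_unique hy.norm ?_
    simp [hx1]
  refine ⟨m, y, htm, hum', fun h0 => by simp [h0] at hy1, ?_⟩
  rw [Module.End.mem_eigenspace_iff]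
  change A y = (m : ℂ) • y
  have : (m : ℂ) • y - A y = 0 := hyB
  exact (sub_eq_zero.mp this).symm

/-! ### Discreteness of the spectrum above δ -/

section Compact

variable {A : H →L[ℂ] H} (hA : IsSelfAdjoint A) {G : Type*}
    [NormedAddCommGroup G] [NormedSpace ℂ G] {K : H →L[ℂ] G} (hK : IsCompactOperator K) {δ : ℝ}
    (hAK : ∀ u, A.reApplyInnerSelf u ≤ ‖K u‖ * ‖u‖ + δ * ‖u‖ ^ 2)

include hA hK hAK

/-- On the span, t‖u‖² ≤ ⟨Au, u⟩ ≤ ‖Ku‖‖u‖ + δ‖u‖², so the compact K is bounded below there by t -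
δ. -/
theorem finiteDimensional_spectralSpan {t : ℝ} (ht : δ < t) :
    FiniteDimensional ℂ (spectralSpan A (Set.Ici t)) := by
  refine finiteDimensional_of_isCompactOperator (K ∘L (spectralSpan A (Set.Ici t)).subtypeL)
    (hK.comp_clm _) (sub_pos.mpr ht) fun u => ?_
  by_cases hu : (u : H) = 0
  · simp [hu]
  have h1 := le_reApplyInnerSelf_of_mem_spectralSpan hA.isSymmetric u.2
  have h2 := hAK u
  have h3 : 0 < ‖(u : H)‖ := norm_pos_iff.mpr hu
  change (t - δ) * ‖(u : H)‖ ≤ ‖K u‖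
  refine le_of_mul_le_mul_right ?_ h3
  nlinarith

/-- The orthogonal complement of the span is invariant under A, and the existence of an eigenvector
applies to the restriction. Were its eigenvalue in I, the eigenvector would lie in the span and be
orthogonal to it. -/
theorem exists_eigenvector_mem_orthogonal {I : Set ℝ} {t : ℝ} {u : H}
    (huI : u ∈ (spectralSpan A I)ᗮ)
    (hu : u ≠ 0) (htu : t * ‖u‖ ^ 2 ≤ A.reApplyInnerSelf u)
    (hδ : δ * ‖u‖ ^ 2 < A.reApplyInnerSelf u) :
    ∃ s : ℝ, t ≤ s ∧ A.reApplyInnerSelf u ≤ s * ‖u‖ ^ 2 ∧ s ∉ I := by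
  have hmap : ∀ x : (spectralSpan A I)ᗮ, A x ∈ (spectralSpan A I)ᗮ := by
    intro x
    rw [Submodule.mem_orthogonal]
    intro y hy
    rw [← hA.isSymmetric.apply_clm y x]
    exact (Submodule.mem_orthogonal _ _).mp x.2 _ (map_mem_spectralSpan A hy)
  let A' : (spectralSpan A I)ᗮ →L[ℂ] (spectralSpan A I)ᗮ :=
    (A ∘L ((spectralSpan A I)ᗮ).subtypeL).codRestrict _ hmap
  have hA'sym : (A' : (spectralSpan A I)ᗮ →ₗ[ℂ] (spectralSpan A I)ᗮ).IsSymmetric :=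
    fun x y => hA.isSymmetric x y
  have hA' : IsSelfAdjoint A' := hA'sym.isSelfAdjoint
  obtain ⟨s, x, hts, hus, hx0, hx⟩ := exists_eigenvector_of_lt hA'
    (K := K ∘L ((spectralSpan A I)ᗮ).subtypeL) (hK.comp_clm _) (δ := δ) (fun v => hAK v)
    (u := ⟨u, huI⟩) (t := t) (fun h => hu (congrArg Subtype.val h)) htu hδ
  refine ⟨s, hts, hus, fun hsI => hx0 ?_⟩
  rw [Module.End.mem_eigenspace_iff] at hx
  have hx' : (x : H) ∈ Module.End.eigenspace (A : H →ₗ[ℂ] H) (s : ℂ) := by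
    rw [Module.End.mem_eigenspace_iff]
    exact congrArg Subtype.val hx
  have h1 := (Submodule.mem_orthogonal _ _).mp x.2 _ (eigenspace_le_spectralSpan A hsI hx')
  exact Subtype.ext (inner_self_eq_zero.mp h1)

/-- The orthogonal projection of S to the spectral span is injective: a nonzero vector of S in its
kernel would yield an eigenvalue that is at least t and yet outside [t, ∞). -/
theorem le_finrank_spectralSpan {S : Submodule ℂ H} {n : ℕ} (hn : 1 ≤ n) (hS : n ≤ finrank ℂ S)
    {t : ℝ} (ht : δ < t) (hSt : ∀ u ∈ S, t * ‖u‖ ^ 2 ≤ A.reApplyInnerSelf u) :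
    n ≤ finrank ℂ (spectralSpan A (Set.Ici t)) := by
  have hfd := finiteDimensional_spectralSpan hA hK hAK ht
  have hSfd : FiniteDimensional ℂ S := Module.finite_of_finrank_pos (by lia)
  let P : S →ₗ[ℂ] spectralSpan A (Set.Ici t) :=
    ((spectralSpan A (Set.Ici t)).orthogonalProjectionOnto : H →ₗ[ℂ] _).comp S.subtype
  refine hS.trans (LinearMap.finrank_le_finrank_of_injective (f := P) ?_)
  rw [← LinearMap.ker_eq_bot, LinearMap.ker_eq_bot']
  intro u hu
  have hu' : (u : H) ∈ (spectralSpan A (Set.Ici t))ᗮ :=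
    Submodule.orthogonalProjectionOnto_eq_zero_iff.mp hu
  by_contra hne
  have hne' : (u : H) ≠ 0 := fun h => hne (Subtype.ext h)
  have h1 := hSt u u.2
  have h2 : 0 < ‖(u : H)‖ ^ 2 := by positivity
  obtain ⟨s, hs, -, hsI⟩ := exists_eigenvector_mem_orthogonal hA hK hAK hu' hne' h1 (by nlinarith)
  exact hsI hs

end Compact

/-- The levels `t` such that the quadratic form of `A` is at least `t` on a subspace of dimension at
least `n`. -/
def minLevels (A : H →L[ℂ] H) (n : ℕ) : Set ℝ :=
  {t | ∃ S : Submodule ℂ H, n ≤ finrank ℂ S ∧ ∀ u ∈ S, t * ‖u‖ ^ 2 ≤ A.reApplyInnerSelf u}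

/-- The `n`-th max-min value of the quadratic form of `A`. -/
def maxMin (A : H →L[ℂ] H) (n : ℕ) : ℝ := sSup (minLevels A n)

omit [CompleteSpace H] in
theorem abs_reApplyInnerSelf_le (A : H →L[ℂ] H) (u : H) :
    |A.reApplyInnerSelf u| ≤ ‖A‖ * ‖u‖ ^ 2 := by
  rw [ContinuousLinearMap.reApplyInnerSelf_apply]
  refine (RCLike.abs_re_le_norm _).trans ((norm_inner_le_norm _ _).trans ?_)
  have := A.le_opNorm u
  nlinarith [norm_nonneg u]

-- The condition n ≥ 1 provides a nonzero vector in the subspace; on the zero subspace every real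
-- number would be a level.
omit [CompleteSpace H] in
theorem bddAbove_minLevels (A : H →L[ℂ] H) {n : ℕ} (hn : 1 ≤ n) : BddAbove (minLevels A n) := by
  refine ⟨‖A‖, ?_⟩
  rintro t ⟨S, hS, hSt⟩
  have : Nontrivial S := Module.nontrivial_of_finrank_pos (R := ℂ) (by lia)
  obtain ⟨u, hu⟩ := exists_ne (0 : S)
  have hu' : (u : H) ≠ 0 := fun h => hu (Subtype.ext h)
  have h1 := hSt u u.2
  have h2 := (abs_le.mp (abs_reApplyInnerSelf_le A u)).2
  have h3 : 0 < ‖(u : H)‖ ^ 2 := by positivity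
  exact le_of_mul_le_mul_right (h1.trans h2) h3

-- A level t of A on a subspace is a level t - ‖A - K‖ of K on the same subspace. The role of S is
-- to make the set of levels nonempty, so that its supremum is meaningful.
omit [CompleteSpace H] in
theorem maxMin_le_add_norm_sub (A K : H →L[ℂ] H) {n : ℕ} (hn : 1 ≤ n) {S : Submodule ℂ H}
    (hS : n ≤ finrank ℂ S) : maxMin A n ≤ maxMin K n + ‖A - K‖ := by
  refine csSup_le ⟨-‖A‖, S, hS, fun u _ => ?_⟩ ?_
  · linarith [(abs_le.mp (abs_reApplyInnerSelf_le A u)).1]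
  · rintro t ⟨T, hT, hTt⟩
    have : t - ‖A - K‖ ≤ maxMin K n := by
      refine le_csSup (bddAbove_minLevels K hn) ⟨T, hT, fun u hu => ?_⟩
      have h1 := hTt u hu
      have h2 := (abs_le.mp (abs_reApplyInnerSelf_le (A - K) u)).2
      have h3 : (A - K).reApplyInnerSelf u = A.reApplyInnerSelf u - K.reApplyInnerSelf u := by
        simp [ContinuousLinearMap.reApplyInnerSelf_apply, inner_sub_left]
      linarith
    linarith

omit [CompleteSpace H] in
theorem abs_maxMin_sub_le (A K : H →L[ℂ] H) {n : ℕ} (hn : 1 ≤ n) {S : Submodule ℂ H}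
    (hS : n ≤ finrank ℂ S) : |maxMin A n - maxMin K n| ≤ ‖A - K‖ := by
  have h1 := maxMin_le_add_norm_sub A K hn hS
  have h2 := maxMin_le_add_norm_sub K A hn hS
  rw [norm_sub_rev] at h2
  rw [abs_le]
  constructor <;> linarith

/-! ### Max-min values as eigenvalues with multiplicity -/

section CompactRank

variable {A : H →L[ℂ] H} (hA : IsSelfAdjoint A) {G : Type*}
    [NormedAddCommGroup G] [NormedSpace ℂ G] {K : H →L[ℂ] G} (hK : IsCompactOperator K) {δ : ℝ}
    (hAK : ∀ u, A.reApplyInnerSelf u ≤ ‖K u‖ * ‖u‖ + δ * ‖u‖ ^ 2)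
    {n : ℕ} (hn : 1 ≤ n) (hδ : δ < maxMin A n) {S : Submodule ℂ H} (hS : n ≤ finrank ℂ S)

include hA hK hAK hn hδ hS

/-- The dimension of the span over [t, ∞) is an integer, so below the max-min value it is constant
once t is close enough. There are then no eigenvalues between such a t and the max-min value, and
the span over [t, ∞) has dimension at least n by comparison with a nearly optimal subspace. -/
theorem le_rank_spectralSpan_maxMin :
    (n : Cardinal) ≤ Module.rank ℂ (spectralSpan A (Set.Ici (maxMin A n))) := by
  obtain ⟨t₁, ⟨ht₁δ, ht₁⟩, hmin⟩ : ∃ t ∈ Set.Ioo δ (maxMin A n), ∀ r ∈ Set.Ioo δ (maxMin A n),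
      finrank ℂ (spectralSpan A (Set.Ici t)) ≤ finrank ℂ (spectralSpan A (Set.Ici r)) := by
    obtain ⟨c, hc⟩ := exists_between hδ
    exact ⟨_, Function.argminOn_mem _ _ ⟨c, hc⟩,
      fun r hr => Function.argminOn_le (fun t => finrank ℂ (spectralSpan A (Set.Ici t))) _ hr⟩
  have hfd := finiteDimensional_spectralSpan hA hK hAK ht₁δ
  have heq : ∀ r, t₁ ≤ r → r < maxMin A n →
      spectralSpan A (Set.Ici r) = spectralSpan A (Set.Ici t₁) := fun r hr hr' =>
    Submodule.eq_of_le_of_finrank_le (spectralSpan_mono A (Set.Ici_subset_Ici.mpr hr))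
      (hmin r ⟨ht₁δ.trans_le hr, hr'⟩)
  have hle : spectralSpan A (Set.Ici t₁) ≤ spectralSpan A (Set.Ici (maxMin A n)) := by
    refine iSup₂_le fun s hs x hx => ?_
    rcases lt_or_ge s (maxMin A n) with hlt | hge
    · obtain ⟨r, hr, hr'⟩ := exists_between hlt
      have hxr : x ∈ spectralSpan A (Set.Ici r) := by
        rw [heq r (le_trans hs hr.le) hr']
        exact eigenspace_le_spectralSpan A hs hx
      rw [isSymmetric_eq_zero_of_spectralSpan hr hA.isSymmetric hx hxr]
      exact Submodule.zero_mem _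
    · exact eigenspace_le_spectralSpan A (show s ∈ Set.Ici _ from hge) hx
  refine le_trans ?_ (Submodule.rank_mono hle)
  rw [← finrank_eq_rank, Nat.cast_le]
  obtain ⟨t, ⟨T, hT, hTt⟩, ht⟩ := exists_lt_of_lt_csSup
    (show (minLevels A n).Nonempty from ⟨-‖A‖, S, hS, fun u _ => by
      linarith [(abs_le.mp (abs_reApplyInnerSelf_le A u)).1]⟩) ht₁
  exact le_finrank_spectralSpan hA hK hAK hn hT ht₁δ fun u hu =>
    le_trans (by gcongr) (hTt u hu)

-- For r above the max-min value the span over [r, ∞) has dimension less than n, since otherwise r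
-- would be a level. These spans grow as r decreases and must become constant, so their union is one
-- of them.
omit hS in
theorem rank_spectralSpan_maxMin_lt :
    Module.rank ℂ (spectralSpan A (Set.Ioi (maxMin A n))) < (n : Cardinal) := by
  have hfd := finiteDimensional_spectralSpan hA hK hAK hδ
  have hbound : ∀ r : ℝ, maxMin A n < r → FiniteDimensional ℂ (spectralSpan A (Set.Ici r)) :=
    fun r hr => finiteDimensional_spectralSpan hA hK hAK (hδ.trans hr)
  have hlt : ∀ r : ℝ, maxMin A n < r → finrank ℂ (spectralSpan A (Set.Ici r)) < n := by
    intro r hr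
    by_contra! hcon
    refine absurd (le_csSup (bddAbove_minLevels A hn) ⟨_, hcon, fun u hu => ?_⟩) (not_le.mpr hr)
    exact le_reApplyInnerSelf_of_mem_spectralSpan hA.isSymmetric hu
  -- Minimizing the truncated difference n - dim maximizes dim, because dim < n throughout.
  obtain ⟨t₁, ht₁, hmax⟩ : ∃ t ∈ Set.Ioi (maxMin A n), ∀ r ∈ Set.Ioi (maxMin A n),
      n - finrank ℂ (spectralSpan A (Set.Ici t)) ≤ n - finrank ℂ (spectralSpan A (Set.Ici r)) :=
    ⟨_, Function.argminOn_mem _ _ (⟨maxMin A n + 1, lt_add_one (maxMin A n)⟩ :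
      (Set.Ioi (maxMin A n)).Nonempty),
      fun r hr => Function.argminOn_le (fun t => n - finrank ℂ (spectralSpan A (Set.Ici t))) _ hr⟩
  have hle : spectralSpan A (Set.Ioi (maxMin A n)) ≤ spectralSpan A (Set.Ici t₁) := by
    refine iSup₂_le fun s hs => ?_
    have hr : maxMin A n < min s t₁ := lt_min hs ht₁
    have := hbound _ hr
    have h1 := hmax _ hr
    have h2 := hlt _ hr
    have h3 := hlt _ ht₁
    rw [Submodule.eq_of_le_of_finrank_le
      (spectralSpan_mono A (Set.Ici_subset_Ici.mpr (min_le_right s t₁))) (by lia)]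
    exact eigenspace_le_spectralSpan A (Set.mem_Ici.mpr (min_le_left s t₁))
  have := hbound _ ht₁
  refine (Submodule.rank_mono hle).trans_lt ?_
  rw [← finrank_eq_rank, Nat.cast_lt]
  exact hlt _ ht₁

end CompactRank

end MaxMin

/-! ### Norm resolvent convergence under penalization -/

section Penalization

open ContinuousLinearMap Module

variable {V H G : Type*} [NormedAddCommGroup V] [InnerProductSpace ℂ V] [CompleteSpace V]
  [NormedAddCommGroup H] [InnerProductSpace ℂ H] [CompleteSpace H]
  [NormedAddCommGroup G] [InnerProductSpace ℂ G] [CompleteSpace G]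

/-- A compact operator turns strong convergence to `0` of self-adjoint operators into norm
convergence. -/
theorem tendsto_norm_comp_of_isCompactOperator {C : V →L[ℂ] G} (hC : IsCompactOperator C)
    {S : ℕ → V →L[ℂ] V} (hS : ∀ k, IsSelfAdjoint (S k)) {M : ℝ} (hM : ∀ k, ‖S k‖ ≤ M)
    (hS0 : ∀ f, Tendsto (fun k => S k f) atTop (𝓝 0)) :
    Tendsto (fun k => ‖C ∘L S k‖) atTop (𝓝 0) := by
  have hM0 : 0 ≤ M := (norm_nonneg _).trans (hM 0)
  by_contra hcon
  rw [Metric.tendsto_atTop] at hcon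
  push Not at hcon
  obtain ⟨ε, hε, hcon⟩ := hcon
  obtain ⟨φ, hφ, hφε⟩ := Filter.extraction_of_frequently_atTop (frequently_atTop.mpr hcon)
  have hx : ∀ k, ∃ x : V, ‖x‖ ≤ 1 ∧ ε / 2 < ‖C (S (φ k) x)‖ := by
    intro k
    by_contra! h
    have h1 : ‖C ∘L S (φ k)‖ ≤ ε / 2 := by
      refine ContinuousLinearMap.opNorm_le_of_unit_norm (𝕜 := ℂ) (by positivity)
        fun x hx => h x hx.le
    have h2 := hφε k
    rw [dist_zero_right, norm_norm] at h2
    linarith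
  choose x hx1 hxε using hx
  obtain ⟨D, hD, hCD⟩ := hC.image_closedBall_subset_compact (f := (C : V →ₗ[ℂ] G)) M
  obtain ⟨z, -, ψ, hψ, hz⟩ := hD.tendsto_subseq (x := fun k => C (S (φ k) (x k))) fun k => by
    refine hCD ⟨_, ?_, rfl⟩
    rw [mem_closedBall_zero_iff]
    calc ‖S (φ k) (x k)‖ ≤ ‖S (φ k)‖ * ‖x k‖ := (S (φ k)).le_opNorm _
      _ ≤ M * 1 := by gcongr; exacts [hM _, hx1 k]
      _ = M := mul_one M
  -- Passing to adjoints, ⟨z, C S x⟩ = ⟨S C* z, x⟩, and S C* z → 0 by strong convergence at the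
  -- single vector C* z.
  have hz0 : inner ℂ z z = (0 : ℂ) := by
    have h1 : Tendsto (fun k => inner ℂ z (C (S (φ (ψ k)) (x (ψ k))))) atTop (𝓝 (inner ℂ z z)) :=
      (tendsto_const_nhds).inner hz
    have h2 : Tendsto (fun k => S (φ (ψ k)) (adjoint C z)) atTop (𝓝 0) :=
      (hS0 _).comp (hφ.tendsto_atTop.comp hψ.tendsto_atTop)
    refine tendsto_nhds_unique h1 ?_
    rw [tendsto_zero_iff_norm_tendsto_zero]
    refine squeeze_zero (fun _ => norm_nonneg _) (fun k => ?_)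
      (tendsto_zero_iff_norm_tendsto_zero.mp h2)
    rw [← adjoint_inner_left, ← (hS (φ (ψ k))).isSymmetric.apply_clm]
    refine (norm_inner_le_norm _ _).trans ?_
    exact mul_le_of_le_one_right (norm_nonneg _) (hx1 _)
  rw [inner_self_eq_zero] at hz0
  have h3 : ε / 2 ≤ ‖z‖ := ge_of_tendsto' hz.norm fun k => (hxε _).le
  rw [hz0, norm_zero] at h3
  linarith

/-- The penalized form operator `1 + t B* B`. -/
def penalization (B : V →L[ℂ] H) (t : ℝ) : V →L[ℂ] V := 1 + (t : ℂ) • (adjoint B ∘L B)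

theorem penalization_apply (B : V →L[ℂ] H) (t : ℝ) (u : V) :
    penalization B t u = u + (t : ℂ) • adjoint B (B u) := rfl

theorem re_inner_penalization (B : V →L[ℂ] H) (t : ℝ) (u : V) :
    RCLike.re (inner ℂ (penalization B t u) u) = ‖u‖ ^ 2 + t * ‖B u‖ ^ 2 := by
  have h3 : ∀ (a : ℝ) (z : ℂ), RCLike.re ((a : ℂ) * z) = a * RCLike.re z := by
    intro a z; simp
  rw [penalization_apply, inner_add_left, inner_smul_left, Complex.conj_ofReal, adjoint_inner_left,
    map_add, h3, inner_self_eq_norm_sq, inner_self_eq_norm_sq]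

theorem isSelfAdjoint_penalization (B : V →L[ℂ] H) (t : ℝ) : IsSelfAdjoint (penalization B t) := by
  refine (IsSelfAdjoint.one _).add (IsSelfAdjoint.smul (Complex.conj_ofReal t) ?_)
  rw [isSelfAdjoint_iff', adjoint_comp, adjoint_adjoint]

/-- Lax–Milgram: the real part of the form is at least ‖x‖². -/
theorem isUnit_penalization (B : V →L[ℂ] H) {t : ℝ} (ht : 0 ≤ t) : IsUnit (penalization B t) := by
  refine isUnit_of_forall_le_norm_inner_map _ (c := 1) one_pos fun x => ?_
  have h1 := re_inner_penalization B t x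
  have h2 := RCLike.re_le_norm (inner ℂ (penalization B t x) x)
  have h3 : 0 ≤ t * ‖B x‖ ^ 2 := by positivity
  simp only [NNReal.coe_one, mul_one]
  linarith

theorem penalization_inverse (B : V →L[ℂ] H) {t : ℝ} (ht : 0 ≤ t) (f : V) :
    penalization B t (Ring.inverse (penalization B t) f) = f := by
  have := Ring.mul_inverse_cancel _ (isUnit_penalization B ht)
  exact congrArg (fun T : V →L[ℂ] V => T f) this

theorem inverse_penalization (B : V →L[ℂ] H) {t : ℝ} (ht : 0 ≤ t) (f : V) :
    Ring.inverse (penalization B t) (penalization B t f) = f := by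
  have := Ring.inverse_mul_cancel _ (isUnit_penalization B ht)
  exact congrArg (fun T : V →L[ℂ] V => T f) this

theorem isSelfAdjoint_inverse_penalization (B : V →L[ℂ] H) {t : ℝ} (ht : 0 ≤ t) :
    IsSelfAdjoint (Ring.inverse (penalization B t)) := by
  rw [isSelfAdjoint_iff_isSymmetric]
  intro f g
  have h := (isSelfAdjoint_penalization B t).isSymmetric
    (Ring.inverse (penalization B t) f) (Ring.inverse (penalization B t) g)
  simp only [coe_coe, penalization_inverse B ht] at h
  exact h.symm

/-- The energy identity, obtained by pairing the equation with its solution. All later bounds on the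
penalized inverse come from it. -/
theorem norm_sq_inverse_penalization (B : V →L[ℂ] H) {t : ℝ} (ht : 0 ≤ t) (f : V) :
    ‖Ring.inverse (penalization B t) f‖ ^ 2 + t * ‖B (Ring.inverse (penalization B t) f)‖ ^ 2 =
      RCLike.re (inner ℂ f (Ring.inverse (penalization B t) f)) := by
  rw [← re_inner_penalization, penalization_inverse B ht]

theorem norm_inverse_penalization_apply_le (B : V →L[ℂ] H) {t : ℝ} (ht : 0 ≤ t) (f : V) :
    ‖Ring.inverse (penalization B t) f‖ ≤ ‖f‖ := by
  have h1 := norm_sq_inverse_penalization B ht f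
  have h2 := (RCLike.re_le_norm _).trans
    (norm_inner_le_norm (𝕜 := ℂ) f (Ring.inverse (penalization B t) f))
  have h3 : 0 ≤ t * ‖B (Ring.inverse (penalization B t) f)‖ ^ 2 := by positivity
  nlinarith [norm_nonneg f, norm_nonneg (Ring.inverse (penalization B t) f)]

theorem mul_norm_sq_inverse_penalization_le (B : V →L[ℂ] H) {t : ℝ} (ht : 0 ≤ t) (f : V) :
    t * ‖B (Ring.inverse (penalization B t) f)‖ ^ 2 ≤ ‖f‖ ^ 2 := by
  have h1 := norm_sq_inverse_penalization B ht f
  have h2 := (RCLike.re_le_norm _).trans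
    (norm_inner_le_norm (𝕜 := ℂ) f (Ring.inverse (penalization B t) f))
  have h3 := norm_inverse_penalization_apply_le B ht f
  nlinarith [norm_nonneg f, norm_nonneg (Ring.inverse (penalization B t) f)]

/-- For data B*w the energy identity reads ‖u‖² + t‖Bu‖² = Re⟨w, Bu⟩; multiply by t and complete the
square in t‖Bu‖. The solution thus decays like t^(-1/2) on the range of B*. -/
theorem mul_norm_sq_inverse_penalization_adjoint_le (B : V →L[ℂ] H) {t : ℝ} (ht : 0 < t) (w : H) :
    t * ‖Ring.inverse (penalization B t) (adjoint B w)‖ ^ 2 ≤ ‖w‖ ^ 2 := by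
  set u := Ring.inverse (penalization B t) (adjoint B w) with hu
  have h1 := norm_sq_inverse_penalization B ht.le (adjoint B w)
  rw [← hu, adjoint_inner_left] at h1
  have h2 := (RCLike.re_le_norm _).trans (norm_inner_le_norm (𝕜 := ℂ) w (B u))
  have h3 : 0 ≤ (‖w‖ - t * ‖B u‖) ^ 2 := by positivity
  have h4 : t * ‖u‖ ^ 2 + (t * ‖B u‖) ^ 2 ≤ ‖w‖ * (t * ‖B u‖) := by nlinarith
  nlinarith [sq_nonneg (‖w‖ - 2 * (t * ‖B u‖))]

/-- The inverse fixes ker B. The orthogonal complement of ker B is the closure of the range of B*,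
where the inverse decays; the inverses being contractions, decay on the range passes to the closure.
-/
theorem tendsto_inverse_penalization (B : V →L[ℂ] H) {t : ℕ → ℝ} (ht0 : ∀ k, 0 < t k)
    (ht : Tendsto t atTop atTop) (f : V) :
    Tendsto (fun k => Ring.inverse (penalization B (t k)) f) atTop
      (𝓝 (B.ker.starProjection f)) := by
  have hfix : ∀ k, Ring.inverse (penalization B (t k)) (B.ker.starProjection f) =
      B.ker.starProjection f := by
    intro k
    have hmem : B (B.ker.starProjection f) = 0 := Submodule.starProjection_apply_mem B.ker f
    have h1 : penalization B (t k) (B.ker.starProjection f) = B.ker.starProjection f := by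
      rw [penalization_apply, hmem, map_zero, smul_zero, add_zero]
    conv_lhs => rw [← h1]
    exact inverse_penalization B (ht0 k).le _
  have hg : f - B.ker.starProjection f ∈ closure (Set.range (adjoint B)) := by
    have h1 : f - B.ker.starProjection f ∈ B.kerᗮ := Submodule.sub_starProjection_mem_orthogonal f
    rw [ContinuousLinearMap.orthogonal_ker] at h1
    exact h1
  rw [Metric.tendsto_atTop]
  intro ε hε
  obtain ⟨_, ⟨w, rfl⟩, hw⟩ := Metric.mem_closure_iff.mp hg (ε / 2) (by positivity)
  obtain ⟨N, hN⟩ := (ht.eventually_gt_atTop (‖w‖ ^ 2 / (ε / 2) ^ 2)).exists_forall_of_atTop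
  refine ⟨N, fun k hk => ?_⟩
  have e1 : Ring.inverse (penalization B (t k)) f - B.ker.starProjection f =
      Ring.inverse (penalization B (t k)) (f - B.ker.starProjection f - adjoint B w) +
        Ring.inverse (penalization B (t k)) (adjoint B w) := by
    rw [map_sub, map_sub, hfix, sub_add_cancel]
  have h2 : ‖Ring.inverse (penalization B (t k)) (adjoint B w)‖ ≤ ε / 2 := by
    have h3 := mul_norm_sq_inverse_penalization_adjoint_le B (ht0 k) w
    have h4 := hN k hk
    rw [div_lt_iff₀ (by positivity)] at h4
    by_contra! hcon
    have h5 : (ε / 2) ^ 2 < ‖Ring.inverse (penalization B (t k)) (adjoint B w)‖ ^ 2 := by gcongr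
    have h6 := mul_lt_mul_of_pos_left h5 (ht0 k)
    linarith
  have h3 := norm_inverse_penalization_apply_le B (ht0 k).le
    (f - B.ker.starProjection f - adjoint B w)
  rw [dist_eq_norm] at hw ⊢
  rw [e1]
  exact (norm_add_le _ _).trans_lt (by linarith)

/-- The resolvent of the operator associated with the form `‖v‖² + t ‖B v‖²` on `V`, seen in `H`
through `j`. -/
def penalizedResolvent (j B : V →L[ℂ] H) (t : ℝ) : H →L[ℂ] H :=
  j ∘L Ring.inverse (penalization B t) ∘L adjoint j

/-- The limit of `penalizedResolvent j B t` as `t → ∞`. -/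
def constrainedResolvent (j B : V →L[ℂ] H) : H →L[ℂ] H :=
  j ∘L B.ker.starProjection ∘L adjoint j

theorem isSelfAdjoint_penalizedResolvent (j B : V →L[ℂ] H) {t : ℝ} (ht : 0 ≤ t) :
    IsSelfAdjoint (penalizedResolvent j B t) := by
  have := (isSelfAdjoint_inverse_penalization B ht).conj_adjoint j
  exact this

theorem isSelfAdjoint_constrainedResolvent (j B : V →L[ℂ] H) :
    IsSelfAdjoint (constrainedResolvent j B) :=
  (isSelfAdjoint_starProjection B.ker).conj_adjoint j

theorem reApplyInnerSelf_penalizedResolvent_nonneg (j B : V →L[ℂ] H) {t : ℝ} (ht : 0 ≤ t) (u : H) :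
    0 ≤ (penalizedResolvent j B t).reApplyInnerSelf u := by
  have h := norm_sq_inverse_penalization B ht (adjoint j u)
  rw [reApplyInnerSelf_apply]
  change 0 ≤ RCLike.re (inner ℂ (j (Ring.inverse (penalization B t) (adjoint j u))) u)
  rw [← adjoint_inner_right, inner_re_symm, ← h]
  positivity

theorem reApplyInnerSelf_constrainedResolvent (j B : V →L[ℂ] H) (u : H) :
    (constrainedResolvent j B).reApplyInnerSelf u =
      ‖B.ker.starProjection (adjoint j u)‖ ^ 2 := by
  rw [reApplyInnerSelf_apply]
  change RCLike.re (inner ℂ (j (B.ker.starProjection (adjoint j u))) u) = _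
  rw [← adjoint_inner_right, ← inner_self_eq_norm_sq (𝕜 := ℂ)]
  congr 1
  conv_lhs => rw [← Submodule.starProjection_eq_self_iff.mpr
    (Submodule.starProjection_apply_mem B.ker (adjoint j u))]
  exact (isSelfAdjoint_starProjection B.ker).isSymmetric _ _

/-- On ker B the operators j and j - B agree, and the latter is compact. -/
theorem isCompactOperator_constrainedResolvent {j B : V →L[ℂ] H}
    (hC : IsCompactOperator (j - B)) : IsCompactOperator (constrainedResolvent j B) := by
  have h1 : (constrainedResolvent j B : H → H) =
      (j - B) ∘ (B.ker.starProjection ∘L adjoint j) := by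
    ext u
    have hmem : B (B.ker.starProjection (adjoint j u)) = 0 :=
      Submodule.starProjection_apply_mem B.ker _
    simp [constrainedResolvent, hmem]
  rw [h1]
  exact hC.comp_clm _

/-- Write j = (j - B) + B. The compact part turns strong convergence into norm convergence. The
projection takes values in ker B, so the energy estimate bounds the remaining part by t^(-1/2). -/
theorem tendsto_norm_penalizedResolvent_sub {j B : V →L[ℂ] H} (hC : IsCompactOperator (j - B))
    {t : ℕ → ℝ} (ht0 : ∀ k, 0 < t k) (ht : Tendsto t atTop atTop) :
    Tendsto (fun k => ‖penalizedResolvent j B (t k) - constrainedResolvent j B‖) atTop (𝓝 0) := by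
  set S : ℕ → V →L[ℂ] V := fun k =>
    Ring.inverse (penalization B (t k)) - B.ker.starProjection with hS
  have hSM : ∀ k, ‖S k‖ ≤ 2 := by
    intro k
    refine ContinuousLinearMap.opNorm_le_bound _ (by norm_num) fun x => ?_
    have h1 := norm_inverse_penalization_apply_le B (ht0 k).le x
    have h2 := Submodule.norm_starProjection_apply_le B.ker x
    calc ‖S k x‖ ≤ ‖Ring.inverse (penalization B (t k)) x‖ + ‖B.ker.starProjection x‖ :=
          norm_sub_le _ _
      _ ≤ 2 * ‖x‖ := by linarith
  have hSsa : ∀ k, IsSelfAdjoint (S k) := fun k =>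
    (isSelfAdjoint_inverse_penalization B (ht0 k).le).sub (isSelfAdjoint_starProjection B.ker)
  have hS0 : ∀ f, Tendsto (fun k => S k f) atTop (𝓝 0) := fun f => by
    have := (tendsto_inverse_penalization B ht0 ht f).sub_const (B.ker.starProjection f)
    rwa [sub_self] at this
  have hCS := tendsto_norm_comp_of_isCompactOperator hC hSsa hSM hS0
  have hBS : ∀ k, ‖B ∘L S k‖ ≤ Real.sqrt ((t k)⁻¹) := by
    intro k
    refine ContinuousLinearMap.opNorm_le_bound _ (Real.sqrt_nonneg _) fun x => ?_
    have hmem : B (B.ker.starProjection x) = 0 := Submodule.starProjection_apply_mem B.ker x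
    have h1 : (B ∘L S k) x = B (Ring.inverse (penalization B (t k)) x) := by
      simp [hS, hmem]
    have h2 := mul_norm_sq_inverse_penalization_le B (ht0 k).le x
    rw [h1]
    refine le_of_sq_le_sq ?_ (by positivity)
    rw [mul_pow, Real.sq_sqrt (inv_nonneg.mpr (ht0 k).le), inv_mul_eq_div,
      le_div_iff₀ (ht0 k), mul_comm]
    exact h2
  have hlim : Tendsto (fun k => (‖(j - B) ∘L S k‖ + Real.sqrt ((t k)⁻¹)) * ‖adjoint j‖) atTop
      (𝓝 0) := by
    have h1 : Tendsto (fun k => Real.sqrt ((t k)⁻¹)) atTop (𝓝 0) := by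
      have := (tendsto_inv_atTop_zero.comp ht).sqrt
      simpa using this
    simpa using (hCS.add h1).mul_const ‖adjoint j‖
  refine squeeze_zero (fun _ => norm_nonneg _) (fun k => ?_) hlim
  have e : penalizedResolvent j B (t k) - constrainedResolvent j B =
      ((j - B) ∘L S k + B ∘L S k) ∘L adjoint j := by
    ext u
    simp only [penalizedResolvent, constrainedResolvent, hS, sub_apply, comp_apply, add_apply,
      map_sub]
    abel
  rw [e]
  refine (opNorm_comp_le _ _).trans ?_
  gcongr
  exact (norm_add_le _ _).trans (by gcongr; exact hBS k)

end Penalization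

/-! ### From max-min values to eigenvalues of unbounded operators -/

section Transfer

open Module

universe u

variable {H H' : Type u} [NormedAddCommGroup H] [InnerProductSpace ℂ H] [CompleteSpace H]
  [AddCommGroup H'] [Module ℂ H']

/-- For λ + κ > 0 the relation κu = (λ + κ)Ru says Ru = su with s = κ/(λ + κ), an order-reversing
substitution. For λ + κ ≤ 0 nonnegativity of R leaves only u = 0. The injection ι allows T to act on
a smaller space than R, as L²(Ω) inside L²(ℝ^d). -/
theorem isNthEigenvalue_of_maxMin {T : H' →ₗ.[ℂ] H'} {ι : H' →ₗ[ℂ] H}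
    (hι : Function.Injective ι) {R : H →L[ℂ] H} (hR : IsSelfAdjoint R)
    (hR0 : ∀ u, 0 ≤ R.reApplyInnerSelf u) {κ : ℝ} (hκ : 0 < κ)
    (hT : ∀ (lam : ℝ) (u : H), u ∈ (eigenspace T (lam : ℂ)).map ι ↔
      (κ : ℂ) • u = ((lam + κ : ℝ) : ℂ) • R u)
    {G : Type*} [NormedAddCommGroup G] [NormedSpace ℂ G] {K : H →L[ℂ] G}
    (hK : IsCompactOperator K) {δ : ℝ} (hδ0 : 0 ≤ δ)
    (hRK : ∀ u, R.reApplyInnerSelf u ≤ ‖K u‖ * ‖u‖ + δ * ‖u‖ ^ 2)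
    {n : ℕ} (hn : 1 ≤ n) (hδ : δ < maxMin R n) {S : Submodule ℂ H} (hS : n ≤ finrank ℂ S) :
    IsNthEigenvalue T n (κ / maxMin R n - κ) := by
  set m := maxMin R n with hm
  have hm0 : 0 < m := hδ0.trans_lt hδ
  have hbot : ∀ lam : ℝ, lam + κ ≤ 0 → (eigenspace T (lam : ℂ)).map ι = ⊥ := by
    intro lam hlam
    rw [eq_bot_iff]
    intro u hu
    rw [hT] at hu
    have h1 : inner ℂ ((κ : ℂ) • u) u = inner ℂ (((lam + κ : ℝ) : ℂ) • R u) u := by rw [hu]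
    have h2 := congrArg RCLike.re h1
    have h3 : ∀ (a : ℝ) (z : ℂ), RCLike.re ((a : ℂ) * z) = a * RCLike.re z := by
      intro a z; simp
    rw [inner_smul_left, inner_smul_left, Complex.conj_ofReal, Complex.conj_ofReal, h3, h3,
      inner_self_eq_norm_sq, ← ContinuousLinearMap.reApplyInnerSelf_apply] at h2
    have h4 : 0 ≤ κ * ‖u‖ ^ 2 := by positivity
    have h5 := mul_nonpos_of_nonpos_of_nonneg hlam (hR0 u)
    rw [Submodule.mem_bot]
    by_contra hne
    have h6 : 0 < κ * ‖u‖ ^ 2 := by positivity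
    linarith
  have hmap : ∀ lam : ℝ, 0 < lam + κ → (eigenspace T (lam : ℂ)).map ι =
      Module.End.eigenspace (R : H →ₗ[ℂ] H) ((κ / (lam + κ) : ℝ) : ℂ) := by
    intro lam hlam
    have hne : ((lam : ℂ) + (κ : ℂ)) ≠ 0 := by
      rw [← Complex.ofReal_add, Complex.ofReal_ne_zero]; exact hlam.ne'
    ext u
    rw [hT, Module.End.mem_eigenspace_iff]
    change _ ↔ R u = _
    push_cast
    constructor
    · intro h
      rw [div_eq_inv_mul, mul_smul, h, smul_smul, inv_mul_cancel₀ hne, one_smul]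
    · intro h
      rw [h, smul_smul, mul_div_cancel₀ _ hne]
  have key : ∀ (P : ℝ → Prop) (I : Set ℝ), (∀ lam, 0 < lam + κ → (P lam ↔ κ / (lam + κ) ∈ I)) →
      (I ⊆ Set.Ioi 0) → (⨆ (lam : ℝ) (_ : P lam), eigenspace T (lam : ℂ)).map ι =
        spectralSpan R I := by
    intro P I hPI hI
    simp only [Submodule.map_iSup]
    refine le_antisymm (iSup₂_le fun lam hlam => ?_) (iSup₂_le fun s hs => ?_)
    · rcases le_or_gt (lam + κ) 0 with h0 | h0
      · rw [hbot lam h0]; exact bot_le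
      · rw [hmap lam h0]
        exact eigenspace_le_spectralSpan R ((hPI lam h0).mp hlam)
    · have hs0 : 0 < s := hI hs
      have h1 : κ / s - κ + κ = κ / s := by ring
      have h2 : 0 < κ / s - κ + κ := by rw [h1]; positivity
      have h3 : κ / (κ / s - κ + κ) = s := by rw [h1]; field_simp
      refine le_iSup₂_of_le (κ / s - κ) ((hPI _ h2).mpr (by rwa [h3])) ?_
      rw [hmap _ h2, h3]
  have hrank : ∀ W : Submodule ℂ H', Module.rank ℂ W = Module.rank ℂ (W.map ι) := fun W =>
    (Submodule.equivMapOfInjective ι hι W).rank_eq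
  constructor
  · rw [hrank, key _ (Set.Ioi m)]
    · exact rank_spectralSpan_maxMin_lt hR hK hRK hn hδ
    · intro lam h0
      rw [Set.mem_Ioi, lt_sub_iff_add_lt, lt_div_iff₀ hm0, lt_div_iff₀ h0, mul_comm]
    · exact Set.Ioi_subset_Ioi hm0.le
  · rw [hrank, key _ (Set.Ici m)]
    · exact le_rank_spectralSpan_maxMin hR hK hRK hn hδ hS
    · intro lam h0
      rw [Set.mem_Ici, le_sub_iff_add_le, le_div_iff₀ hm0, le_div_iff₀ h0, mul_comm]
    · exact Set.Ici_subset_Ioi.mpr hm0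

end Transfer

/-! ### Multiplication operators and Fourier multipliers on `L²` -/

section Multipliers

open TemperedDistribution FourierTransform
open scoped SchwartzMap Laplacian LineDeriv ENNReal

variable {d : ℕ}

theorem toTD_injective {u v : L2 d} (h : (u : 𝓢'(Euc d, ℂ)) = (v : 𝓢'(Euc d, ℂ))) : u = v := by
  have hker : u - v ∈ (Lp.toTemperedDistributionCLM ℂ (volume : Measure (Euc d)) 2).ker := by
    rw [LinearMap.mem_ker]
    change Lp.toTemperedDistributionCLM ℂ (volume : Measure (Euc d)) 2 (u - v) = 0
    rw [map_sub, sub_eq_zero]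
    exact h
  rw [Lp.ker_toTemperedDistributionCLM_eq_bot] at hker
  exact sub_eq_zero.mp (by simpa using hker)

theorem toTD_sum {ι : Type*} (s : Finset ι) (u : ι → L2 d) :
    ((∑ i ∈ s, u i : L2 d) : 𝓢'(Euc d, ℂ)) = ∑ i ∈ s, (u i : 𝓢'(Euc d, ℂ)) :=
  map_sum (Lp.toTemperedDistributionCLM ℂ (volume : Measure (Euc d)) 2) u s

/-- Multiplication by a bounded function, as an operator on `L²(ℝ^d)`. -/
def mulOp (g : Euc d → ℂ) (hg : MemLp g ∞ volume) : L2 d →L[ℂ] L2 d :=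
  LinearMap.mkContinuous
    { toFun := fun u => (hg.toLp g • u : L2 d)
      map_add' := fun u v => Lp.add_smul _ u v
      map_smul' := fun c u => by
        refine Lp.ext ?_
        filter_upwards [Lp.coeFn_lpSMul (r := 2) (hg.toLp g) (c • u),
          Lp.coeFn_lpSMul (r := 2) (hg.toLp g) u, Lp.coeFn_smul c u,
          Lp.coeFn_smul c (hg.toLp g • u : L2 d)] with x h1 h2 h3 h4
        rw [RingHom.id_apply, h1, h4, Pi.smul_apply', h3, Pi.smul_apply, Pi.smul_apply, h2,
          Pi.smul_apply', smul_comm] }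
    ‖hg.toLp g‖ (fun u => Lp.norm_smul_le _ u)

theorem mulOp_apply (g : Euc d → ℂ) (hg : MemLp g ∞ volume) (u : L2 d) :
    mulOp g hg u = (hg.toLp g • u : L2 d) := rfl

theorem mulOp_ae (g : Euc d → ℂ) (hg : MemLp g ∞ volume) (u : L2 d) :
    mulOp g hg u =ᵐ[volume] fun x => g x * u x := by
  filter_upwards [Lp.coeFn_lpSMul (r := 2) (hg.toLp g) u, hg.coeFn_toLp] with x h1 h2
  rw [mulOp_apply, h1, Pi.smul_apply', h2, smul_eq_mul]

theorem norm_mulOp_apply_le {g : Euc d → ℂ} (hg : MemLp g ∞ volume) {C : ℝ} (h : ∀ x, ‖g x‖ ≤ C)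
    (u : L2 d) : ‖mulOp g hg u‖ ≤ C * ‖u‖ := by
  refine Lp.norm_le_mul_norm_of_ae_le_mul ?_
  filter_upwards [mulOp_ae g hg u] with x hx
  rw [hx, norm_mul]
  exact mul_le_mul_of_nonneg_right (h x) (norm_nonneg _)

theorem isSelfAdjoint_mulOp {g : Euc d → ℂ} (hg : MemLp g ∞ volume)
    (h : ∀ x, star (g x) = g x) : IsSelfAdjoint (mulOp g hg) := by
  rw [ContinuousLinearMap.isSelfAdjoint_iff_isSymmetric]
  intro u v
  change inner ℂ (mulOp g hg u) v = inner ℂ u (mulOp g hg v)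
  rw [L2.inner_def, L2.inner_def]
  refine integral_congr_ae ?_
  filter_upwards [mulOp_ae g hg u, mulOp_ae g hg v] with x h1 h2
  rw [h1, h2]
  have h3 := h x
  simp only [RCLike.inner_apply, map_mul]
  rw [RCLike.star_def] at h3
  rw [h3]
  ring

theorem toTD_mulOp {g : Euc d → ℂ} (hg : MemLp g ∞ volume) (hg' : g.HasTemperateGrowth)
    (u : L2 d) :
    ((mulOp g hg u : L2 d) : 𝓢'(Euc d, ℂ)) = smulLeftCLM ℂ g (u : 𝓢'(Euc d, ℂ)) :=
  Lp.toTemperedDistribution_smul_eq hg' hg u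

/-- The Fourier transform on `L²(ℝ^d)`, as a continuous linear map. -/
def fourierOp (d : ℕ) : L2 d →L[ℂ] L2 d :=
  (Lp.fourierTransformₗᵢ (Euc d) ℂ).toContinuousLinearEquiv

/-- The inverse Fourier transform on `L²(ℝ^d)`, as a continuous linear map. -/
def fourierInvOp (d : ℕ) : L2 d →L[ℂ] L2 d :=
  (Lp.fourierTransformₗᵢ (Euc d) ℂ).symm.toContinuousLinearEquiv

theorem fourierOp_fourierInvOp (u : L2 d) : fourierOp d (fourierInvOp d u) = u :=
  (Lp.fourierTransformₗᵢ (Euc d) ℂ).apply_symm_apply u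

theorem norm_fourierOp (u : L2 d) : ‖fourierOp d u‖ = ‖u‖ :=
  (Lp.fourierTransformₗᵢ (Euc d) ℂ).norm_map u

theorem norm_fourierInvOp (u : L2 d) : ‖fourierInvOp d u‖ = ‖u‖ :=
  (Lp.fourierTransformₗᵢ (Euc d) ℂ).symm.norm_map u

theorem inner_fourierInvOp_left (u v : L2 d) :
    inner ℂ (fourierInvOp d u) v = inner ℂ u (fourierOp d v) := by
  have := (Lp.fourierTransformₗᵢ (Euc d) ℂ).inner_map_map (fourierInvOp d u) v
  rw [← this]
  change inner ℂ (fourierOp d (fourierInvOp d u)) (fourierOp d v) = _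
  rw [fourierOp_fourierInvOp]

/-- The Fourier multiplier with bounded symbol `g`, as an operator on `L²(ℝ^d)`. -/
def multiplier (g : Euc d → ℂ) (hg : MemLp g ∞ volume) : L2 d →L[ℂ] L2 d :=
  fourierInvOp d ∘L mulOp g hg ∘L fourierOp d

theorem toTD_multiplier {g : Euc d → ℂ} (hg : MemLp g ∞ volume) (hg' : g.HasTemperateGrowth)
    (u : L2 d) :
    ((multiplier g hg u : L2 d) : 𝓢'(Euc d, ℂ)) =
      fourierMultiplierCLM ℂ g (u : 𝓢'(Euc d, ℂ)) := by
  rw [fourierMultiplierCLM_apply, Lp.fourier_toTemperedDistribution_eq]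
  change ((fourierInvOp d (mulOp g hg (fourierOp d u)) : L2 d) : 𝓢'(Euc d, ℂ)) =
    𝓕⁻ (smulLeftCLM ℂ g ((fourierOp d u : L2 d) : 𝓢'(Euc d, ℂ)))
  rw [← toTD_mulOp hg hg', Lp.fourierInv_toTemperedDistribution_eq]
  rfl

theorem isSelfAdjoint_multiplier {g : Euc d → ℂ} (hg : MemLp g ∞ volume)
    (h : ∀ x, star (g x) = g x) : IsSelfAdjoint (multiplier g hg) := by
  rw [ContinuousLinearMap.isSelfAdjoint_iff_isSymmetric]
  intro u v
  change inner ℂ (fourierInvOp d (mulOp g hg (fourierOp d u))) v =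
    inner ℂ u (fourierInvOp d (mulOp g hg (fourierOp d v)))
  rw [inner_fourierInvOp_left, ← inner_conj_symm u, inner_fourierInvOp_left, inner_conj_symm]
  exact (isSelfAdjoint_mulOp hg h).isSymmetric _ _

/-! ### The Bessel potential of order one -/

/-- The symbol `(1 + |ξ|²)^(-1/2)`. -/
def besselSymbol (d : ℕ) (x : Euc d) : ℂ := ((1 + ‖x‖ ^ 2) ^ ((-1 : ℝ) / 2) : ℝ)

/-- The symbol `ξ_i (1 + |ξ|²)^(-1/2)`. -/
def derivSymbol {d : ℕ} (i : Fin d) (x : Euc d) : ℂ :=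
  ((inner ℝ x (EuclideanSpace.single i (1 : ℝ)) * (1 + ‖x‖ ^ 2) ^ ((-1 : ℝ) / 2) : ℝ) : ℂ)

theorem hasTemperateGrowth_besselSymbol (d : ℕ) : (besselSymbol d).HasTemperateGrowth := by
  unfold besselSymbol; fun_prop

theorem hasTemperateGrowth_derivSymbol (i : Fin d) : (derivSymbol i).HasTemperateGrowth := by
  unfold derivSymbol; fun_prop

theorem hasTemperateGrowth_inner_single (i : Fin d) :
    (fun x : Euc d =>
      ((inner ℝ x (EuclideanSpace.single i (1 : ℝ)) : ℝ) : ℂ)).HasTemperateGrowth := by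
  fun_prop

theorem sq_rpow_neg_half (x : Euc d) :
    ((1 + ‖x‖ ^ 2 : ℝ) ^ ((-1 : ℝ) / 2)) ^ 2 = (1 + ‖x‖ ^ 2)⁻¹ := by
  rw [← Real.rpow_natCast, ← Real.rpow_mul (by positivity), ← Real.rpow_neg_one]
  norm_num

theorem norm_besselSymbol_le_one (x : Euc d) : ‖besselSymbol d x‖ ≤ 1 := by
  rw [besselSymbol, Complex.norm_real, Real.norm_of_nonneg (by positivity)]
  exact Real.rpow_le_one_of_one_le_of_nonpos (by simp) (by norm_num)

theorem sum_inner_single_sq (x : Euc d) :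
    ∑ i, inner ℝ x (EuclideanSpace.single i (1 : ℝ)) ^ 2 = ‖x‖ ^ 2 := by
  rw [EuclideanSpace.norm_sq_eq]
  refine Finset.sum_congr rfl fun i _ => ?_
  simp [EuclideanSpace.inner_single_right]

theorem norm_derivSymbol_le_one (i : Fin d) (x : Euc d) : ‖derivSymbol i x‖ ≤ 1 := by
  rw [derivSymbol, Complex.norm_real]
  refine abs_le_one_iff_mul_self_le_one.mpr ?_
  rw [← sq, mul_pow, sq_rpow_neg_half, mul_inv_le_iff₀ (by positivity), one_mul,
    ← sum_inner_single_sq x]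
  have := Finset.single_le_sum (f := fun i => inner ℝ x (EuclideanSpace.single i (1 : ℝ)) ^ 2)
    (fun i _ => by positivity) (Finset.mem_univ i)
  linarith

theorem memLp_besselSymbol (d : ℕ) : MemLp (besselSymbol d) ∞ volume :=
  memLp_top_of_bound (hasTemperateGrowth_besselSymbol d).1.continuous.aestronglyMeasurable 1
    (Eventually.of_forall norm_besselSymbol_le_one)

theorem memLp_derivSymbol (i : Fin d) : MemLp (derivSymbol i) ∞ volume :=
  memLp_top_of_bound (hasTemperateGrowth_derivSymbol i).1.continuous.aestronglyMeasurable 1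
    (Eventually.of_forall (norm_derivSymbol_le_one i))

/-- The Bessel potential `J = (1 + |ξ|²)^(-1/2)` on `L²(ℝ^d)`; its range is `H¹(ℝ^d)`. -/
def besselOp (d : ℕ) : L2 d →L[ℂ] L2 d := multiplier (besselSymbol d) (memLp_besselSymbol d)

/-- The operator with symbol `ξ_i (1 + |ξ|²)^(-1/2)`, i.e. `(2πi)⁻¹ ∂_i J`. -/
def besselDerivOp {d : ℕ} (i : Fin d) : L2 d →L[ℂ] L2 d :=
  multiplier (derivSymbol i) (memLp_derivSymbol i)

theorem isSelfAdjoint_besselOp (d : ℕ) : IsSelfAdjoint (besselOp d) :=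
  isSelfAdjoint_multiplier _ fun _ => Complex.conj_ofReal _

theorem toTD_besselOp (u : L2 d) :
    ((besselOp d u : L2 d) : 𝓢'(Euc d, ℂ)) = besselPotential (Euc d) ℂ (-1) (u : 𝓢'(Euc d, ℂ)) :=
  toTD_multiplier _ (hasTemperateGrowth_besselSymbol d) u

theorem toTD_besselDerivOp (i : Fin d) (u : L2 d) :
    ((besselDerivOp i u : L2 d) : 𝓢'(Euc d, ℂ)) =
      fourierMultiplierCLM ℂ (derivSymbol i) (u : 𝓢'(Euc d, ℂ)) :=
  toTD_multiplier _ (hasTemperateGrowth_derivSymbol i) u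

theorem besselOp_injective (d : ℕ) : Function.Injective (besselOp d) := by
  intro u v h
  refine toTD_injective ?_
  have h1 := congrArg (fun w : L2 d => besselPotential (Euc d) ℂ 1 (w : 𝓢'(Euc d, ℂ))) h
  simp only [toTD_besselOp, besselPotential_besselPotential_apply] at h1
  simpa using h1

theorem lineDeriv_besselOp (i : Fin d) (v : L2 d) :
    ∂_{EuclideanSpace.single i (1 : ℝ)} ((besselOp d v : L2 d) : 𝓢'(Euc d, ℂ)) =
      (2 * Real.pi * Complex.I) • ((besselDerivOp i v : L2 d) : 𝓢'(Euc d, ℂ)) := by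
  rw [lineDeriv_eq_fourierMultiplierCLM, toTD_besselDerivOp, toTD_besselOp, besselPotential,
    fourierMultiplierCLM_fourierMultiplierCLM_apply (by fun_prop) (by fun_prop)]
  congr 3
  ext x
  simp [derivSymbol, mul_comm]

theorem fourierMultiplierCLM_add_apply {g₁ g₂ : Euc d → ℂ} (h₁ : g₁.HasTemperateGrowth)
    (h₂ : g₂.HasTemperateGrowth) (f : 𝓢'(Euc d, ℂ)) :
    fourierMultiplierCLM ℂ g₁ f + fourierMultiplierCLM ℂ g₂ f =
      fourierMultiplierCLM ℂ (fun x => g₁ x + g₂ x) f := by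
  rw [fourierMultiplierCLM_apply, fourierMultiplierCLM_apply, fourierMultiplierCLM_apply,
    ← FourierTransform.fourierInv_add, show (fun x => g₁ x + g₂ x) = g₁ + g₂ from rfl,
    smulLeftCLM_add h₁ h₂]
  rfl

/-- Since ∑ξ_i² = |ξ|², this is (1 + |ξ|²)(1 + |ξ|²)^(-1/2) = (1 + |ξ|²)^(1/2). It recovers J⁻¹f by
applying bounded multipliers to f and its first derivatives. -/
theorem bessel_sum_distribution (f : 𝓢'(Euc d, ℂ)) :
    besselPotential (Euc d) ℂ (-1) f + ∑ i : Fin d, fourierMultiplierCLM ℂ (derivSymbol i)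
      (fourierMultiplierCLM ℂ
        (fun x => ((inner ℝ x (EuclideanSpace.single i (1 : ℝ)) : ℝ) : ℂ)) f) =
      besselPotential (Euc d) ℂ 1 f := by
  have h : ∀ i : Fin d, fourierMultiplierCLM ℂ (derivSymbol i) (fourierMultiplierCLM ℂ
        (fun x => ((inner ℝ x (EuclideanSpace.single i (1 : ℝ)) : ℝ) : ℂ)) f) =
      fourierMultiplierCLM ℂ (fun x => ((inner ℝ x (EuclideanSpace.single i (1 : ℝ)) ^ 2 *
        (1 + ‖x‖ ^ 2) ^ ((-1 : ℝ) / 2) : ℝ) : ℂ)) f := by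
    intro i
    rw [fourierMultiplierCLM_fourierMultiplierCLM_apply (hasTemperateGrowth_inner_single i)
      (hasTemperateGrowth_derivSymbol i)]
    congr 2
    ext x
    simp only [Pi.mul_apply, derivSymbol]
    push_cast
    ring
  have hlap : ∑ i : Fin d, fourierMultiplierCLM ℂ (fun x : Euc d =>
      ((inner ℝ x (EuclideanSpace.single i (1 : ℝ)) ^ 2 *
        (1 + ‖x‖ ^ 2) ^ ((-1 : ℝ) / 2) : ℝ) : ℂ)) f =
      fourierMultiplierCLM ℂ (fun x : Euc d =>
        ((‖x‖ ^ 2 * (1 + ‖x‖ ^ 2) ^ ((-1 : ℝ) / 2) : ℝ) : ℂ)) f := by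
    rw [← sum_apply, ← fourierMultiplierCLM_sum ℂ (by intro i _; fun_prop)]
    congr 2
    ext x
    rw [← sum_inner_single_sq x, Finset.sum_mul]
    push_cast
    rfl
  rw [Finset.sum_congr rfl fun i _ => h i, hlap, besselPotential, besselPotential,
    fourierMultiplierCLM_add_apply (by fun_prop) (by fun_prop)]
  congr 2
  ext x
  rw [← Complex.ofReal_add]
  congr 1
  have h0 : (0 : ℝ) < 1 + ‖x‖ ^ 2 := by positivity
  calc (1 + ‖x‖ ^ 2) ^ ((-1 : ℝ) / 2) + ‖x‖ ^ 2 * (1 + ‖x‖ ^ 2) ^ ((-1 : ℝ) / 2)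
      = (1 + ‖x‖ ^ 2) ^ (1 : ℝ) * (1 + ‖x‖ ^ 2) ^ ((-1 : ℝ) / 2) := by rw [Real.rpow_one]; ring
    _ = (1 + ‖x‖ ^ 2) ^ ((1 : ℝ) / 2) := by rw [← Real.rpow_add h0]; norm_num

/-- A square-integrable function with square-integrable distributional gradient lies in the range
of the Bessel potential. -/
theorem besselOp_of_lineDeriv {u : L2 d} {g : Fin d → L2 d}
    (h : ∀ i, ∂_{EuclideanSpace.single i (1 : ℝ)} (u : 𝓢'(Euc d, ℂ)) =
      (2 * Real.pi * Complex.I) • (g i : 𝓢'(Euc d, ℂ))) :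
    besselOp d (besselOp d u + ∑ i, besselDerivOp i (g i)) = u := by
  have hne : (2 * Real.pi * Complex.I) ≠ 0 := by
    simp [Real.pi_ne_zero]
  have h' : ∀ i, fourierMultiplierCLM ℂ
      (fun x => ((inner ℝ x (EuclideanSpace.single i (1 : ℝ)) : ℝ) : ℂ)) (u : 𝓢'(Euc d, ℂ)) =
      (g i : 𝓢'(Euc d, ℂ)) := by
    intro i
    have := h i
    rw [lineDeriv_eq_fourierMultiplierCLM] at this
    exact smul_right_injective _ hne this
  refine toTD_injective ?_
  rw [toTD_besselOp, toTD_add, toTD_sum, toTD_besselOp]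
  simp only [toTD_besselDerivOp, ← h']
  rw [bessel_sum_distribution, besselPotential_besselPotential_apply]
  simp

/-- Take u = Jv and cancel J. This makes v a continuous function of Jv and its gradient, so L²
convergence of these two gives convergence in H¹. -/
theorem besselOp_add_sum (v : L2 d) :
    besselOp d (besselOp d v) + ∑ i, besselDerivOp i (besselDerivOp i v) = v :=
  besselOp_injective d (besselOp_of_lineDeriv fun i => lineDeriv_besselOp i v)

end Multipliers

/-! ### The resolvent of the particle-in-well operator -/

section WellResolvent

open TemperedDistribution FourierTransform ContinuousLinearMap
open scoped SchwartzMap Laplacian LineDeriv ENNReal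

variable {d : ℕ}

theorem memLp_indicator_one {s : Set (Euc d)} (hs : MeasurableSet s) :
    MemLp (s.indicator fun _ => (1 : ℂ)) ∞ (volume : Measure (Euc d)) :=
  memLp_top_of_bound (aestronglyMeasurable_const.indicator hs) 1
    (Eventually.of_forall fun x => by
      by_cases hx : x ∈ s <;> simp [hx])

/-- Multiplication by the indicator function of `s`. -/
def charOp (s : Set (Euc d)) (hs : MeasurableSet s) : L2 d →L[ℂ] L2 d :=
  mulOp (s.indicator fun _ => 1) (memLp_indicator_one hs)

theorem charOp_ae {s : Set (Euc d)} (hs : MeasurableSet s) (u : L2 d) :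
    charOp s hs u =ᵐ[volume] s.indicator fun x => u x := by
  filter_upwards [mulOp_ae _ (memLp_indicator_one hs) u] with x hx
  rw [charOp, hx]
  by_cases h : x ∈ s <;> simp [h]

theorem isSelfAdjoint_charOp {s : Set (Euc d)} (hs : MeasurableSet s) :
    IsSelfAdjoint (charOp s hs) :=
  isSelfAdjoint_mulOp _ fun x => by by_cases h : x ∈ s <;> simp [h]

theorem charOp_charOp {s : Set (Euc d)} (hs : MeasurableSet s) (u : L2 d) :
    charOp s hs (charOp s hs u) = charOp s hs u := by
  refine Lp.ext ?_
  filter_upwards [charOp_ae hs u, charOp_ae hs (charOp s hs u)] with x h1 h2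
  rw [h2]
  by_cases h : x ∈ s
  · rw [Set.indicator_of_mem h]
  · rw [h1, Set.indicator_of_notMem h, Set.indicator_of_notMem h]

theorem charOp_add_charOp_compl {s : Set (Euc d)} (hs : MeasurableSet s) (u : L2 d) :
    charOp s hs u + charOp sᶜ hs.compl u = u := by
  refine Lp.ext ?_
  filter_upwards [charOp_ae hs u, charOp_ae hs.compl u,
    Lp.coeFn_add (charOp s hs u) (charOp sᶜ hs.compl u)] with x h1 h2 h3
  rw [h3, Pi.add_apply, h1, h2]
  by_cases h : x ∈ s <;> simp [h]

/-- With characters e^(2πi x·ξ), the operator -Δ has symbol (2π)²|ξ|²; this is where κ comes from.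
-/
theorem besselPotential_two (f : 𝓢'(Euc d, ℂ)) :
    besselPotential (Euc d) ℂ 2 f = f - (((2 * Real.pi) ^ 2)⁻¹ : ℝ) • Δ f := by
  have h1 : f = fourierMultiplierCLM ℂ (fun _ : Euc d => (1 : ℂ)) f := by simp
  have hpi : (2 * Real.pi) ^ 2 ≠ 0 := by positivity
  rw [laplacian_eq_fourierMultiplierCLM, smul_smul, mul_neg, inv_mul_cancel₀ hpi, neg_smul,
    one_smul, sub_neg_eq_add]
  nth_rw 2 [h1]
  rw [fourierMultiplierCLM_add_apply (by fun_prop) (by fun_prop), besselPotential]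
  congr 2
  ext x
  norm_num

theorem toTD_sub_ofReal_smul (u w : L2 d) (c : ℝ) :
    ((u - (c : ℂ) • w : L2 d) : 𝓢'(Euc d, ℂ)) = (u : 𝓢'(Euc d, ℂ)) - c • (w : 𝓢'(Euc d, ℂ)) := by
  rw [sub_eq_add_neg, ← neg_smul, toTD_add, toTD_smul, neg_smul, ← sub_eq_add_neg]
  rfl

theorem toTD_besselOp_besselOp (u : L2 d) :
    ((besselOp d (besselOp d u) : L2 d) : 𝓢'(Euc d, ℂ)) =
      besselPotential (Euc d) ℂ (-2) (u : 𝓢'(Euc d, ℂ)) := by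
  rw [toTD_besselOp, toTD_besselOp, besselPotential_besselPotential_apply]
  norm_num

theorem eq_besselOp_of_laplacian {u w : L2 d} (hw : (w : 𝓢'(Euc d, ℂ)) = Δ (u : 𝓢'(Euc d, ℂ))) :
    u = besselOp d (besselOp d (u - ((((2 * Real.pi) ^ 2)⁻¹ : ℝ) : ℂ) • w)) := by
  refine toTD_injective ?_
  rw [toTD_besselOp_besselOp, toTD_sub_ofReal_smul, hw, ← besselPotential_two,
    besselPotential_besselPotential_apply]
  simp

/-- `H²(ℝ^d)` and the Laplacian in terms of the Bessel potential. -/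
theorem memSobolev_two_and_laplacian_iff (u w : L2 d) :
    (MemSobolev 2 2 (u : 𝓢'(Euc d, ℂ)) ∧ (w : 𝓢'(Euc d, ℂ)) = Δ (u : 𝓢'(Euc d, ℂ))) ↔
      u = besselOp d (besselOp d (u - ((((2 * Real.pi) ^ 2)⁻¹ : ℝ) : ℂ) • w)) := by
  refine ⟨fun h => eq_besselOp_of_laplacian h.2, fun h => ?_⟩
  have hc0 : ((2 * Real.pi) ^ 2)⁻¹ ≠ 0 := by positivity
  have h2 : besselPotential (Euc d) ℂ 2 (u : 𝓢'(Euc d, ℂ)) =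
      (u : 𝓢'(Euc d, ℂ)) - ((2 * Real.pi) ^ 2)⁻¹ • (w : 𝓢'(Euc d, ℂ)) := by
    conv_lhs => rw [h]
    rw [toTD_besselOp_besselOp, besselPotential_besselPotential_apply, toTD_sub_ofReal_smul]
    simp
  refine ⟨⟨_, h2.trans (toTD_sub_ofReal_smul _ _ _).symm⟩, ?_⟩
  rw [besselPotential_two] at h2
  exact (smul_right_injective _ hc0 (sub_right_injective h2)).symm

/-- The resolvent of `P_h`. -/
def wellResolvent (Ω : Set (Euc d)) (hΩ : IsOpen Ω) (t : ℝ) : L2 d →L[ℂ] L2 d :=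
  penalizedResolvent (besselOp d) (charOp Ωᶜ hΩ.measurableSet.compl ∘L besselOp d) t

/-- With w = (1 + tJχJ)⁻¹Ju the first equation reads u = cJw, and w + tJχJw = Ju turns J(cu - tχu)
into cw. Conversely, v = J(cu - tχu) solves (1 + tJχJ)v = cJu. -/
theorem eq_smul_penalizedResolvent_iff {H : Type*} [NormedAddCommGroup H] [InnerProductSpace ℂ H]
    [CompleteSpace H] {J χ : H →L[ℂ] H} (hJ : IsSelfAdjoint J) (hχ : IsSelfAdjoint χ)
    (hχ2 : ∀ u, χ (χ u) = χ u) {t : ℝ} (ht : 0 ≤ t) (c : ℂ) (u : H) :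
    u = c • penalizedResolvent J (χ ∘L J) t u ↔ u = J (J (c • u - (t : ℂ) • χ u)) := by
  have hJ' : adjoint J = J := hJ
  have hχ' : adjoint χ = χ := hχ
  have hT : ∀ v, penalization (χ ∘L J) t v = v + (t : ℂ) • J (χ (J v)) := by
    intro v
    rw [penalization_apply, adjoint_comp, hJ', hχ']
    simp only [comp_apply, hχ2]
  have hR : ∀ v, penalizedResolvent J (χ ∘L J) t v =
      J (Ring.inverse (penalization (χ ∘L J) t) (J v)) := by
    intro v
    rw [penalizedResolvent, hJ']
    rfl
  constructor
  · intro h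
    rw [hR] at h
    set w := Ring.inverse (penalization (χ ∘L J) t) (J u) with hw
    have h1 : w + (t : ℂ) • J (χ (J w)) = J u := by
      rw [← hT, hw, penalization_inverse _ ht]
    have h2 : χ u = c • χ (J w) := by conv_lhs => rw [h, map_smul]
    have h3 : J (c • u - (t : ℂ) • χ u) = c • w := by
      rw [map_sub, map_smul, map_smul, h2, map_smul, ← h1, smul_add, smul_comm c (t : ℂ),
        add_sub_cancel_right]
    rw [h3, map_smul]
    exact h
  · intro h
    set v := J (c • u - (t : ℂ) • χ u) with hv
    have h1 : penalization (χ ∘L J) t v = c • J u := by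
      rw [hT, ← h, hv, map_sub, map_smul, map_smul, sub_add_cancel]
    have h2 : v = c • Ring.inverse (penalization (χ ∘L J) t) (J u) := by
      rw [← map_smul, ← h1, inverse_penalization _ ht]
    rw [hR, ← map_smul, ← h2]
    exact h

/-- Divide -Δu + h⁻²χu = λu by κ and add u: then (1 - Δ/κ)u = ((λ + κ)/κ)u - tχu with t = 1/(κh²),
and J² inverts 1 - Δ/κ. -/
theorem mem_eigenspace_wellOperator_iff {Ω : Set (Euc d)} (hΩ : IsOpen Ω) (h lam : ℝ)
    (u : L2 d) :
    u ∈ eigenspace (wellOperator Ω h) (lam : ℂ) ↔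
      (((2 * Real.pi) ^ 2 : ℝ) : ℂ) • u = ((lam + (2 * Real.pi) ^ 2 : ℝ) : ℂ) •
        wellResolvent Ω hΩ (((2 * Real.pi) ^ 2 * h ^ 2)⁻¹) u := by
  set κ : ℝ := (2 * Real.pi) ^ 2 with hκ
  have hκ0 : (κ : ℂ) ≠ 0 := by
    rw [Complex.ofReal_ne_zero]; positivity
  have hgraph : u ∈ eigenspace (wellOperator Ω h) (lam : ℂ) ↔
      (u, (lam : ℂ) • u) ∈ wellGraph Ω h := by
    rw [← wellOperator_graph]; rfl
  have hae : ∀ w : L2 d, (∀ᵐ x, ((lam : ℂ) • u : L2 d) x =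
      -w x + ((h ^ 2)⁻¹ : ℝ) * Ωᶜ.indicator (fun y => u y) x) ↔
      w = (((h ^ 2)⁻¹ : ℝ) : ℂ) • charOp Ωᶜ hΩ.measurableSet.compl u - (lam : ℂ) • u := by
    intro w
    rw [Lp.ext_iff]
    refine eventually_congr ?_
    filter_upwards [Lp.coeFn_smul (lam : ℂ) u,
      Lp.coeFn_smul (((h ^ 2)⁻¹ : ℝ) : ℂ) (charOp Ωᶜ hΩ.measurableSet.compl u),
      Lp.coeFn_sub ((((h ^ 2)⁻¹ : ℝ) : ℂ) • charOp Ωᶜ hΩ.measurableSet.compl u) ((lam : ℂ) • u),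
      charOp_ae hΩ.measurableSet.compl u] with x h1 h2 h3 h4
    rw [h3, Pi.sub_apply, h1, h2, Pi.smul_apply, Pi.smul_apply, h4, smul_eq_mul, smul_eq_mul]
    constructor
    · intro h; linear_combination h
    · intro h; linear_combination h
  have hmem : u ∈ eigenspace (wellOperator Ω h) (lam : ℂ) ↔
      u = besselOp d (besselOp d ((((lam + κ) / κ : ℝ) : ℂ) • u -
        (((κ * h ^ 2)⁻¹ : ℝ) : ℂ) • charOp Ωᶜ hΩ.measurableSet.compl u)) := by
    have e : (((lam + κ) / κ : ℝ) : ℂ) • u -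
        (((κ * h ^ 2)⁻¹ : ℝ) : ℂ) • charOp Ωᶜ hΩ.measurableSet.compl u =
        u - ((κ⁻¹ : ℝ) : ℂ) •
          ((((h ^ 2)⁻¹ : ℝ) : ℂ) • charOp Ωᶜ hΩ.measurableSet.compl u - (lam : ℂ) • u) := by
      rw [smul_sub, smul_smul, smul_smul, ← Complex.ofReal_mul, ← Complex.ofReal_mul, ← mul_inv]
      have h1 : (((lam + κ) / κ : ℝ) : ℂ) = 1 + ((κ⁻¹ * lam : ℝ) : ℂ) := by
        push_cast
        field_simp
        ring
      rw [h1, add_smul, one_smul]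
      abel
    rw [hgraph, e, ← memSobolev_two_and_laplacian_iff]
    constructor
    · rintro ⟨hS, w, hw, hwx⟩
      have := (hae w).mp hwx
      subst this
      exact ⟨hS, hw⟩
    · rintro ⟨hS, hw⟩
      exact ⟨hS, _, hw, (hae _).mpr rfl⟩
  rw [hmem, ← eq_smul_penalizedResolvent_iff (isSelfAdjoint_besselOp d)
    (isSelfAdjoint_charOp hΩ.measurableSet.compl) (charOp_charOp hΩ.measurableSet.compl)
    (by positivity)]
  change u = _ • wellResolvent Ω hΩ ((κ * h ^ 2)⁻¹) u ↔ _
  have h1 : (((lam + κ) / κ : ℝ) : ℂ) = (κ : ℂ)⁻¹ * ((lam + κ : ℝ) : ℂ) := by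
    push_cast
    rw [div_eq_inv_mul]
  rw [h1, mul_smul, eq_inv_smul_iff₀ hκ0]

end WellResolvent

/-! ### Compactness of `H¹(ℝ^d) → L²(Ω)` for bounded `Ω` -/

section KernelOperator

open scoped ENNReal

variable {X : Type*} [MeasurableSpace X] (μ : Measure X) (H : Type*) [NormedAddCommGroup H]
  [NormedSpace ℂ H]

/-- The operator `k ↦ (x ↦ F x k)` from `H` to `L²(X)` attached to a square-integrable family `F` of
functionals on `H`. -/
def kernelOp : Lp (H →L[ℂ] ℂ) 2 μ →L[ℂ] H →L[ℂ] Lp ℂ 2 μ :=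
  LinearMap.mkContinuous₂
    (LinearMap.mk₂ ℂ (fun F k => (ContinuousLinearMap.apply ℂ ℂ k).compLp F)
      (fun F F' k => by
        exact ((ContinuousLinearMap.apply ℂ ℂ k).compLpₗ 2 μ).map_add F F')
      (fun c F k => by
        exact ((ContinuousLinearMap.apply ℂ ℂ k).compLpₗ 2 μ).map_smul c F)
      (fun F k k' => by
        rw [map_add, ContinuousLinearMap.add_compLp])
      (fun c F k => by
        rw [map_smul, ContinuousLinearMap.smul_compLp]))
    1 (fun F k => by
      change ‖(ContinuousLinearMap.apply ℂ ℂ k).compLp F‖ ≤ 1 * ‖F‖ * ‖k‖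
      rw [one_mul, mul_comm]
      refine (ContinuousLinearMap.norm_compLp_le _ _).trans ?_
      gcongr
      refine ContinuousLinearMap.opNorm_le_bound _ (norm_nonneg k) fun f => ?_
      rw [mul_comm]
      exact f.le_opNorm k)

variable {μ H}

theorem kernelOp_ae (F : Lp (H →L[ℂ] ℂ) 2 μ) (k : H) :
    kernelOp μ H F k =ᵐ[μ] fun x => F x k :=
  ContinuousLinearMap.coeFn_compLp' (ContinuousLinearMap.apply ℂ ℂ k) F

/-- Indicator families give operators of rank at most one. Sums of these are dense, the operator
depends continuously on the family, and compact operators form a closed set. -/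
theorem isCompactOperator_kernelOp (F : Lp (H →L[ℂ] ℂ) 2 μ) :
    IsCompactOperator (kernelOp μ H F) := by
  refine Lp.induction ENNReal.ofNat_ne_top
    (motive := fun F => IsCompactOperator (kernelOp μ H F)) ?_ ?_ ?_ F
  · intro c s hs hμs
    have h1 : (kernelOp μ H (Lp.simpleFunc.indicatorConst 2 hs hμs.ne c : Lp (H →L[ℂ] ℂ) 2 μ)) =
        c.smulRight (indicatorConstLp 2 hs hμs.ne (1 : ℂ)) := by
      ext1 k
      refine Lp.ext ?_
      rw [Lp.simpleFunc.coe_indicatorConst]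
      filter_upwards [kernelOp_ae (indicatorConstLp 2 hs hμs.ne c) k,
        indicatorConstLp_coeFn (p := 2) (hs := hs) (hμs := hμs.ne) (c := c),
        indicatorConstLp_coeFn (p := 2) (hs := hs) (hμs := hμs.ne) (c := (1 : ℂ)),
        Lp.coeFn_smul (c k) (indicatorConstLp 2 hs hμs.ne (1 : ℂ))] with x h1 h2 h3 h4
      rw [h1, h2, ContinuousLinearMap.smulRight_apply, h4, Pi.smul_apply, h3]
      by_cases hx : x ∈ s <;> simp [hx]
    rw [h1]
    have h2 : IsCompactOperator (ContinuousLinearMap.toSpanSingleton ℂ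
        (indicatorConstLp 2 hs hμs.ne (1 : ℂ) : Lp ℂ 2 μ)) :=
      isCompactOperator_of_locallyCompactSpace_rng (ContinuousLinearMap.toSpanSingleton ℂ
        (indicatorConstLp 2 hs hμs.ne (1 : ℂ) : Lp ℂ 2 μ))
    exact h2.comp_clm c
  · intro f g hf hg _ h1 h2
    rw [map_add]
    exact h1.add h2
  · have hcont : Continuous (kernelOp μ H) := (kernelOp μ H).continuous
    exact (isClosed_setOfPred_isCompactOperator (σ₁₂ := RingHom.id ℂ) (M₁ := H)
      (M₂ := Lp ℂ 2 μ)).preimage hcont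

end KernelOperator

/-! ### Rellich's theorem by frequency truncation -/

section Rellich

open FourierTransform ContinuousLinearMap
open scoped SchwartzMap ENNReal RealInnerProductSpace

variable {d : ℕ}

/-- Both sides are tested against smooth compactly supported functions. The transform moves to the
test function on either side: in the sense of distributions for the L² transform, by the
multiplication formula for the integral. -/
theorem fourierInvOp_ae {f : L2 d} (hf : Integrable f volume) :
    fourierInvOp d f =ᵐ[volume] 𝓕⁻ (f : Euc d → ℂ) := by
  have hcont : Continuous (𝓕⁻ (f : Euc d → ℂ)) :=
    VectorFourier.fourierIntegral_continuous Real.continuous_fourierChar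
      (by exact (innerSL ℝ).continuous₂.neg) hf
  refine ae_eq_of_integral_contDiff_smul_eq
    ((Lp.memLp (fourierInvOp d f)).locallyIntegrable (by norm_num)) hcont.locallyIntegrable ?_
  intro g hg hgc
  have hg₁ : HasCompactSupport (Complex.ofRealCLM ∘ g) := hgc.comp_left rfl
  have hg₂ : ContDiff ℝ ∞ (Complex.ofRealCLM ∘ g) := by fun_prop
  set ψ : 𝓢(Euc d, ℂ) := hg₁.toSchwartzMap hg₂ with hψ
  have h1 : ∫ x, g x • (fourierInvOp d f) x = ∫ x, (𝓕⁻ ψ) x • f x := by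
    have h2 := congrArg (fun T : 𝓢'(Euc d, ℂ) => T ψ)
      (Lp.fourierInv_toTemperedDistribution_eq f)
    simp only [TemperedDistribution.fourierInv_apply, Lp.toTemperedDistribution_apply] at h2
    rw [h2]
    rfl
  rw [h1]
  have h3 := VectorFourier.integral_fourierIntegral_smul_eq_flip (e := Real.fourierChar)
    (μ := (volume : Measure (Euc d))) (ν := (volume : Measure (Euc d)))
    (L := -innerₗ (Euc d)) (f := ψ) (g := (f : Euc d → ℂ)) Real.continuous_fourierChar
    (by exact (innerSL ℝ).continuous₂.neg) ψ.integrable hf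
  have h4 : (-innerₗ (Euc d)).flip = -innerₗ (Euc d) := by
    ext x y
    simp [real_inner_comm]
  rw [h4] at h3
  rw [SchwartzMap.fourierInv_coe]
  exact h3

theorem norm_fourierChar_sub_le (a b : ℝ) :
    ‖(Real.fourierChar a : ℂ) - Real.fourierChar b‖ ≤ 2 * Real.pi * |a - b| := by
  have h1 : (Real.fourierChar a : ℂ) - Real.fourierChar b =
      Real.fourierChar b * (Real.fourierChar (a - b) - 1) := by
    rw [mul_sub, mul_one, ← Circle.coe_mul, ← AddChar.map_add_eq_mul, add_sub_cancel]
  rw [h1, norm_mul, Circle.norm_coe, one_mul, Real.fourierChar_apply, mul_comm _ Complex.I]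
  refine (Real.norm_exp_I_mul_ofReal_sub_one_le).trans ?_
  rw [Real.norm_eq_abs, abs_mul, abs_of_nonneg (by positivity)]

/-- The function `ξ ↦ 1_{|ξ| ≤ R} e^{-2πi x·ξ}` in `L²(ℝ^d)`. -/
def planeWave (R : ℝ) (x : Euc d) : L2 d :=
  mulOp (fun ξ => ((Real.fourierChar (-⟪ξ, x⟫) : Circle) : ℂ)) (memLp_top_of_bound
    (by
      refine Continuous.aestronglyMeasurable ?_
      have := Real.continuous_fourierChar
      fun_prop) 1 (Eventually.of_forall fun _ => (Circle.norm_coe _).le))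
    (indicatorConstLp 2 measurableSet_closedBall
      (isCompact_closedBall (0 : Euc d) R).measure_lt_top.ne 1)

theorem planeWave_ae (R : ℝ) (x : Euc d) : planeWave R x =ᵐ[volume]
    fun ξ => ((Real.fourierChar (-⟪ξ, x⟫) : Circle) : ℂ) *
      (Metric.closedBall 0 R).indicator (fun _ => 1) ξ := by
  filter_upwards [mulOp_ae (fun ξ => ((Real.fourierChar (-⟪ξ, x⟫) : Circle) : ℂ))
    (memLp_top_of_bound
    (by
      refine Continuous.aestronglyMeasurable ?_
      have := Real.continuous_fourierChar
      fun_prop) 1 (Eventually.of_forall fun _ => (Circle.norm_coe _).le))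
    (indicatorConstLp 2 measurableSet_closedBall
      (isCompact_closedBall (0 : Euc d) R).measure_lt_top.ne 1),
    indicatorConstLp_coeFn (p := 2) (μ := (volume : Measure (Euc d)))
      (hs := measurableSet_closedBall)
      (hμs := (isCompact_closedBall (0 : Euc d) R).measure_lt_top.ne) (c := (1 : ℂ))] with ξ h1 h2
  rw [planeWave, h1, h2]

/-- On |ξ| ≤ R the phases at x and y differ by at most 2πR‖x - y‖, so the map is Lipschitz. -/
theorem continuous_planeWave {R : ℝ} (hR : 0 ≤ R) :
    Continuous (planeWave R : Euc d → L2 d) := by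
  set I : L2 d := indicatorConstLp 2 measurableSet_closedBall
    (isCompact_closedBall (0 : Euc d) R).measure_lt_top.ne 1 with hI
  have hIae : I =ᵐ[volume] (Metric.closedBall 0 R).indicator fun _ => (1 : ℂ) :=
    indicatorConstLp_coeFn
  have hlip : ∀ x y : Euc d, ‖planeWave R x - planeWave R y‖ ≤
      (2 * Real.pi * R * ‖I‖) * ‖x - y‖ := by
    intro x y
    have : ‖planeWave R x - planeWave R y‖ ≤ (2 * Real.pi * R * ‖x - y‖) * ‖I‖ := by
      refine Lp.norm_le_mul_norm_of_ae_le_mul ?_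
      filter_upwards [planeWave_ae R x, planeWave_ae R y,
        Lp.coeFn_sub (planeWave R x) (planeWave R y), hIae]
        with ξ h1 h2 h3 hIξ
      simp only [h3, Pi.sub_apply, h1, h2]
      by_cases hξ : ξ ∈ Metric.closedBall (0 : Euc d) R
      · simp only [hIξ, Set.indicator_of_mem hξ, mul_one, norm_one]
        have hξ' : ‖ξ‖ ≤ R := by simpa using hξ
        have h5 : |-⟪ξ, x⟫ - -⟪ξ, y⟫| ≤ R * ‖x - y‖ := by
          rw [neg_sub_neg, ← inner_sub_right, norm_sub_rev x y]
          refine (abs_real_inner_le_norm _ _).trans ?_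
          gcongr
        refine (norm_fourierChar_sub_le _ _).trans ?_
        have := mul_le_mul_of_nonneg_left h5 Real.two_pi_pos.le
        linarith
      · simp [hIξ, Set.indicator_of_notMem hξ]
    linarith
  exact (LipschitzWith.of_dist_le_mul (K := (2 * Real.pi * R * ‖I‖).toNNReal) fun x y => by
    rw [dist_eq_norm, dist_eq_norm, Real.coe_toNNReal _ (by positivity)]
    exact hlip x y).continuous

/-- For band-limited functions, evaluation at x is the inner product with a plane wave. These
functionals are bounded uniformly on the bounded set Ω, hence square integrable over it. -/
theorem isCompactOperator_charOp_fourierInvOp_charOp {Ω : Set (Euc d)} (hΩ : MeasurableSet Ω)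
    (hb : Bornology.IsBounded Ω) {R : ℝ} (hR : 0 ≤ R) :
    IsCompactOperator (charOp Ω hΩ ∘L fourierInvOp d ∘L
      charOp (Metric.closedBall 0 R) measurableSet_closedBall) := by
  have hcont : Continuous fun x : Euc d => innerSL ℂ (planeWave R x) :=
    (innerSL ℂ).continuous.comp (continuous_planeWave hR)
  have hmem : MemLp (Ω.indicator fun x : Euc d => innerSL ℂ (planeWave R x)) 2 volume := by
    refine (memLp_indicator_iff_restrict (ε := L2 d →L[ℂ] ℂ) hΩ).mpr ?_
    have : IsFiniteMeasure ((volume : Measure (Euc d)).restrict Ω) :=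
      ⟨by rw [Measure.restrict_apply_univ]; exact hb.measure_lt_top⟩
    obtain ⟨C, hC⟩ := (hb.isCompact_closure).exists_bound_of_continuousOn hcont.continuousOn
    refine MemLp.of_bound hcont.aestronglyMeasurable C ?_
    filter_upwards [ae_restrict_mem hΩ] with x hx
    exact hC x (subset_closure hx)
  have heq : charOp Ω hΩ ∘L fourierInvOp d ∘L
      charOp (Metric.closedBall 0 R) measurableSet_closedBall =
      kernelOp volume (L2 d) (hmem.toLp _) := by
    ext1 k
    refine Lp.ext ?_
    set k' := charOp (Metric.closedBall 0 R) measurableSet_closedBall k with hk'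
    have hk'ae := charOp_ae (s := Metric.closedBall (0 : Euc d) R) measurableSet_closedBall k
    have hint : Integrable k' volume := by
      refine Integrable.congr ?_ hk'ae.symm
      rw [integrable_indicator_iff measurableSet_closedBall]
      have : IsFiniteMeasure ((volume : Measure (Euc d)).restrict (Metric.closedBall 0 R)) :=
        ⟨by rw [Measure.restrict_apply_univ]; exact (isCompact_closedBall _ _).measure_lt_top⟩
      exact ((Lp.memLp k).restrict _).integrable (by norm_num)
    filter_upwards [charOp_ae hΩ (fourierInvOp d k'), fourierInvOp_ae hint,
      kernelOp_ae (hmem.toLp _) k, hmem.coeFn_toLp] with x h1 h2 h3 h4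
    change charOp Ω hΩ (fourierInvOp d k') x = _
    rw [h1, h3, h4]
    by_cases hx : x ∈ Ω
    -- The inner product is conjugate-linear in its first argument, so e^(-2πi x·ξ) yields the
    -- inverse Fourier integral.
    · rw [Set.indicator_of_mem hx, Set.indicator_of_mem hx, h2, innerSL_apply_apply, L2.inner_def,
        Real.fourierInv_eq]
      refine integral_congr_ae ?_
      filter_upwards [hk'ae, planeWave_ae R x] with ξ h5 h6
      rw [h5, h6]
      by_cases hξ : ξ ∈ Metric.closedBall (0 : Euc d) R
      · rw [Set.indicator_of_mem hξ, Set.indicator_of_mem hξ, mul_one, RCLike.inner_apply,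
          AddChar.map_neg_eq_inv, ← Circle.coe_inv_eq_conj, inv_inv, Circle.smul_def, smul_eq_mul,
          mul_comm]
      · rw [Set.indicator_of_notMem hξ, Set.indicator_of_notMem hξ]
        simp
    · rw [Set.indicator_of_notMem hx, Set.indicator_of_notMem hx]
      simp
  rw [heq]
  exact isCompactOperator_kernelOp _

/-- **Rellich's theorem**: the embedding of `H¹(ℝ^d)` into `L²(Ω)` is compact for bounded `Ω`. -/
theorem isCompactOperator_charOp_besselOp {Ω : Set (Euc d)} (hΩ : MeasurableSet Ω)
    (hb : Bornology.IsBounded Ω) : IsCompactOperator (charOp Ω hΩ ∘L besselOp d) := by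
  set F : ℕ → L2 d →L[ℂ] L2 d := fun n =>
    (charOp Ω hΩ ∘L fourierInvOp d ∘L
      charOp (Metric.closedBall 0 (n : ℝ)) measurableSet_closedBall) ∘L
      (mulOp (besselSymbol d) (memLp_besselSymbol d) ∘L fourierOp d) with hF
  refine isCompactOperator_of_tendsto (l := atTop) (F := F) ?_ (Eventually.of_forall fun n =>
    (isCompactOperator_charOp_fourierInvOp_charOp hΩ hb (Nat.cast_nonneg n)).comp_clm _)
  -- Beyond |ξ| = n the symbol of J is at most (1 + n²)^(-1/2), so truncation converges in norm.
  have hc : ∀ n : ℕ, ‖F n - charOp Ω hΩ ∘L besselOp d‖ ≤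
      (1 + (n : ℝ) ^ 2) ^ ((-1 : ℝ) / 2) := by
    intro n
    refine opNorm_le_bound _ (by positivity) fun u => ?_
    set B : Set (Euc d) := Metric.closedBall 0 (n : ℝ) with hB
    have hBm : MeasurableSet B := measurableSet_closedBall
    set v := mulOp (besselSymbol d) (memLp_besselSymbol d) (fourierOp d u) with hv
    have e1 : (F n - charOp Ω hΩ ∘L besselOp d) u =
        -charOp Ω hΩ (fourierInvOp d (charOp Bᶜ hBm.compl v)) := by
      have h1 : v = charOp B hBm v + charOp Bᶜ hBm.compl v := (charOp_add_charOp_compl hBm v).symm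
      have h2 : (charOp Ω hΩ ∘L besselOp d) u = charOp Ω hΩ (fourierInvOp d v) := rfl
      have h3 : F n u = charOp Ω hΩ (fourierInvOp d (charOp B hBm v)) := rfl
      rw [sub_apply, h2, h3]
      nth_rw 2 [h1]
      rw [map_add, map_add, sub_add_cancel_left]
    have h4 : ‖charOp Bᶜ hBm.compl v‖ ≤ (1 + (n : ℝ) ^ 2) ^ ((-1 : ℝ) / 2) * ‖fourierOp d u‖ := by
      refine Lp.norm_le_mul_norm_of_ae_le_mul ?_
      filter_upwards [charOp_ae hBm.compl v, mulOp_ae _ (memLp_besselSymbol d) (fourierOp d u)]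
        with x h5 h6
      rw [h5]
      by_cases hx : x ∈ B
      · rw [Set.indicator_of_notMem (by simpa using hx), norm_zero]
        positivity
      · rw [Set.indicator_of_mem (by simpa using hx), hv, h6, norm_mul]
        refine mul_le_mul_of_nonneg_right ?_ (norm_nonneg _)
        rw [besselSymbol, Complex.norm_real, Real.norm_of_nonneg (by positivity)]
        refine Real.rpow_le_rpow_of_nonpos (by positivity) ?_ (by norm_num)
        have hx' : (n : ℝ) < ‖x‖ := by simpa [hB] using hx
        gcongr
    rw [e1, norm_neg]
    refine (norm_mulOp_apply_le (C := 1) _ (fun x => ?_) _).trans ?_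
    · by_cases hx : x ∈ Ω <;> simp [hx]
    · rw [one_mul, norm_fourierInvOp]
      rwa [norm_fourierOp] at h4
  rw [tendsto_iff_norm_sub_tendsto_zero]
  refine squeeze_zero (fun _ => norm_nonneg _) hc ?_
  have h1 : Tendsto (fun n : ℕ => 1 + (n : ℝ) ^ 2) atTop atTop :=
    tendsto_atTop_add_const_left _ _ ((tendsto_pow_atTop two_ne_zero).comp
      tendsto_natCast_atTop_atTop)
  have h2 := (tendsto_rpow_neg_atTop (show (0 : ℝ) < 1 / 2 by norm_num)).comp h1
  refine h2.congr fun n => ?_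
  simp only [Function.comp]
  norm_num

end Rellich

/-! ### Cutoffs, translations and density in `H¹` -/

section Density

open TemperedDistribution FourierTransform ContinuousLinearMap
open scoped SchwartzMap LineDeriv ENNReal Manifold

variable {d : ℕ}

theorem lineDeriv_smulLeftCLM_schwartz (ζ ψ : 𝓢(Euc d, ℂ)) (m : Euc d) :
    ∂_{m} (SchwartzMap.smulLeftCLM ℂ ζ ψ) =
      SchwartzMap.smulLeftCLM ℂ (∂_{m} ζ : 𝓢(Euc d, ℂ)) ψ +
        SchwartzMap.smulLeftCLM ℂ ζ (∂_{m} ψ) := by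
  ext x
  rw [_root_.add_apply, SchwartzMap.lineDerivOp_apply_eq_fderiv,
    SchwartzMap.smulLeftCLM_apply_apply (SchwartzMap.hasTemperateGrowth _),
    SchwartzMap.smulLeftCLM_apply_apply (SchwartzMap.hasTemperateGrowth _),
    SchwartzMap.lineDerivOp_apply_eq_fderiv, SchwartzMap.lineDerivOp_apply_eq_fderiv,
    SchwartzMap.smulLeftCLM_apply (SchwartzMap.hasTemperateGrowth _)]
  have h := fderiv_mul (ζ.differentiableAt (x := x)) (ψ.differentiableAt (x := x))
  change fderiv ℝ ((ζ : Euc d → ℂ) * (ψ : Euc d → ℂ)) x m = _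
  rw [h]
  simp only [add_apply, smul_apply, smul_eq_mul]
  ring

theorem lineDeriv_smulLeftCLM (ζ : 𝓢(Euc d, ℂ)) (f : 𝓢'(Euc d, ℂ)) (m : Euc d) :
    ∂_{m} (smulLeftCLM ℂ ζ f) =
      smulLeftCLM ℂ (∂_{m} ζ : 𝓢(Euc d, ℂ)) f + smulLeftCLM ℂ ζ (∂_{m} f) := by
  ext ψ
  change f (SchwartzMap.smulLeftCLM ℂ ζ (-∂_{m} ψ)) =
    f (SchwartzMap.smulLeftCLM ℂ (∂_{m} ζ : 𝓢(Euc d, ℂ)) ψ) +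
      f (-∂_{m} (SchwartzMap.smulLeftCLM ℂ ζ ψ))
  rw [lineDeriv_smulLeftCLM_schwartz, ← map_add]
  congr 1
  rw [map_neg]
  abel

/-- Multiplication by a Schwartz function on `L²(ℝ^d)`. -/
def schwartzMulOp (ζ : 𝓢(Euc d, ℂ)) : L2 d →L[ℂ] L2 d := mulOp ζ ζ.memLp_top

theorem schwartzMulOp_ae (ζ : 𝓢(Euc d, ℂ)) (u : L2 d) :
    schwartzMulOp ζ u =ᵐ[volume] fun x => ζ x * u x := mulOp_ae _ _ u

theorem toTD_schwartzMulOp (ζ : 𝓢(Euc d, ℂ)) (u : L2 d) :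
    ((schwartzMulOp ζ u : L2 d) : 𝓢'(Euc d, ℂ)) = smulLeftCLM ℂ ζ (u : 𝓢'(Euc d, ℂ)) :=
  toTD_mulOp _ ζ.hasTemperateGrowth u

theorem two_pi_I_ne_zero : (2 * Real.pi * Complex.I) ≠ 0 := by
  simp [Real.pi_ne_zero]

/-- Multiplication by a Schwartz function on `H¹(ℝ^d)`, transported to `L²(ℝ^d)` by the Bessel
potential. -/
def cutoffOp (ζ : 𝓢(Euc d, ℂ)) : L2 d →L[ℂ] L2 d :=
  besselOp d ∘L schwartzMulOp ζ ∘L besselOp d + ∑ i, besselDerivOp i ∘L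
    (schwartzMulOp ζ ∘L besselDerivOp i + (2 * Real.pi * Complex.I)⁻¹ •
      (schwartzMulOp (∂_{EuclideanSpace.single i (1 : ℝ)} ζ) ∘L besselOp d))

/-- Leibniz's rule gives the gradient of ζJv, and `besselOp_of_lineDeriv` recovers the potential
from function and gradient. -/
theorem besselOp_cutoffOp (ζ : 𝓢(Euc d, ℂ)) (v : L2 d) :
    besselOp d (cutoffOp ζ v) = schwartzMulOp ζ (besselOp d v) := by
  have h := besselOp_of_lineDeriv (u := schwartzMulOp ζ (besselOp d v))
    (g := fun i => schwartzMulOp ζ (besselDerivOp i v) + (2 * Real.pi * Complex.I)⁻¹ •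
      (schwartzMulOp (∂_{EuclideanSpace.single i (1 : ℝ)} ζ) (besselOp d v))) fun i => by
    rw [toTD_schwartzMulOp, lineDeriv_smulLeftCLM, lineDeriv_besselOp, toTD_add, toTD_smul,
      toTD_schwartzMulOp, toTD_schwartzMulOp, smul_add, smul_inv_smul₀ two_pi_I_ne_zero, map_smul,
      add_comm]
  rw [← h]
  congr 1
  simp [cutoffOp, sum_apply]

theorem besselOp_toLp (f : 𝓢(Euc d, ℂ)) :
    besselOp d (f.toLp 2) = (SchwartzMap.fourierMultiplierCLM ℂ (besselSymbol d) f).toLp 2 := by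
  refine toTD_injective ?_
  rw [toTD_besselOp, Lp.toTemperedDistribution_toLp_eq, Lp.toTemperedDistribution_toLp_eq]
  exact fourierMultiplierCLM_toTemperedDistributionCLM_eq (hasTemperateGrowth_besselSymbol d) f

theorem IsTestFunction.zero (Ω : Set (Euc d)) : IsTestFunction Ω (0 : Euc d → ℂ) :=
  ⟨contDiff_const, HasCompactSupport.zero, by simp [tsupport]⟩

theorem IsTestFunction.add {Ω : Set (Euc d)} {φ ψ : Euc d → ℂ} (hφ : IsTestFunction Ω φ)
    (hψ : IsTestFunction Ω ψ) : IsTestFunction Ω (φ + ψ) :=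
  ⟨hφ.1.add hψ.1, hφ.2.add hψ.2, (tsupport_add φ ψ).trans (Set.union_subset hφ.3 hψ.3)⟩

theorem IsTestFunction.const_smul {Ω : Set (Euc d)} {φ : Euc d → ℂ} (hφ : IsTestFunction Ω φ)
    (c : ℂ) : IsTestFunction Ω (c • φ) :=
  ⟨contDiff_const.smul hφ.1, hφ.2.smul_left (f := fun _ => c),
    (tsupport_smul_subset_right (fun _ => c) φ).trans hφ.3⟩

/-- The elements of `L²(ℝ^d)` whose Bessel potential is a test function. -/
def testPotentials (Ω : Set (Euc d)) : Submodule ℂ (L2 d) where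
  carrier := {w | ∃ φ : Euc d → ℂ, IsTestFunction Ω φ ∧ besselOp d w =ᵐ[volume] φ}
  zero_mem' := ⟨0, IsTestFunction.zero Ω, by rw [map_zero]; exact Lp.coeFn_zero ℂ 2 volume⟩
  add_mem' := by
    rintro v w ⟨φ, hφ, h1⟩ ⟨ψ, hψ, h2⟩
    refine ⟨φ + ψ, hφ.add hψ, ?_⟩
    rw [map_add]
    exact (Lp.coeFn_add _ _).trans (h1.add h2)
  smul_mem' := by
    rintro c v ⟨φ, hφ, h1⟩
    refine ⟨c • φ, hφ.const_smul c, ?_⟩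
    rw [map_smul]
    exact (Lp.coeFn_smul _ _).trans (h1.const_smul c)

/-- J preserves Schwartz functions, so ζ times Jf is smooth with compact support in Ω. -/
theorem cutoffOp_toLp_mem_testPotentials {Ω : Set (Euc d)} {ζ : 𝓢(Euc d, ℂ)}
    (hζ : IsTestFunction Ω ζ) (f : 𝓢(Euc d, ℂ)) : cutoffOp ζ (f.toLp 2) ∈ testPotentials Ω := by
  set ψ := SchwartzMap.fourierMultiplierCLM ℂ (besselSymbol d) f with hψ
  refine ⟨fun x => ζ x * ψ x, ⟨hζ.contDiff.mul (ψ.smooth ⊤), hζ.hasCompactSupport.mul_right,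
    (tsupport_mul_subset_left (f := ζ) (g := ψ)).trans hζ.tsupport_subset⟩, ?_⟩
  rw [besselOp_cutoffOp, besselOp_toLp]
  filter_upwards [schwartzMulOp_ae ζ (ψ.toLp 2), ψ.coeFn_toLp 2] with x h1 h2
  rw [h1, h2]

theorem cutoffOp_mem_closure_testPotentials {Ω : Set (Euc d)} {ζ : 𝓢(Euc d, ℂ)}
    (hζ : IsTestFunction Ω ζ) (v : L2 d) :
    cutoffOp ζ v ∈ (testPotentials Ω).topologicalClosure := by
  have hd : DenseRange (SchwartzMap.toLpCLM ℝ ℂ 2 (volume : Measure (Euc d))) :=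
    SchwartzMap.denseRange_toLpCLM (by norm_num)
  refine hd.induction_on (p := fun v => cutoffOp ζ v ∈ (testPotentials Ω).topologicalClosure) v
    ((testPotentials Ω).isClosed_topologicalClosure.preimage (cutoffOp ζ).continuous) fun f => ?_
  exact (testPotentials Ω).le_topologicalClosure (cutoffOp_toLp_mem_testPotentials hζ f)

theorem exists_isTestFunction_eq_one {Ω K : Set (Euc d)} (hΩ : IsOpen Ω) (hK : IsCompact K)
    (hKΩ : K ⊆ Ω) : ∃ ζ : Euc d → ℂ, IsTestFunction Ω ζ ∧ ∀ x ∈ K, ζ x = 1 := by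
  obtain ⟨L, hL, hKL, hLΩ⟩ := exists_compact_between hK hΩ hKΩ
  obtain ⟨f, hf0, hf1, -⟩ := exists_contMDiffMap_zero_one_of_isClosed (n := ⊤) 𝓘(ℝ, Euc d)
    (s := (interior L)ᶜ) (t := K) isOpen_interior.isClosed_compl hK.isClosed
    (Set.disjoint_left.mpr fun x hx hxK => hx (hKL hxK))
  have hsub : tsupport (fun x => (f x : ℂ)) ⊆ L := by
    refine closure_minimal (fun x hx => ?_) hL.isClosed
    by_contra hxL
    exact hx (by simp [hf0 (show x ∈ (interior L)ᶜ from fun h => hxL (interior_subset h))])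
  refine ⟨fun x => (f x : ℂ), ⟨Complex.ofRealCLM.contDiff.comp f.contMDiff.contDiff,
    hL.of_isClosed_subset (isClosed_tsupport _) hsub,
    hsub.trans hLΩ⟩, fun x hx => by simp [hf1 hx]⟩

/-- A cutoff equal to 1 on K fixes Jv, hence `cutoffOp` fixes v; the values of `cutoffOp` are limits
of test potentials because Schwartz functions are dense. -/
theorem mem_closure_testPotentials_of_compact {Ω K : Set (Euc d)} (hΩ : IsOpen Ω)
    (hK : IsCompact K) (hKΩ : K ⊆ Ω) {v : L2 d} (hv : ∀ᵐ x, x ∉ K → besselOp d v x = 0) :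
    v ∈ (testPotentials Ω).topologicalClosure := by
  obtain ⟨ζ₀, hζ₀, hζ1⟩ := exists_isTestFunction_eq_one hΩ hK hKΩ
  set ζ : 𝓢(Euc d, ℂ) := hζ₀.hasCompactSupport.toSchwartzMap hζ₀.contDiff with hζ
  have hcut : cutoffOp ζ v = v := by
    refine besselOp_injective d ?_
    rw [besselOp_cutoffOp]
    refine Lp.ext ?_
    filter_upwards [hv, schwartzMulOp_ae ζ (besselOp d v)] with x h1 h2
    rw [h2]
    by_cases hx : x ∈ K
    · change ζ₀ x * _ = _
      rw [hζ1 x hx, one_mul]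
    · rw [h1 hx, mul_zero]
  rw [← hcut]
  exact cutoffOp_mem_closure_testPotentials hζ₀ v

/-- Translation by `a` on `L²(ℝ^d)`. -/
def translateOp (a : Euc d) : L2 d →ₗᵢ[ℂ] L2 d :=
  Lp.compMeasurePreservingₗᵢ ℂ (fun x => x - a) (measurePreserving_sub_right volume a)

theorem translateOp_ae (a : Euc d) (u : L2 d) :
    translateOp a u =ᵐ[volume] fun x => u (x - a) :=
  Lp.coeFn_compMeasurePreserving u (measurePreserving_sub_right volume a)

theorem tendsto_translateOp (u : L2 d) :
    Tendsto (fun a : Euc d => translateOp a u) (𝓝 0) (𝓝 u) := by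
  have hcont : Continuous fun a : Euc d => translateOp a u := by
    let g : Euc d → C(Euc d, Euc d) := fun a => ⟨fun x => x - a, by fun_prop⟩
    have hg : Continuous g := ContinuousMap.continuous_of_continuous_uncurry _ (by
      change Continuous fun p : Euc d × Euc d => p.2 - p.1
      fun_prop)
    exact Continuous.compMeasurePreservingLp (f := fun _ => u) continuous_const hg
      (fun a => measurePreserving_sub_right volume a) (by norm_num)
  have h0 : translateOp 0 u = u := by
    refine Lp.ext ?_
    filter_upwards [translateOp_ae 0 u] with x hx
    rw [hx, sub_zero]
  have := hcont.tendsto 0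
  rwa [h0] at this

theorem toTD_translateOp (a : Euc d) (u : L2 d) (ψ : 𝓢(Euc d, ℂ)) :
    ((translateOp a u : L2 d) : 𝓢'(Euc d, ℂ)) ψ =
      (u : 𝓢'(Euc d, ℂ)) (SchwartzMap.compSubConstCLM ℂ (-a) ψ) := by
  rw [Lp.toTemperedDistribution_apply, Lp.toTemperedDistribution_apply,
    ← integral_sub_right_eq_self (fun x => (SchwartzMap.compSubConstCLM ℂ (-a) ψ) x • u x) a]
  refine integral_congr_ae ?_
  filter_upwards [translateOp_ae a u] with x hx
  rw [hx, SchwartzMap.compSubConstCLM_apply]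
  simp

theorem lineDeriv_compSubConstCLM (a m : Euc d) (ψ : 𝓢(Euc d, ℂ)) :
    ∂_{m} (SchwartzMap.compSubConstCLM ℂ a ψ) = SchwartzMap.compSubConstCLM ℂ a (∂_{m} ψ) := by
  ext x
  rw [SchwartzMap.lineDerivOp_apply_eq_fderiv, SchwartzMap.compSubConstCLM_apply,
    SchwartzMap.lineDerivOp_apply_eq_fderiv]
  change fderiv ℝ (fun x => ψ (x - a)) x m = _
  rw [fderiv_comp_sub]

theorem lineDeriv_translateOp {u g : L2 d} {m : Euc d} {c : ℂ}
    (h : ∂_{m} (u : 𝓢'(Euc d, ℂ)) = c • (g : 𝓢'(Euc d, ℂ))) (a : Euc d) :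
    ∂_{m} ((translateOp a u : L2 d) : 𝓢'(Euc d, ℂ)) =
      c • ((translateOp a g : L2 d) : 𝓢'(Euc d, ℂ)) := by
  ext ψ
  have h1 := congrArg (fun T : 𝓢'(Euc d, ℂ) => T (SchwartzMap.compSubConstCLM ℂ (-a) ψ)) h
  rw [lineDerivOp_apply_apply, toTD_translateOp, map_neg, ← lineDeriv_compSubConstCLM]
  refine h1.trans ?_
  change c • (g : 𝓢'(Euc d, ℂ)) _ = c • ((translateOp a g : L2 d) : 𝓢'(Euc d, ℂ)) ψ
  rw [toTD_translateOp]

/-- Translation on `H¹(ℝ^d)`, transported to `L²(ℝ^d)` by the Bessel potential. -/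
def translatePotential (a : Euc d) (v : L2 d) : L2 d :=
  besselOp d (translateOp a (besselOp d v)) +
    ∑ i, besselDerivOp i (translateOp a (besselDerivOp i v))

theorem besselOp_translatePotential (a : Euc d) (v : L2 d) :
    besselOp d (translatePotential a v) = translateOp a (besselOp d v) :=
  besselOp_of_lineDeriv fun i => lineDeriv_translateOp (lineDeriv_besselOp i v) a

theorem tendsto_translatePotential (v : L2 d) :
    Tendsto (fun a => translatePotential a v) (𝓝 0) (𝓝 v) := by
  nth_rw 2 [← besselOp_add_sum v]
  refine Tendsto.add ?_ (tendsto_finsetSum _ fun i _ => ?_)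
  · exact ((besselOp d).continuous.tendsto _).comp (tendsto_translateOp _)
  · exact ((besselDerivOp i).continuous.tendsto _).comp (tendsto_translateOp _)

end Density

/-! ### Approximation by test functions up to a C¹ boundary -/

section Boundary

open scoped SchwartzMap Manifold

variable {d : ℕ} {Ω : Set (Euc d)}

/-- A set with `C¹` boundary is locally shifted into itself by small multiples of some vector. -/
theorem HasC1Boundary.exists_shift (hC : HasC1Boundary Ω) (hΩ : IsOpen Ω) {x : Euc d}
    (hx : x ∈ closure Ω) : ∃ (W : Set (Euc d)) (e : Euc d) (t₀ : ℝ), IsOpen W ∧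
      Bornology.IsBounded W ∧ x ∈ W ∧ 0 < t₀ ∧
      ∀ y ∈ closure Ω ∩ W, ∀ t, 0 < t → t < t₀ → y + t • e ∈ Ω := by
  by_cases hxΩ : x ∈ Ω
  · refine ⟨Ω ∩ Metric.ball x 1, 0, 1, hΩ.inter Metric.isOpen_ball,
      Metric.isBounded_ball.subset Set.inter_subset_right, ⟨hxΩ, Metric.mem_ball_self one_pos⟩,
      one_pos, fun y hy t _ _ => ?_⟩
    simpa using hy.2.1
  · obtain ⟨U, φ, hU, hxU, hφ, hφx, hUΩ⟩ := hC x ⟨hx, by rwa [hΩ.interior_eq]⟩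
    obtain ⟨v, hv⟩ : ∃ v, fderiv ℝ φ x v ≠ 0 := by
      by_contra! h
      exact hφx (ContinuousLinearMap.ext h)
    -- Scaled so that the derivative of φ along e at x is -1.
    set e : Euc d := -((fderiv ℝ φ x v)⁻¹ • v) with he
    have hex : fderiv ℝ φ x e < 0 := by
      rw [he, map_neg, map_smul, smul_eq_mul, inv_mul_cancel₀ hv]
      norm_num
    have hcont : ContinuousAt (fun z => fderiv ℝ φ z e) x :=
      ((hφ.continuousOn_fderiv_of_isOpen hU le_rfl).continuousAt (hU.mem_nhds hxU)).clm_apply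
        continuousAt_const
    obtain ⟨r, hr, hball⟩ := Metric.mem_nhds_iff.mp
      (Filter.inter_mem (hU.mem_nhds hxU) (hcont.eventually_lt_const hex))
    -- Starting within r/2 of x and moving by less than r/2 keeps the segment in the ball of radius
    -- r, where φ decreases along e.
    refine ⟨Metric.ball x (r / 2), e, r / (2 * (‖e‖ + 1)), Metric.isOpen_ball,
      Metric.isBounded_ball, Metric.mem_ball_self (by positivity), by positivity,
      fun y hy t ht ht₀ => ?_⟩
    have hmem : ∀ s ∈ Set.Icc 0 t, y + s • e ∈ Metric.ball x r := by
      intro s hs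
      rw [Metric.mem_ball, dist_eq_norm]
      have h1 : ‖y - x‖ < r / 2 := by
        rw [← dist_eq_norm]; exact hy.2
      have h2 : s * ‖e‖ ≤ t * (‖e‖ + 1) := by
        have := hs.1; have := hs.2
        gcongr
        linarith
      have h3 : t * (‖e‖ + 1) < r / 2 := by
        rw [lt_div_iff₀ (by positivity)] at ht₀
        linarith
      calc ‖y + s • e - x‖ = ‖(y - x) + s • e‖ := by congr 1; abel
        _ ≤ ‖y - x‖ + ‖s • e‖ := norm_add_le _ _
        _ = ‖y - x‖ + s * ‖e‖ := by rw [norm_smul, Real.norm_of_nonneg hs.1]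
        _ < r := by linarith
    have hderiv : ∀ s ∈ Set.Icc 0 t,
        HasDerivAt (fun s : ℝ => φ (y + s • e)) (fderiv ℝ φ (y + s • e) e) s := by
      intro s hs
      have h1 : DifferentiableAt ℝ φ (y + s • e) :=
        (hφ.differentiableOn one_ne_zero).differentiableAt (hU.mem_nhds (hball (hmem s hs)).1)
      have h2 : HasDerivAt (fun s : ℝ => y + s • e) e s := by
        simpa using ((hasDerivAt_id s).smul_const e).const_add y
      exact h1.hasFDerivAt.comp_hasDerivAt s h2
    have hanti : StrictAntiOn (fun s : ℝ => φ (y + s • e)) (Set.Icc 0 t) := by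
      refine strictAntiOn_of_deriv_neg (convex_Icc 0 t)
        (fun s hs => (hderiv s hs).continuousAt.continuousWithinAt) fun s hs => ?_
      have hs' := interior_subset hs
      rw [(hderiv s hs').deriv]
      exact (hball (hmem s hs')).2
    have hlt := hanti (Set.left_mem_Icc.mpr ht.le) (Set.right_mem_Icc.mpr ht.le) ht
    simp only [zero_smul, add_zero] at hlt
    have hyU : y ∈ U := (hball (Metric.ball_subset_ball (by linarith) hy.2)).1
    -- A point of the closure may lie on the boundary, so only a weak inequality holds; the strict
    -- decrease along e makes up for it.
    have hφy : φ y ≤ 0 := by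
      by_contra! hpos
      have hev : ∀ᶠ z in 𝓝 y, z ∈ U ∧ 0 < φ z :=
        (hU.eventually_mem hyU).and
          ((hφ.continuousOn.continuousAt (hU.mem_nhds hyU)).eventually_const_lt hpos)
      obtain ⟨z, hz, hzΩ⟩ := mem_closure_iff_nhds.mp hy.1 _ hev
      exact absurd ((hUΩ z hz.1).mp hzΩ) (not_lt.mpr hz.2.le)
    exact (hUΩ _ (hball (hmem t (Set.right_mem_Icc.mpr ht.le))).1).mpr (hlt.trans_le hφy)

/-- Translation by te moves the support of Jv into a compact subset of Ω, and translations tend to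
the identity in H¹ as t → 0. -/
theorem mem_closure_testPotentials_of_shift (hΩ : IsOpen Ω) {K : Set (Euc d)} (hK : IsCompact K)
    {e : Euc d} {t₀ : ℝ} (ht₀ : 0 < t₀) (h : ∀ y ∈ K, ∀ t, 0 < t → t < t₀ → y + t • e ∈ Ω)
    {v : L2 d} (hv : ∀ᵐ x, x ∉ K → besselOp d v x = 0) :
    v ∈ (testPotentials Ω).topologicalClosure := by
  have hlim : Tendsto (fun t : ℝ => translatePotential (t • e) v) (𝓝[>] 0) (𝓝 v) := by
    refine (tendsto_translatePotential v).comp (tendsto_nhdsWithin_of_tendsto_nhds ?_)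
    have : Continuous fun t : ℝ => t • e := by fun_prop
    simpa using this.tendsto 0
  refine (testPotentials Ω).isClosed_topologicalClosure.mem_of_tendsto hlim ?_
  filter_upwards [Ioo_mem_nhdsGT ht₀] with t ht
  refine mem_closure_testPotentials_of_compact hΩ (K := (fun y => y + t • e) '' K)
    (hK.image (by fun_prop)) ?_ ?_
  · rintro _ ⟨y, hy, rfl⟩
    exact h y hy t ht.1 ht.2
  · rw [besselOp_translatePotential]
    filter_upwards [translateOp_ae (t • e) (besselOp d v),
      (measurePreserving_sub_right volume (t • e)).quasiMeasurePreserving.ae hv] with x h1 h2 hx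
    rw [h1]
    exact h2 fun hxK => hx ⟨_, hxK, sub_add_cancel _ _⟩

/-- The functions in `H¹(ℝ^d)` that vanish outside `Ω` are `H¹` limits of test functions if `Ω` is
bounded with `C¹` boundary. -/
theorem HasC1Boundary.mem_closure_testPotentials (hC : HasC1Boundary Ω) (hΩ : IsOpen Ω)
    (hb : Bornology.IsBounded Ω) {v : L2 d} (hv : ∀ᵐ x, x ∉ Ω → besselOp d v x = 0) :
    v ∈ (testPotentials Ω).topologicalClosure := by
  choose! W e t₀ hWo hWb hxW ht₀ hshift using
    fun (x : Euc d) (hx : x ∈ closure Ω) => hC.exists_shift hΩ hx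
  obtain ⟨s, hs, hcover⟩ := hb.isCompact_closure.elim_nhds_subcover W
    fun x hx => (hWo x hx).mem_nhds (hxW x hx)
  -- Each piece of the partition is supported where a single shift vector works. The pieces of v sum
  -- to v, as the partition sums to 1 on Ω and Jv vanishes elsewhere.
  obtain ⟨f, hf⟩ := SmoothPartitionOfUnity.exists_isSubordinate 𝓘(ℝ, Euc d)
    (isClosed_closure (s := Ω)) (fun i : s => W i) (fun i => hWo i (hs i i.2))
    (hcover.trans (by rw [Set.iUnion_subtype]))
  have hcpt : ∀ i, IsCompact (tsupport (f i)) := fun i =>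
    Metric.isCompact_of_isClosed_isBounded (isClosed_tsupport _) ((hWb i (hs i i.2)).subset (hf i))
  have hsub : ∀ i, tsupport (fun x => ((f i x : ℝ) : ℂ)) ⊆ tsupport (f i) := fun i =>
    closure_mono fun x hx => by simpa using hx
  have hζc : ∀ i, HasCompactSupport fun x => ((f i x : ℝ) : ℂ) := fun i =>
    (hcpt i).of_isClosed_subset (isClosed_tsupport _) (hsub i)
  have hζs : ∀ i, ContDiff ℝ ∞ fun x => ((f i x : ℝ) : ℂ) := fun i =>
    Complex.ofRealCLM.contDiff.comp (f i).contMDiff.contDiff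
  set ζ : s → 𝓢(Euc d, ℂ) := fun i => (hζc i).toSchwartzMap (hζs i) with hζ
  have hsum : ∑ i, cutoffOp (ζ i) v = v := by
    refine besselOp_injective d ?_
    rw [map_sum]
    simp only [besselOp_cutoffOp]
    refine Lp.ext ?_
    have hall : ∀ᵐ x, ∀ i, schwartzMulOp (ζ i) (besselOp d v) x = ζ i x * besselOp d v x :=
      ae_all_iff.mpr fun i => schwartzMulOp_ae _ _
    filter_upwards [hall, hv,
      Lp.coeFn_finsetSum Finset.univ fun i => schwartzMulOp (ζ i) (besselOp d v)]
      with x h1 h2 h3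
    rw [h3, Finset.sum_apply]
    simp only [h1]
    rw [← Finset.sum_mul]
    by_cases hx : x ∈ Ω
    · have h4 := f.sum_eq_one (subset_closure hx)
      rw [finsum_eq_sum_of_fintype] at h4
      change (∑ i, ((f i x : ℝ) : ℂ)) * _ = _
      rw [← Complex.ofReal_sum, h4, Complex.ofReal_one, one_mul]
    · rw [h2 hx, mul_zero]
  rw [← hsum]
  refine Submodule.sum_mem _ fun i _ => ?_
  refine mem_closure_testPotentials_of_shift hΩ (K := closure Ω ∩ tsupport (f i))
    ((hcpt i).inter_left isClosed_closure) (ht₀ i (hs i i.2))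
    (fun y hy => hshift i (hs i i.2) y ⟨hy.1, hf i hy.2⟩) ?_
  rw [besselOp_cutoffOp]
  filter_upwards [schwartzMulOp_ae (ζ i) (besselOp d v), hv] with x h1 h2 hx
  rw [h1]
  by_cases hxΩ : x ∈ closure Ω
  · have : f i x = 0 := by
      by_contra h
      exact hx ⟨hxΩ, subset_tsupport _ h⟩
    change ((f i x : ℝ) : ℂ) * _ = 0
    rw [this, Complex.ofReal_zero, zero_mul]
  · rw [h2 fun h => hxΩ (subset_closure h), mul_zero]

end Boundary

/-! ### Extension by zero and the resolvent of the Dirichlet Laplacian -/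

section Extension

variable {d : ℕ} {Ω : Set (Euc d)}

theorem memLp_indicator_L2On (hΩ : MeasurableSet Ω) (u : L2On Ω) :
    MemLp (Ω.indicator fun x => u x) 2 (volume : Measure (Euc d)) :=
  (memLp_indicator_iff_restrict hΩ).mpr (Lp.memLp u)

theorem ae_indicator_eq_of_ae_restrict (hΩ : MeasurableSet Ω) {f g : Euc d → ℂ}
    (h : f =ᵐ[volume.restrict Ω] g) : Ω.indicator f =ᵐ[volume] Ω.indicator g := by
  filter_upwards [(ae_restrict_iff' hΩ).mp h] with x hx
  by_cases hxΩ : x ∈ Ω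
  · rw [Set.indicator_of_mem hxΩ, Set.indicator_of_mem hxΩ, hx hxΩ]
  · rw [Set.indicator_of_notMem hxΩ, Set.indicator_of_notMem hxΩ]

/-- Extension by zero, from `L²(Ω)` to `L²(ℝ^d)`. -/
def extendZero (Ω : Set (Euc d)) (hΩ : MeasurableSet Ω) : L2On Ω →ₗᵢ[ℂ] L2 d where
  toFun u := (memLp_indicator_L2On hΩ u).toLp _
  map_add' u v := by
    rw [← MemLp.toLp_add, MemLp.toLp_eq_toLp_iff]
    refine (ae_indicator_eq_of_ae_restrict hΩ (Lp.coeFn_add u v)).trans (Eventually.of_forall ?_)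
    intro x
    exact congrFun (Set.indicator_add Ω (fun x => u x) fun x => v x) x
  map_smul' c u := by
    rw [RingHom.id_apply, ← MemLp.toLp_const_smul, MemLp.toLp_eq_toLp_iff]
    refine (ae_indicator_eq_of_ae_restrict hΩ (Lp.coeFn_smul c u)).trans (Eventually.of_forall ?_)
    intro x
    exact congrFun (Set.indicator_const_smul Ω c fun x => u x) x
  norm_map' u := by
    change ‖(memLp_indicator_L2On hΩ u).toLp _‖ = ‖u‖
    rw [Lp.norm_toLp, Lp.norm_def, eLpNorm_indicator_eq_eLpNorm_restrict hΩ]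

theorem extendZero_ae (hΩ : MeasurableSet Ω) (u : L2On Ω) :
    extendZero Ω hΩ u =ᵐ[volume] Ω.indicator fun x => u x :=
  (memLp_indicator_L2On hΩ u).coeFn_toLp

/-- Restriction, from `L²(ℝ^d)` to `L²(Ω)`. -/
def restrictOp (Ω : Set (Euc d)) : L2 d →L[ℂ] L2On Ω := LpToLpRestrictCLM (Euc d) ℂ ℂ volume 2 Ω

theorem restrictOp_ae (u : L2 d) : restrictOp Ω u =ᵐ[volume.restrict Ω] u :=
  LpToLpRestrictCLM_coeFn ℂ Ω u

theorem charOp_compl_extendZero (hΩ : MeasurableSet Ω) (u : L2On Ω) :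
    charOp Ωᶜ hΩ.compl (extendZero Ω hΩ u) = 0 := by
  refine (Lp.eq_zero_iff_ae_eq_zero).mpr ?_
  filter_upwards [charOp_ae hΩ.compl (extendZero Ω hΩ u), extendZero_ae hΩ u] with x h1 h2
  rw [h1]
  by_cases hx : x ∈ Ω
  · simp [hx]
  · simp [hx, h2]

theorem ae_eq_zero_of_charOp_compl (hΩ : MeasurableSet Ω) {u : L2 d}
    (hu : charOp Ωᶜ hΩ.compl u = 0) : ∀ᵐ x, x ∉ Ω → u x = 0 := by
  filter_upwards [charOp_ae hΩ.compl u, (Lp.eq_zero_iff_ae_eq_zero).mp hu] with x h1 h2 hx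
  rw [h2, Set.indicator_of_mem (by exact hx)] at h1
  exact h1.symm

theorem extendZero_restrictOp (hΩ : MeasurableSet Ω) {u : L2 d}
    (hu : charOp Ωᶜ hΩ.compl u = 0) : extendZero Ω hΩ (restrictOp Ω u) = u := by
  refine Lp.ext ?_
  filter_upwards [extendZero_ae hΩ (restrictOp Ω u),
    ae_indicator_eq_of_ae_restrict hΩ (restrictOp_ae u), ae_eq_zero_of_charOp_compl hΩ hu]
    with x h1 h2 h3
  rw [h1, h2]
  by_cases hx : x ∈ Ω
  · rw [Set.indicator_of_mem hx]
  · rw [Set.indicator_of_notMem hx, h3 hx]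

open scoped ComplexConjugate in
theorem inner_extendZero (hΩ : MeasurableSet Ω) {w : L2 d} {ψ : Euc d → ℂ}
    (hw : w =ᵐ[volume] ψ) (u : L2On Ω) :
    inner ℂ w (extendZero Ω hΩ u) = ∫ x in Ω, u x * conj (ψ x) := by
  rw [L2.inner_def, ← integral_indicator hΩ]
  refine integral_congr_ae ?_
  filter_upwards [hw, extendZero_ae hΩ u] with x h1 h2
  rw [h1, h2, RCLike.inner_apply]
  by_cases hx : x ∈ Ω <;> simp [hx]

end Extension

/-! ### H¹₀(Ω) through the Bessel potential -/

section TestFunctions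

open TemperedDistribution
open scoped SchwartzMap LineDeriv ComplexConjugate Laplacian

variable {d : ℕ} {Ω : Set (Euc d)}

theorem IsTestFunction.partialDeriv {φ : Euc d → ℂ} (hφ : IsTestFunction Ω φ) (i : Fin d) :
    IsTestFunction Ω (ParticleInWell.partialDeriv i φ) :=
  ⟨(hφ.contDiff.fderiv_right (m := ∞) (by simp)).clm_apply contDiff_const,
    hφ.hasCompactSupport.fderiv_apply (𝕜 := ℝ) (EuclideanSpace.single i 1),
    (tsupport_fderiv_apply_subset ℝ _).trans hφ.tsupport_subset⟩

theorem IsTestFunction.conj {φ : Euc d → ℂ} (hφ : IsTestFunction Ω φ) :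
    IsTestFunction Ω fun x => conj (φ x) :=
  ⟨Complex.conjCLE.contDiff.comp hφ.contDiff, hφ.hasCompactSupport.comp_left (map_zero _),
    (closure_mono fun x hx => by simpa using hx : _ ⊆ tsupport φ).trans hφ.tsupport_subset⟩

theorem partialDeriv_conj (i : Fin d) (φ : Euc d → ℂ) (x : Euc d) :
    partialDeriv i (fun x => conj (φ x)) x = conj (partialDeriv i φ x) := by
  have := Complex.conjCLE.comp_fderiv (f := φ) (x := x)
  change fderiv ℝ (Complex.conjCLE ∘ φ) x _ = _
  rw [this]
  rfl

/-- A test function as a Schwartz function. -/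
def IsTestFunction.toSchwartz {φ : Euc d → ℂ} (hφ : IsTestFunction Ω φ) : 𝓢(Euc d, ℂ) :=
  hφ.hasCompactSupport.toSchwartzMap hφ.contDiff

theorem coe_lineDeriv_schwartz (i : Fin d) (ζ : 𝓢(Euc d, ℂ)) :
    ((∂_{EuclideanSpace.single i (1 : ℝ)} ζ : 𝓢(Euc d, ℂ)) : Euc d → ℂ) = partialDeriv i ζ :=
  funext fun _ => SchwartzMap.lineDerivOp_apply_eq_fderiv _ _ _

theorem toTD_lineDeriv_schwartz (m : Euc d) (ζ : 𝓢(Euc d, ℂ)) :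
    ∂_{m} ((ζ.toLp 2 volume : L2 d) : 𝓢'(Euc d, ℂ)) =
      (((∂_{m} ζ : 𝓢(Euc d, ℂ)).toLp 2 volume : L2 d) : 𝓢'(Euc d, ℂ)) := by
  rw [Lp.toTemperedDistribution_toLp_eq, Lp.toTemperedDistribution_toLp_eq,
    lineDerivOp_toTemperedDistributionCLM_eq]

theorem besselDerivOp_of_besselOp_eq_toLp {w : L2 d} {ζ : 𝓢(Euc d, ℂ)}
    (hw : besselOp d w = ζ.toLp 2 volume) (i : Fin d) :
    (2 * Real.pi * Complex.I) • besselDerivOp i w =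
      (∂_{EuclideanSpace.single i (1 : ℝ)} ζ : 𝓢(Euc d, ℂ)).toLp 2 volume := by
  refine toTD_injective ?_
  rw [toTD_smul, ← lineDeriv_besselOp, hw, toTD_lineDeriv_schwartz]

theorem besselOp_of_schwartz (ζ : 𝓢(Euc d, ℂ)) :
    besselOp d (besselOp d (ζ.toLp 2 volume) + ∑ i, besselDerivOp i ((2 * Real.pi * Complex.I)⁻¹ •
      (∂_{EuclideanSpace.single i (1 : ℝ)} ζ : 𝓢(Euc d, ℂ)).toLp 2 volume)) = ζ.toLp 2 volume :=
  besselOp_of_lineDeriv fun i => by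
    rw [toTD_smul, smul_inv_smul₀ two_pi_I_ne_zero, toTD_lineDeriv_schwartz]

theorem besselOp_besselOp_of_schwartz (ζ : 𝓢(Euc d, ℂ)) :
    besselOp d (besselOp d (ζ.toLp 2 volume -
      ((((2 * Real.pi) ^ 2)⁻¹ : ℝ) : ℂ) • (Δ ζ : 𝓢(Euc d, ℂ)).toLp 2 volume)) =
        ζ.toLp 2 volume := by
  have h : (((Δ ζ : 𝓢(Euc d, ℂ)).toLp 2 volume : L2 d) : 𝓢'(Euc d, ℂ)) =
      Δ ((ζ.toLp 2 volume : L2 d) : 𝓢'(Euc d, ℂ)) := by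
    rw [Lp.toTemperedDistribution_toLp_eq, Lp.toTemperedDistribution_toLp_eq,
      laplacian_toTemperedDistributionCLM_eq]
  exact (eq_besselOp_of_laplacian h).symm

theorem toLp_laplacian (ζ : 𝓢(Euc d, ℂ)) :
    ((Δ ζ : 𝓢(Euc d, ℂ)).toLp 2 volume : L2 d) = ∑ i : Fin d, (∂_{EuclideanSpace.single i (1 : ℝ)}
      (∂_{EuclideanSpace.single i (1 : ℝ)} ζ : 𝓢(Euc d, ℂ)) : 𝓢(Euc d, ℂ)).toLp 2 volume := by
  rw [show (Δ ζ : 𝓢(Euc d, ℂ)) = _ from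
    SchwartzMap.laplacian_eq_sum (EuclideanSpace.basisFun (Fin d) ℝ) ζ]
  have := map_sum (SchwartzMap.toLpCLM ℂ ℂ 2 (volume : Measure (Euc d)))
    (fun i => ∂_{EuclideanSpace.basisFun (Fin d) ℝ i}
      (∂_{EuclideanSpace.basisFun (Fin d) ℝ i} ζ : 𝓢(Euc d, ℂ))) Finset.univ
  simpa only [SchwartzMap.toLpCLM_apply, EuclideanSpace.basisFun_apply] using this

/-- The candidate potential is continuous in the pair (u, g), and the required identity is a closed
condition that holds for test functions. -/
theorem exists_besselOp_eq_of_mem_H10Gradient (hΩ : MeasurableSet Ω) {u : L2On Ω}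
    {g : Fin d → L2On Ω} (h : (u, g) ∈ H10Gradient Ω) :
    ∃ v, besselOp d v = extendZero Ω hΩ u := by
  let F : L2On Ω × (Fin d → L2On Ω) → L2 d := fun p => besselOp d (extendZero Ω hΩ p.1) +
    ∑ i, besselDerivOp i ((2 * Real.pi * Complex.I)⁻¹ • extendZero Ω hΩ (p.2 i))
  have hF : Continuous F := by
    have := (extendZero Ω hΩ).continuous
    fun_prop
  have hcl : IsClosed {p : L2On Ω × (Fin d → L2On Ω) |
      besselOp d (F p) = extendZero Ω hΩ p.1} :=
    isClosed_eq ((besselOp d).continuous.comp hF)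
      ((extendZero Ω hΩ).continuous.comp continuous_fst)
  refine ⟨F (u, g), closure_minimal ?_ hcl h⟩
  rintro ⟨p, q⟩ ⟨φ, hφ, h1, h2⟩
  have hext : ∀ {a : L2On Ω} {ζ : 𝓢(Euc d, ℂ)}, tsupport ζ ⊆ Ω → a =ᵐ[volume.restrict Ω] ζ →
      extendZero Ω hΩ a = ζ.toLp 2 volume := by
    intro a ζ hζ ha
    refine Lp.ext ?_
    filter_upwards [extendZero_ae hΩ a, ae_indicator_eq_of_ae_restrict hΩ ha, ζ.coeFn_toLp 2]
      with x h3 h4 h5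
    rw [h3, h4, h5]
    by_cases hx : x ∈ Ω
    · rw [Set.indicator_of_mem hx]
    · rw [Set.indicator_of_notMem hx, image_eq_zero_of_notMem_tsupport fun hx' => hx (hζ hx')]
  have e1 : extendZero Ω hΩ p = hφ.toSchwartz.toLp 2 volume := hext hφ.tsupport_subset h1
  have e2 : ∀ i, extendZero Ω hΩ (q i) =
      (∂_{EuclideanSpace.single i (1 : ℝ)} hφ.toSchwartz : 𝓢(Euc d, ℂ)).toLp 2 volume := fun i =>
    hext (by rw [coe_lineDeriv_schwartz]; exact (hφ.partialDeriv i).tsupport_subset)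
      (by rw [coe_lineDeriv_schwartz]; exact h2 i)
  change besselOp d (besselOp d (extendZero Ω hΩ p) +
    ∑ i, besselDerivOp i ((2 * Real.pi * Complex.I)⁻¹ • extendZero Ω hΩ (q i))) =
    extendZero Ω hΩ p
  simp only [e1, e2]
  exact besselOp_of_schwartz _

/-- The map v ↦ (Jv, ∇Jv), restricted to Ω, is continuous and sends test potentials to test gradient
pairs, hence closure to closure. -/
theorem exists_mem_H10Gradient_of_mem_closure {v : L2 d}
    (hv : v ∈ (testPotentials Ω).topologicalClosure) :
    ∃ g, (restrictOp Ω (besselOp d v), g) ∈ H10Gradient Ω := by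
  let F : L2 d → L2On Ω × (Fin d → L2On Ω) := fun v => (restrictOp Ω (besselOp d v),
    fun i => restrictOp Ω ((2 * Real.pi * Complex.I) • besselDerivOp i v))
  have hF : Continuous F := by fun_prop
  have hmaps : Set.MapsTo F (testPotentials Ω) (testGradientGraph Ω) := by
    rintro w ⟨φ, hφ, hw⟩
    have hw' : besselOp d w = hφ.toSchwartz.toLp 2 volume :=
      Lp.ext (hw.trans (hφ.toSchwartz.coeFn_toLp 2 volume).symm)
    refine ⟨φ, hφ, (restrictOp_ae _).trans (ae_restrict_of_ae hw), fun i => ?_⟩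
    refine (restrictOp_ae _).trans (ae_restrict_of_ae ?_)
    rw [besselDerivOp_of_besselOp_eq_toLp hw']
    refine (SchwartzMap.coeFn_toLp _ 2 volume).trans ?_
    rw [coe_lineDeriv_schwartz]
    rfl
  have h := map_mem_closure hF hv hmaps
  exact ⟨_, h⟩

end TestFunctions

/-! ### The Dirichlet eigenvalue equation in resolvent form -/

section DirichletResolvent

open TemperedDistribution
open scoped SchwartzMap LineDeriv ComplexConjugate Laplacian

variable {d : ℕ} {Ω : Set (Euc d)}

theorem inner_toSchwartz_extendZero (hΩ : MeasurableSet Ω) {φ : Euc d → ℂ}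
    (hφ : IsTestFunction Ω φ) (u : L2On Ω) :
    inner ℂ (hφ.toSchwartz.toLp 2 volume : L2 d) (extendZero Ω hΩ u) =
      ∫ x in Ω, u x * conj (φ x) :=
  inner_extendZero hΩ (hφ.toSchwartz.coeFn_toLp 2 volume) u

theorem inner_laplacian_extendZero (hΩ : MeasurableSet Ω) {φ : Euc d → ℂ}
    (hφ : IsTestFunction Ω φ) (u : L2On Ω) :
    inner ℂ ((Δ hφ.toSchwartz : 𝓢(Euc d, ℂ)).toLp 2 volume : L2 d) (extendZero Ω hΩ u) =
      ∑ i, ∫ x in Ω, u x * partialDeriv i (partialDeriv i fun y => conj (φ y)) x := by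
  rw [toLp_laplacian, sum_inner]
  refine Finset.sum_congr rfl fun i _ => ?_
  rw [inner_extendZero hΩ (ψ := partialDeriv i (partialDeriv i φ))]
  · refine integral_congr_ae (Eventually.of_forall fun x => ?_)
    simp only
    rw [funext fun y => partialDeriv_conj i φ y, partialDeriv_conj]
  · refine (SchwartzMap.coeFn_toLp _ 2 volume).trans ?_
    rw [coe_lineDeriv_schwartz, coe_lineDeriv_schwartz]
    rfl

/-- A second integration by parts eliminates g and leaves a condition on u alone. Conjugating the
test function matches the bilinear integrals with the sesquilinear inner product. -/
theorem weak_dirichlet_iff (hΩ : MeasurableSet Ω) {u : L2On Ω} {g : Fin d → L2On Ω}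
    (hg : (u, g) ∈ H10Gradient Ω) (c : ℂ) :
    (∀ φ : Euc d → ℂ, IsTestFunction Ω φ →
      ∑ i, ∫ x in Ω, g i x * partialDeriv i φ x = ∫ x in Ω, (c • u : L2On Ω) x * φ x) ↔
    ∀ (φ : Euc d → ℂ) (hφ : IsTestFunction Ω φ),
      -inner ℂ ((Δ hφ.toSchwartz : 𝓢(Euc d, ℂ)).toLp 2 volume : L2 d) (extendZero Ω hΩ u) =
        c * inner ℂ (hφ.toSchwartz.toLp 2 volume : L2 d) (extendZero Ω hΩ u) := by
  have hleft : ∀ φ : Euc d → ℂ, IsTestFunction Ω φ →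
      ∑ i, ∫ x in Ω, g i x * partialDeriv i φ x =
        -∑ i, ∫ x in Ω, u x * partialDeriv i (partialDeriv i φ) x := by
    intro φ hφ
    rw [← Finset.sum_neg_distrib]
    exact Finset.sum_congr rfl fun i _ => H10Gradient.weak hg (hφ.partialDeriv i) i
  have hright : ∀ φ : Euc d → ℂ,
      ∫ x in Ω, (c • u : L2On Ω) x * φ x = c * ∫ x in Ω, u x * φ x := by
    intro φ
    rw [← integral_const_mul]
    refine integral_congr_ae ?_
    filter_upwards [Lp.coeFn_smul c u] with x hx
    rw [hx, Pi.smul_apply, smul_eq_mul, mul_assoc]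
  constructor
  · intro h φ hφ
    have h1 := h _ hφ.conj
    rw [hleft _ hφ.conj, hright] at h1
    rw [inner_laplacian_extendZero, inner_toSchwartz_extendZero, h1]
  · intro h φ hφ
    have h1 := h _ hφ.conj
    rw [inner_laplacian_extendZero, inner_toSchwartz_extendZero] at h1
    simp only [Complex.conj_conj] at h1
    rw [hleft φ hφ, hright, h1]

/-- The subspace of `L²(ℝ^d)` of elements whose Bessel potential vanishes outside `Ω`. -/
theorem HasC1Boundary.ker_eq_closure_testPotentials (hC : HasC1Boundary Ω) (hΩ : IsOpen Ω)
    (hb : Bornology.IsBounded Ω) :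
    (charOp Ωᶜ hΩ.measurableSet.compl ∘L besselOp d).ker =
      (testPotentials Ω).topologicalClosure := by
  refine le_antisymm (fun v hv => ?_) ?_
  · exact hC.mem_closure_testPotentials hΩ hb (ae_eq_zero_of_charOp_compl hΩ.measurableSet hv)
  · refine Submodule.topologicalClosure_minimal _ ?_
      (charOp Ωᶜ hΩ.measurableSet.compl ∘L besselOp d).isClosed_ker
    rintro w ⟨φ, hφ, hw⟩
    refine (Lp.eq_zero_iff_ae_eq_zero).mpr ?_
    filter_upwards [charOp_ae hΩ.measurableSet.compl (besselOp d w), hw] with x h1 h2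
    refine h1.trans ?_
    by_cases hx : x ∈ Ω
    · simp [hx]
    · simp [hx, h2, image_eq_zero_of_notMem_tsupport fun hx' => hx (hφ.tsupport_subset hx')]

/-- If Jw = φ then w = J(φ - Δφ/κ). Symmetry of J gives ⟨w, v⟩ = ⟨φ - Δφ/κ, e⟩ and ⟨w, Je⟩ = ⟨φ, e⟩,
so orthogonality to all such w is the equation -Δe = ce tested in Ω. -/
theorem inner_eq_zero_testPotentials_iff {v e : L2 d} (hv : besselOp d v = e) (c : ℝ) :
    ((((2 * Real.pi) ^ 2 : ℝ) : ℂ) • v - ((c + (2 * Real.pi) ^ 2 : ℝ) : ℂ) • besselOp d e ∈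
      (testPotentials Ω)ᗮ) ↔
    ∀ (φ : Euc d → ℂ) (hφ : IsTestFunction Ω φ),
      -inner ℂ ((Δ hφ.toSchwartz : 𝓢(Euc d, ℂ)).toLp 2 volume : L2 d) e =
        c * inner ℂ (hφ.toSchwartz.toLp 2 volume : L2 d) e := by
  set κ : ℝ := (2 * Real.pi) ^ 2 with hκ
  have hκ0 : (κ : ℂ) ≠ 0 := by
    rw [Complex.ofReal_ne_zero]; positivity
  have hsymm := (isSelfAdjoint_besselOp d).isSymmetric
  have key : ∀ ζ : 𝓢(Euc d, ℂ), ∀ w : L2 d, besselOp d w = ζ.toLp 2 volume →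
      inner ℂ w ((κ : ℂ) • v - ((c + κ : ℝ) : ℂ) • besselOp d e) =
        -inner ℂ ((Δ ζ : 𝓢(Euc d, ℂ)).toLp 2 volume : L2 d) e -
          c * inner ℂ (ζ.toLp 2 volume : L2 d) e := by
    intro ζ w hw
    have h1 := besselOp_injective d (hw.trans (besselOp_besselOp_of_schwartz ζ).symm)
    have h2 : inner ℂ w (besselOp d e) = inner ℂ (ζ.toLp 2 volume : L2 d) e := by
      rw [← hw]; exact (hsymm w e).symm
    have h3 : inner ℂ w v = inner ℂ (ζ.toLp 2 volume : L2 d) e -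
        (κ : ℂ)⁻¹ * inner ℂ ((Δ ζ : 𝓢(Euc d, ℂ)).toLp 2 volume : L2 d) e := by
      rw [h1, ← hv]
      refine (hsymm _ v).trans ?_
      rw [inner_sub_left, inner_smul_left, Complex.conj_ofReal, Complex.ofReal_inv]
      rfl
    rw [inner_sub_right, inner_smul_right, inner_smul_right, h2, h3, mul_sub,
      mul_inv_cancel_left₀ hκ0]
    push_cast
    ring
  rw [Submodule.mem_orthogonal]
  constructor
  · intro h φ hφ
    have h1 := key hφ.toSchwartz _ (besselOp_besselOp_of_schwartz hφ.toSchwartz)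
    rw [h _ ⟨φ, hφ, ?_⟩] at h1
    · exact sub_eq_zero.mp h1.symm
    · rw [besselOp_besselOp_of_schwartz]
      exact hφ.toSchwartz.coeFn_toLp 2 volume
  · rintro h w ⟨φ, hφ, hw⟩
    rw [key hφ.toSchwartz w (Lp.ext (hw.trans (hφ.toSchwartz.coeFn_toLp 2 volume).symm)), h φ hφ,
      sub_self]

/-- The resolvent of the Dirichlet Laplacian, extended by zero to `L²(ℝ^d)`. -/
def dirichletResolvent (Ω : Set (Euc d)) (hΩ : IsOpen Ω) : L2 d →L[ℂ] L2 d :=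
  constrainedResolvent (besselOp d) (charOp Ωᶜ hΩ.measurableSet.compl ∘L besselOp d)

theorem dirichletResolvent_apply (hΩ : IsOpen Ω) (u : L2 d) :
    dirichletResolvent Ω hΩ u = besselOp d
      ((charOp Ωᶜ hΩ.measurableSet.compl ∘L besselOp d).ker.starProjection (besselOp d u)) := by
  have : ContinuousLinearMap.adjoint (besselOp d) = besselOp d := isSelfAdjoint_besselOp d
  change besselOp d ((charOp Ωᶜ hΩ.measurableSet.compl ∘L besselOp d).ker.starProjection
    (ContinuousLinearMap.adjoint (besselOp d) u)) = _
  rw [this]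

/-- For v in V the weak equation for Jv says that κv - (λ + κ)J²v is orthogonal to the test
potentials, which are dense in V. Projecting to V gives κv = (λ + κ)PJ²v, and the injective J turns
this into the equation for Jv. -/
theorem HasC1Boundary.mem_eigenspace_dirichletLaplacian_iff (hC : HasC1Boundary Ω) (hΩ : IsOpen Ω)
    (hb : Bornology.IsBounded Ω) (lam : ℝ) (w : L2 d) :
    w ∈ (eigenspace (dirichletLaplacian Ω) (lam : ℂ)).map
        (extendZero Ω hΩ.measurableSet).toLinearMap ↔
      (((2 * Real.pi) ^ 2 : ℝ) : ℂ) • w = ((lam + (2 * Real.pi) ^ 2 : ℝ) : ℂ) •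
        dirichletResolvent Ω hΩ w := by
  set κ : ℝ := (2 * Real.pi) ^ 2 with hκ
  have hκ0 : (κ : ℂ) ≠ 0 := by
    rw [Complex.ofReal_ne_zero]; positivity
  set V := (charOp Ωᶜ hΩ.measurableSet.compl ∘L besselOp d).ker with hV
  have hVcl : V = (testPotentials Ω).topologicalClosure := hC.ker_eq_closure_testPotentials hΩ hb
  have hVmem : ∀ v, v ∈ V ↔ charOp Ωᶜ hΩ.measurableSet.compl (besselOp d v) = 0 := fun v => Iff.rfl
  have key : ∀ v, v ∈ V → ((κ : ℂ) • v - ((lam + κ : ℝ) : ℂ) • besselOp d (besselOp d v) ∈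
      (testPotentials Ω)ᗮ ↔ (κ : ℂ) • besselOp d v = ((lam + κ : ℝ) : ℂ) •
        dirichletResolvent Ω hΩ (besselOp d v)) := by
    intro v hv
    rw [← Submodule.orthogonal_closure, ← hVcl, ← Submodule.starProjection_apply_eq_zero_iff,
      map_sub, map_smul, map_smul, sub_eq_zero, Submodule.starProjection_eq_self_iff.mpr hv,
      dirichletResolvent_apply, ← (besselOp_injective d).eq_iff, map_smul, map_smul]
  have hgraph : ∀ u : L2On Ω, u ∈ eigenspace (dirichletLaplacian Ω) (lam : ℂ) ↔
      (u, (lam : ℂ) • u) ∈ dirichletGraph Ω := by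
    intro u
    rw [← dirichletLaplacian_graph hΩ]; rfl
  constructor
  · rintro ⟨u, hu, rfl⟩
    obtain ⟨g, hg, hgu⟩ := (hgraph u).mp hu
    obtain ⟨v, hv⟩ := exists_besselOp_eq_of_mem_H10Gradient hΩ.measurableSet hg
    have hvV : v ∈ V := by
      rw [hVmem, hv, charOp_compl_extendZero]
    change (κ : ℂ) • extendZero Ω hΩ.measurableSet u = _ • dirichletResolvent Ω hΩ
      (extendZero Ω hΩ.measurableSet u)
    rw [← hv, ← key v hvV, inner_eq_zero_testPotentials_iff rfl, hv]
    exact (weak_dirichlet_iff hΩ.measurableSet hg _).mp hgu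
  · intro h
    -- The potential is read off from the hypothesis, which says w = ((λ + κ)/κ)JPJw.
    set v : L2 d := ((κ : ℂ)⁻¹ * ((lam + κ : ℝ) : ℂ)) • V.starProjection (besselOp d w) with hv
    have hvV : v ∈ V := V.smul_mem _ (V.starProjection_apply_mem _)
    have hw : besselOp d v = w := by
      rw [hv, map_smul, ← dirichletResolvent_apply hΩ, mul_smul, ← h, inv_smul_smul₀ hκ0]
    have hext : extendZero Ω hΩ.measurableSet (restrictOp Ω w) = w :=
      extendZero_restrictOp hΩ.measurableSet (by rw [← hw]; exact hvV)
    refine ⟨restrictOp Ω w, (hgraph _).mpr ?_, hext⟩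
    obtain ⟨g, hg⟩ := exists_mem_H10Gradient_of_mem_closure (Ω := Ω) (hVcl ▸ hvV)
    rw [hw] at hg
    refine ⟨g, hg, (weak_dirichlet_iff hΩ.measurableSet hg _).mpr ?_⟩
    rw [hext, ← hw]
    refine (inner_eq_zero_testPotentials_iff rfl lam).mp ((key v hvV).mpr ?_)
    rw [hw]
    exact h

end DirichletResolvent

/-! ### Positivity of the limit form and convergence of the resolvents -/

section Convergence

open Module

variable {d : ℕ} {Ω : Set (Euc d)}

/-- For d ≥ 1 there are n distinct points in Ω. The indicators of disjoint neighbourhoods of them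
are orthogonal, and nonzero because each neighbourhood meets Ω in a nonempty open set. -/
theorem exists_linearIndependent_L2On (hd : 1 ≤ d) (hΩ : IsOpen Ω) (hb : Bornology.IsBounded Ω)
    (hne : Ω.Nonempty) (n : ℕ) : ∃ f : Fin n → L2On Ω, LinearIndependent ℂ f := by
  have : Nonempty (Fin d) := ⟨⟨0, hd⟩⟩
  have : IsFiniteMeasure ((volume : Measure (Euc d)).restrict Ω) :=
    ⟨by rw [Measure.restrict_apply_univ]; exact hb.measure_lt_top⟩
  obtain ⟨x₀, hx₀⟩ := hne
  have hinf : Ω.Infinite := infinite_of_mem_nhds x₀ (hΩ.mem_nhds hx₀)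
  obtain ⟨s, hs, hcard⟩ := hinf.exists_subset_card_eq n
  obtain ⟨U, hU, hdisj⟩ := s.finite_toSet.t2_separation
  let F : s → L2On Ω := fun x => indicatorConstLp 2 (hU x).2.measurableSet (measure_ne_top _ _) 1
  have hF : LinearIndependent ℂ F := by
    refine linearIndependent_of_ne_zero_of_inner_eq_zero (fun x h0 => ?_) fun x y hxy => ?_
    · have hpos : (volume.restrict Ω) (U x) ≠ 0 := by
        rw [Measure.restrict_apply (hU x).2.measurableSet]
        exact (((hU x).2.inter hΩ).measure_pos volume ⟨x, (hU x).1, hs x.2⟩).ne'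
      have h1 : ‖F x‖ = 0 := by rw [h0, norm_zero]
      rw [norm_indicatorConstLp (by norm_num) (by norm_num), norm_one, one_mul] at h1
      have := Real.rpow_eq_zero (x := (volume.restrict Ω).real (U x)) measureReal_nonneg
        (y := 1 / (2 : ENNReal).toReal) (by norm_num)
      rw [this, measureReal_def, ENNReal.toReal_eq_zero_iff] at h1
      exact h1.elim hpos (measure_ne_top _ _)
    · change inner ℂ (F x) (F y) = 0
      rw [L2.inner_indicatorConstLp_one, setIntegral_indicatorConstLp (hU x).2.measurableSet,
        (hdisj y.2 x.2 fun h => hxy (Subtype.ext h.symm)).inter_eq]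
      simp
  have e : Fin n ≃ s := (Fintype.equivFinOfCardEq (by simpa using hcard)).symm
  exact ⟨F ∘ e, hF.comp _ e.injective⟩

/-- The hypothesis says that Jf is orthogonal to all test potentials; by symmetry of J, f is
orthogonal to all test functions. -/
theorem HasC1Boundary.starProjection_besselOp_extendZero_eq_zero (hC : HasC1Boundary Ω)
    (hΩ : IsOpen Ω) (hb : Bornology.IsBounded Ω) {f : L2On Ω}
    (hf : (charOp Ωᶜ hΩ.measurableSet.compl ∘L besselOp d).ker.starProjection
      (besselOp d (extendZero Ω hΩ.measurableSet f)) = 0) : f = 0 := by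
  rw [Submodule.starProjection_apply_eq_zero_iff, hC.ker_eq_closure_testPotentials hΩ hb,
    Submodule.orthogonal_closure, Submodule.mem_orthogonal] at hf
  refine eq_zero_of_test hΩ f fun φ hφ => ?_
  have hmem := besselOp_besselOp_of_schwartz hφ.conj.toSchwartz
  have h1 := hf _ ⟨_, hφ.conj, by
    rw [hmem]
    exact hφ.conj.toSchwartz.coeFn_toLp 2 volume⟩
  have h2 := (isSelfAdjoint_besselOp d).isSymmetric (besselOp d (hφ.conj.toSchwartz.toLp 2 volume -
    ((((2 * Real.pi) ^ 2)⁻¹ : ℝ) : ℂ) •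
      (Laplacian.laplacian hφ.conj.toSchwartz : SchwartzMap (Euc d) ℂ).toLp 2 volume))
    (extendZero Ω hΩ.measurableSet f)
  have h3 := h2.trans h1
  change inner ℂ (besselOp d (besselOp d _)) _ = 0 at h3
  rw [hmem, inner_toSchwartz_extendZero] at h3
  simpa using h3

/-- The form of R₀ is ‖PJu‖², and PJ is injective on extensions by zero, hence bounded below on a
finite-dimensional space of them. This makes every max-min value of R₀ positive. -/
theorem HasC1Boundary.exists_pos_le_reApplyInnerSelf (hd : 1 ≤ d) (hC : HasC1Boundary Ω)
    (hΩ : IsOpen Ω) (hb : Bornology.IsBounded Ω) (hne : Ω.Nonempty) (n : ℕ) :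
    ∃ S : Submodule ℂ (L2 d), n ≤ finrank ℂ S ∧ ∃ t > 0, ∀ u ∈ S,
      t * ‖u‖ ^ 2 ≤ (dirichletResolvent Ω hΩ).reApplyInnerSelf u := by
  obtain ⟨f, hf⟩ := exists_linearIndependent_L2On hd hΩ hb hne n
  set E : L2On Ω →ₗ[ℂ] L2 d := (extendZero Ω hΩ.measurableSet).toLinearMap with hE
  have hEinj : Function.Injective E := (extendZero Ω hΩ.measurableSet).injective
  have hEf : LinearIndependent ℂ (E ∘ f) := hf.map' E (LinearMap.ker_eq_bot.mpr hEinj)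
  set S := Submodule.span ℂ (Set.range (E ∘ f)) with hS
  have hfin : FiniteDimensional ℂ S := FiniteDimensional.span_of_finite ℂ (Set.finite_range _)
  have hSE : ∀ u ∈ S, ∃ a, E a = u := fun u hu => by
    have : S ≤ LinearMap.range E := Submodule.span_le.mpr (by
      rintro _ ⟨i, rfl⟩
      exact ⟨f i, rfl⟩)
    exact this hu
  refine ⟨S, by rw [hS, finrank_span_eq_card hEf, Fintype.card_fin], ?_⟩
  set L : L2 d →L[ℂ] L2 d := (charOp Ωᶜ hΩ.measurableSet.compl ∘L besselOp d).ker.starProjection ∘L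
    besselOp d with hL
  have hker : LinearMap.ker (L.toLinearMap ∘ₗ S.subtype) = ⊥ := by
    rw [LinearMap.ker_eq_bot']
    rintro ⟨u, hu⟩ h0
    obtain ⟨a, rfl⟩ := hSE u hu
    have := hC.starProjection_besselOp_extendZero_eq_zero hΩ hb (f := a) h0
    subst this
    exact Subtype.ext (map_zero E)
  obtain ⟨K, hK, hanti⟩ := LinearMap.exists_antilipschitzWith _ hker
  have hK' : (0 : ℝ) < K := hK
  refine ⟨((K : ℝ) ^ 2)⁻¹, by positivity, fun u hu => ?_⟩
  have h1 : ‖u‖ ≤ K * ‖L u‖ := by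
    have := hanti.le_mul_dist ⟨u, hu⟩ 0
    simpa [dist_eq_norm] using this
  have h2 : (dirichletResolvent Ω hΩ).reApplyInnerSelf u = ‖L u‖ ^ 2 := by
    have h3 : ContinuousLinearMap.adjoint (besselOp d) = besselOp d := isSelfAdjoint_besselOp d
    have h4 := reApplyInnerSelf_constrainedResolvent (besselOp d)
      (charOp Ωᶜ hΩ.measurableSet.compl ∘L besselOp d) u
    rw [h3] at h4
    exact h4
  rw [h2, inv_mul_le_iff₀ (by positivity), ← mul_pow]
  gcongr

theorem isCompactOperator_besselOp_sub (hΩ : IsOpen Ω) (hb : Bornology.IsBounded Ω) :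
    IsCompactOperator (besselOp d - charOp Ωᶜ hΩ.measurableSet.compl ∘L besselOp d) := by
  have h : besselOp d - charOp Ωᶜ hΩ.measurableSet.compl ∘L besselOp d =
      charOp Ω hΩ.measurableSet ∘L besselOp d := by
    ext1 u
    exact sub_eq_of_eq_add (charOp_add_charOp_compl hΩ.measurableSet (besselOp d u)).symm
  rw [h]
  exact isCompactOperator_charOp_besselOp hΩ.measurableSet hb

theorem tendsto_norm_wellResolvent_sub (hΩ : IsOpen Ω) (hb : Bornology.IsBounded Ω) :
    Tendsto (fun t => ‖wellResolvent Ω hΩ t - dirichletResolvent Ω hΩ‖) atTop (𝓝 0) := by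
  refine tendsto_of_seq_tendsto fun t ht => ?_
  -- The maximum with 1 makes the sequence positive at every index without changing its tail.
  have h1 := tendsto_norm_penalizedResolvent_sub (isCompactOperator_besselOp_sub hΩ hb)
    (t := fun k => max (t k) 1) (fun k => by positivity)
    (tendsto_atTop_mono (fun k => le_max_left _ _) ht)
  refine h1.congr' ?_
  filter_upwards [ht.eventually_ge_atTop 1] with k hk
  rw [max_eq_left hk]
  rfl

/-- With K compact this is the hypothesis of the spectral lemmas for δ = ‖A - K‖: the part of the
form above δ is controlled by a compact operator. -/
theorem reApplyInnerSelf_le_add (A K : L2 d →L[ℂ] L2 d) (u : L2 d) :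
    A.reApplyInnerSelf u ≤ ‖K u‖ * ‖u‖ + ‖A - K‖ * ‖u‖ ^ 2 := by
  have h1 : A.reApplyInnerSelf u = K.reApplyInnerSelf u + (A - K).reApplyInnerSelf u := by
    simp only [ContinuousLinearMap.reApplyInnerSelf_apply, sub_apply, inner_sub_left, map_sub]
    ring
  rw [h1]
  refine add_le_add ?_ ((le_abs_self _).trans (abs_reApplyInnerSelf_le _ _))
  exact (RCLike.re_le_norm _).trans (norm_inner_le_norm _ _)

end Convergence

end ParticleInWell

end

/-! ### Convergence of the eigenvalues -/

open ParticleInWell in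
theorem proposition2p5 (d : ℕ) (hd : 1 ≤ d) (Ω : Set (EuclideanSpace ℝ (Fin d)))
    (hΩ_open : IsOpen Ω) (hΩ_bdd : Bornology.IsBounded Ω) (hΩ_ne : Ω.Nonempty)
    (hΩ_C1 : ParticleInWell.HasC1Boundary Ω) (n : ℕ) (hn : 1 ≤ n) :
    ∃ (lamD : ℝ) (lam : ℝ → ℝ),
      ParticleInWell.IsNthEigenvalue (ParticleInWell.dirichletLaplacian Ω) n lamD ∧
      (∃ h₀ : ℝ, 0 < h₀ ∧ ∀ h : ℝ, 0 < h → h ≤ h₀ →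
        ParticleInWell.IsNthEigenvalue (ParticleInWell.wellOperator Ω h) n (lam h) ∧
        lam h ≤ 1 / 2 * (h ^ 2)⁻¹) ∧
      Tendsto lam (𝓝[>] 0) (𝓝 lamD) := by
  set κ : ℝ := (2 * Real.pi) ^ 2 with hκ
  have hκ0 : 0 < κ := by positivity
  set R₀ := dirichletResolvent Ω hΩ_open with hR₀
  set R : ℝ → L2 d →L[ℂ] L2 d := fun h => wellResolvent Ω hΩ_open ((κ * h ^ 2)⁻¹) with hR
  obtain ⟨S, hS, t, ht0, ht⟩ := hΩ_C1.exists_pos_le_reApplyInnerSelf hd hΩ_open hΩ_bdd hΩ_ne n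
  have hm0 : 0 < maxMin R₀ n := ht0.trans_le (le_csSup (bddAbove_minLevels R₀ hn) ⟨S, hS, ht⟩)
  have hR₀c : IsCompactOperator R₀ :=
    isCompactOperator_constrainedResolvent (isCompactOperator_besselOp_sub hΩ_open hΩ_bdd)
  have hinv : Tendsto (fun h : ℝ => (h ^ 2)⁻¹) (𝓝[>] 0) atTop := by
    refine Tendsto.inv_tendsto_nhdsGT_zero (tendsto_nhdsWithin_iff.mpr ⟨?_, ?_⟩)
    · refine tendsto_nhdsWithin_of_tendsto_nhds ?_
      have : Continuous fun h : ℝ => h ^ 2 := by fun_prop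
      simpa using this.tendsto 0
    · filter_upwards [self_mem_nhdsWithin] with h hh
      exact pow_pos (Set.mem_Ioi.mp hh) 2
  have hnorm : Tendsto (fun h => ‖R h - R₀‖) (𝓝[>] 0) (𝓝 0) := by
    refine (tendsto_norm_wellResolvent_sub hΩ_open hΩ_bdd).comp ?_
    simp only [mul_inv]
    exact hinv.const_mul_atTop (by positivity)
  have hm : Tendsto (fun h => maxMin (R h) n) (𝓝[>] 0) (𝓝 (maxMin R₀ n)) := by
    rw [tendsto_iff_norm_sub_tendsto_zero]
    exact squeeze_zero (fun _ => norm_nonneg _) (fun h => abs_maxMin_sub_le (R h) R₀ hn hS) hnorm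
  have hlam : Tendsto (fun h => κ / maxMin (R h) n - κ) (𝓝[>] 0) (𝓝 (κ / maxMin R₀ n - κ)) :=
    (tendsto_const_nhds.div hm hm0.ne').sub tendsto_const_nhds
  refine ⟨κ / maxMin R₀ n - κ, fun h => κ / maxMin (R h) n - κ, ?_, ?_, hlam⟩
  -- R₀ is itself compact, so δ = 0 is allowed and positivity of the max-min value suffices.
  · refine isNthEigenvalue_of_maxMin (R := R₀)
      (ι := (extendZero Ω hΩ_open.measurableSet).toLinearMap)
      (extendZero Ω hΩ_open.measurableSet).injective (isSelfAdjoint_constrainedResolvent _ _)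
      (fun u => ?_) hκ0 (hΩ_C1.mem_eigenspace_dirichletLaplacian_iff hΩ_open hΩ_bdd) hR₀c le_rfl
      (fun u => ?_) hn hm0 hS
    · exact (sq_nonneg _).trans_eq (reApplyInnerSelf_constrainedResolvent _ _ u).symm
    · simpa using reApplyInnerSelf_le_add R₀ R₀ u
  · have hev : ∀ᶠ h in 𝓝[>] (0 : ℝ), ‖R h - R₀‖ < maxMin (R h) n ∧
        κ / maxMin (R h) n - κ ≤ 1 / 2 * (h ^ 2)⁻¹ := by
      filter_upwards [hnorm.eventually_lt hm hm0, hlam.eventually_le_const (lt_add_one _),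
        (hinv.const_mul_atTop (show (0 : ℝ) < 1 / 2 by norm_num)).eventually_ge_atTop
          (κ / maxMin R₀ n - κ + 1)] with h h1 h2 h3
      exact ⟨h1, h2.trans h3⟩
    obtain ⟨h₀, hh₀, hsub⟩ := mem_nhdsGT_iff_exists_Ioc_subset.mp hev
    refine ⟨h₀, hh₀, fun h h0 hle => ⟨?_, (hsub ⟨h0, hle⟩).2⟩⟩
    refine isNthEigenvalue_of_maxMin (ι := LinearMap.id) Function.injective_id
      (isSelfAdjoint_penalizedResolvent _ _ (by positivity))
      (reApplyInnerSelf_penalizedResolvent_nonneg _ _ (by positivity)) hκ0 (fun lam u => ?_) hR₀c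
      (norm_nonneg _) (reApplyInnerSelf_le_add (R h) R₀) hn (hsub ⟨h0, hle⟩).1 hS
    rw [Submodule.map_id]
    exact mem_eigenspace_wellOperator_iff hΩ_open h lam u
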